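/- Let $n\ge 1$, $m\ge 0$. Fix $\chi\in C_c^\infty(\mathbb R^n;\mathbb R)$ with $\chi(\xi)=1$ for $|\xi|\le 1$ and $\chi(\xi)=0$ for $|\xi|\ge 2$. For a $\mathbb C^m$-valued tempered distribution $u$ on $\mathbb R^n$ and dyadic $\lambda\in\{1,2,4,\dots\}$ let $u_\lambda=S_\lambda u$ be its Littlewood–Paley pieces, $S_1=\chi(D)$ and $S_\lambda=\chi(D/\lambda)-\chi(2D/\lambda)$ for $\lambda\ge 2$, where $D=-i\nabla$, and let $u_{\le 1}=u_1$, $u_{>1}=u-u_1$. For $\mu>0$ put $$\|v\|_{\mathcal DL^2_\mu}=\sup_{x_0\in\mathbb R^n}\ \sup_{\omega\in\mathbb S^{n-1}}\ \sum_{k\in\mathbb N}\big\|1_{\{|\mu^{-1}(x-x_0)-k\omega|<1\}}\,v\big\|_{L^2},\qquad \|v\|_{\mathcal DL^2}=\|v\|_{\mathcal DL^2_1},$$ $$\|u\|_{\mathcal DH^s}^2=\sum_{\lambda\ge 1\ \mathrm{dyadic}}\lambda^{2s}\,\|u_\lambda\|_{\mathcal DL^2_\lambda}^2 ,$$ with the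 convention that $\|\cdot\|_{\mathcal DL^2_\mu}$ and $\|\cdot\|_{L^\infty}$ are infinite for a distribution that is not a function. Let $s>\frac n2$. Then there is a constant $C=C(n,m,s,\chi)$ such that for every tempered distribution $u_0$ with $M=\|u_0\|_{\mathcal DH^s}<\infty$ and every $0<\varepsilon\le 1$ the rescaled data $u_0^\varepsilon(x)=\varepsilon u_0(\varepsilon x)$ satisfies $$\|u^\varepsilon_{0,\le 1}\|_{L^\infty}+\|u^\varepsilon_{0,>1}\|_{L^\infty}\le C\varepsilon M,$$ $$\|u^\varepsilon_{0,\le 1}\|_{\mathcal DL^2}\le CM,\qquad \|u^\varepsilon_{0,>1}\|_{\mathcal DH^s}\le C\varepsilon^{s-\frac n2}M,$$ $$\|\nabla u^\varepsilon_{0,\le 1}\|_{\mathcal DL^2}\le C\max\{\varepsilon,\varepsilon^{s-\frac n2}\}M\quad\text{if } s\ne\tfrac n2+1,\qquad \|\nabla u^\varepsilon_{0,\le 1}\|_{\mathcal DL^2}\le C\varepsilon(1+|\ln\varepsilon|)M\quad\text{if } s=\tfrac n2+1 .$$ -/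

import Mathlib

open MeasureTheory
open scoped ENNReal NNReal SchwartzMap LineDeriv

noncomputable section

namespace DLSpace

/-- `ℝⁿ` with its Euclidean structure. -/
abbrev Rn (n : ℕ) : Type := EuclideanSpace ℝ (Fin n)

/-- `ℂᵐ` with its Hermitian structure. -/
abbrev Cm (m : ℕ) : Type := EuclideanSpace ℂ (Fin m)

/-- The smooth cutoff generating a Littlewood-Paley decomposition of `ℝⁿ`. -/
structure LPCutoff (n : ℕ) where
  toFun : Rn n → ℝ
  smooth : ContDiff ℝ ((⊤ : ℕ∞) : WithTop ℕ∞) toFun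
  eq_one : ∀ ξ, ‖ξ‖ ≤ 1 → toFun ξ = 1
  eq_zero : ∀ ξ, 2 ≤ ‖ξ‖ → toFun ξ = 0

/-- The symbol of `S_{≤ 2 ^ j}`. Mathlib's Fourier variable `ξ` belongs to the exponential
`exp (2 π i x·ξ)`, so `2 π ξ` is the frequency in the convention `exp (i x·ξ)`. -/
def LPCutoff.lowSymbol {n : ℕ} (χ : LPCutoff n) (j : ℕ) (ξ : Rn n) : ℂ :=
  (χ.toFun ((2 * Real.pi / 2 ^ j : ℝ) • ξ) : ℂ)

/-- The symbol of `S_λ` for `λ = 2 ^ j`; all the frequencies below `1` go into `j = 0`. -/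
def LPCutoff.dyadicSymbol {n : ℕ} (χ : LPCutoff n) : ℕ → Rn n → ℂ
  | 0 => χ.lowSymbol 0
  | j + 1 => fun ξ => χ.lowSymbol (j + 1) ξ - χ.lowSymbol j ξ

/-- The Littlewood-Paley piece `u_λ = S_λ u`, `λ = 2 ^ j`, of a tempered distribution. -/
def LPCutoff.piece {n m : ℕ} (χ : LPCutoff n) (j : ℕ) (u : 𝓢'(Rn n, Cm m)) :
    𝓢'(Rn n, Cm m) :=
  TemperedDistribution.fourierMultiplierCLM (Cm m) (χ.dyadicSymbol j) u

/-- The low frequency part `u_{≤ 1} = u_1`. -/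
def LPCutoff.low {n m : ℕ} (χ : LPCutoff n) (u : 𝓢'(Rn n, Cm m)) : 𝓢'(Rn n, Cm m) :=
  χ.piece 0 u

/-- The high frequency part `u_{> 1} = u - u_{≤ 1}`. -/
def LPCutoff.high {n m : ℕ} (χ : LPCutoff n) (u : 𝓢'(Rn n, Cm m)) : 𝓢'(Rn n, Cm m) :=
  u - χ.low u

/-- The tempered distribution `u` is the function `g`. -/
def IsFunction {n m : ℕ} (u : 𝓢'(Rn n, Cm m)) (g : Rn n → Cm m) : Prop :=
  ∀ φ : 𝓢(Rn n, ℂ), Integrable (fun x => φ x • g x) ∧ u φ = ∫ x, φ x • g x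

/-- The norm `sup_{x₀} sup_ω ∑_k ‖1_{|μ⁻¹ (x - x₀) - k ω| < 1} g‖_{L²}` of a function `g`. -/
def dlFun {n : ℕ} {G : Type*} [NormedAddCommGroup G] (μ : ℝ) (g : Rn n → G) : ℝ≥0∞ :=
  ⨆ (x₀ : Rn n) (ω : Metric.sphere (0 : Rn n) 1),
    ∑' k : ℕ, eLpNorm
      (Set.indicator {x : Rn n | ‖μ⁻¹ • (x - x₀) - (k : ℝ) • (ω : Rn n)‖ < 1} g) 2 volume

/-- The `𝒟L²_μ` norm of a tempered distribution, infinite if it is not a function. The function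
is unique up to null sets, so the infimum is over equal values. -/
def dlNorm {n m : ℕ} (μ : ℝ) (u : 𝓢'(Rn n, Cm m)) : ℝ≥0∞ :=
  ⨅ (g : Rn n → Cm m) (_ : IsFunction u g), dlFun μ g

/-- The `𝒟L²_μ` norm of the distributional gradient, with pointwise size
`(∑ i, |∂ᵢ u (x)|²) ^ (1/2)`; infinite if some `∂ᵢ u` is not a function. -/
def dlGradNorm {n m : ℕ} (μ : ℝ) (u : 𝓢'(Rn n, Cm m)) : ℝ≥0∞ :=
  ⨅ (g : Fin n → Rn n → Cm m)
    (_ : ∀ i, IsFunction (∂_{EuclideanSpace.single i (1 : ℝ)} u) (g i)),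
    dlFun μ (fun x => (WithLp.toLp 2 (fun i => g i x) : PiLp 2 (fun _ : Fin n => Cm m)))

/-- The `L^∞` norm of a tempered distribution, infinite if it is not a function. -/
def linftyNorm {n m : ℕ} (u : 𝓢'(Rn n, Cm m)) : ℝ≥0∞ :=
  ⨅ (g : Rn n → Cm m) (_ : IsFunction u g), eLpNorm g ∞ volume

/-- The `𝒟H^s` norm `(∑_{λ = 2 ^ j} λ^{2s} ‖S_λ u‖²_{𝒟L²_λ}) ^ (1/2)`. -/
def dhNorm {n m : ℕ} (χ : LPCutoff n) (s : ℝ) (u : 𝓢'(Rn n, Cm m)) : ℝ≥0∞ :=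
  (∑' j : ℕ, ENNReal.ofReal (((2 : ℝ) ^ j) ^ (2 * s)) *
    dlNorm ((2 : ℝ) ^ j) (χ.piece j u) ^ 2) ^ (1 / 2 : ℝ)

/-- The linear automorphism `x ↦ ε⁻¹ x` of `ℝⁿ`. -/
def invDilation (n : ℕ) (ε : ℝ) (hε : 0 < ε) : Rn n ≃L[ℝ] Rn n :=
  ContinuousLinearEquiv.smulLeft (Units.mk0 ε⁻¹ (inv_ne_zero hε.ne'))

/-- The rescaling `u^ε (x) = ε u (ε x)`, by duality:
`⟨u^ε, φ⟩ = ε ε^{-n} ⟨u, φ (ε⁻¹ ·)⟩`. -/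
def rescale {n m : ℕ} (ε : ℝ) (hε : 0 < ε) (u : 𝓢'(Rn n, Cm m)) : 𝓢'(Rn n, Cm m) :=
  ((ε * (ε ^ n)⁻¹ : ℝ) : ℂ) •
    PointwiseConvergenceCLM.precomp (Cm m)
      (SchwartzMap.compCLMOfContinuousLinearEquiv ℂ (invDilation n ε hε)) u

end DLSpace

end

noncomputable section

namespace DLSpace

/-! ### The directional norms of nonnegative functions -/

/-! Everything is a scaling count. Rescaling costs an amplitude ε and a Jacobian: the norm at radius
μ of u^ε is at most ε^(1-n/2) times the norm at radius εμ of u (`dlNorm_rescale_le`), and S_{≤1} of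
u^ε is the rescaling of χ(εD)u (`LPCutoff.low_rescale`). What remains are estimates for a single
piece u_λ, measured at radii other than λ.

Two comparisons along a ray carry these estimates. For any function, passing from radius ν to a
smaller radius μ costs (ν/μ)^(1/2), by Cauchy-Schwarz over the small balls in one large ball
(`exists_dlE_le_scale`). For a function at unit frequency, values at nearby points control each
other through the rapidly decaying kernel, so passing from radius 1 to μ costs only μ^(n/2-1): each
small ball gains μ^(n/2), and there are 1/μ of them per unit length (`dlE_le_of_le_nearby`).
Dilation to frequency λ gives the Bernstein bounds: for λν bounded, the norm of u_λ at radius ν is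
at most (λν)^(n/2-1) λ times its norm at radius λ, and its sup norm is at most λ^(n/2) times that
norm (`exists_dlNorm_bernstein`, `exists_linftyNorm_bernstein`), up to constants.

With ν = ε the powers of ε cancel, and the piece u_λ contributes λ^(n/2) ‖u_λ‖ ≤ λ^(n/2-s) M to the
low part. This is summable because s > n/2; the sup norm is the same sum times the amplitude ε. A
gradient brings the further factor ελ, hence ε ∑ λ^(n/2+1-s) over λ ≲ 1/ε: bounded sum, dominant
last term or logarithm, according to the sign of the exponent.

For the high part, S_λ(1-χ(D)) acting on u^ε sees only the pieces of u with frequency close to λ/ε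
(`LPCutoff.dyadicSymbol_mul_localized`). The change of radius from λ/ε to ελ costs 1/ε, which eats
the amplitude, while λ^s is ε^s times the weight of those pieces. This leaves ε^(s-n/2), and the
finite overlap of the frequency windows keeps the square sum. -/

/-- The `L²` norm of a nonnegative function on a ball. -/
def ballL2 {n : ℕ} (h : Rn n → ℝ≥0∞) (c : Rn n) (r : ℝ) : ℝ≥0∞ :=
  (∫⁻ x in Metric.ball c r, h x ^ 2) ^ (1 / 2 : ℝ)

/-- The `𝒟L²_μ` norm of a nonnegative function. -/
def dlE {n : ℕ} (μ : ℝ) (h : Rn n → ℝ≥0∞) : ℝ≥0∞ :=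
  ⨆ (x₀ : Rn n) (ω : Metric.sphere (0 : Rn n) 1),
    ∑' k : ℕ, ballL2 h (x₀ + (μ * k) • (ω : Rn n)) μ

/-- The norm sees only the pointwise size, on balls of radius μ with centres spaced by μ on a ray.
All estimates are therefore made for nonnegative extended functions, where no summability has to be
checked. -/
theorem dlFun_eq_dlE {n : ℕ} {G : Type*} [NormedAddCommGroup G] {μ : ℝ} (hμ : 0 < μ)
    (g : Rn n → G) : dlFun μ g = dlE μ (fun x => ‖g x‖ₑ) := by
  unfold dlFun dlE ballL2
  refine iSup_congr fun x₀ => iSup_congr fun ω => tsum_congr fun k => ?_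
  have hset : {x : Rn n | ‖μ⁻¹ • (x - x₀) - (k : ℝ) • (ω : Rn n)‖ < 1}
      = Metric.ball (x₀ + (μ * k) • (ω : Rn n)) μ := by
    ext x
    have h1 : x - (x₀ + (μ * k) • (ω : Rn n)) = μ • (μ⁻¹ • (x - x₀) - (k : ℝ) • (ω : Rn n)) := by
      rw [smul_sub, smul_smul, mul_inv_cancel₀ hμ.ne', one_smul, smul_smul]
      abel
    rw [Metric.mem_ball, dist_eq_norm, h1, norm_smul, Real.norm_of_nonneg hμ.le, Set.mem_ofPred_eq]
    constructor
    · intro h; nlinarith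
    · intro h; by_contra hc; push Not at hc; nlinarith
  rw [hset, eLpNorm_indicator_eq_eLpNorm_restrict Metric.isOpen_ball.measurableSet,
    eLpNorm_eq_lintegral_rpow_enorm_toReal (by norm_num) (by norm_num)]
  simp

theorem ballL2_mono {n : ℕ} {h h' : Rn n → ℝ≥0∞} (H : ∀ x, h x ≤ h' x) (c : Rn n) (r : ℝ) :
    ballL2 h c r ≤ ballL2 h' c r := by
  unfold ballL2
  gcongr
  exact H _

theorem dlE_mono {n : ℕ} {h h' : Rn n → ℝ≥0∞} (H : ∀ x, h x ≤ h' x) (μ : ℝ) :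
    dlE μ h ≤ dlE μ h' := by
  unfold dlE
  gcongr
  exact ballL2_mono H _ _

theorem tsum_ballL2_le_dlE {n : ℕ} (μ : ℝ) (h : Rn n → ℝ≥0∞) (x₀ ω : Rn n) (hω : ‖ω‖ = 1) :
    ∑' k : ℕ, ballL2 h (x₀ + (μ * k) • ω) μ ≤ dlE μ h :=
  le_iSup₂_of_le (f := fun (x₀ : Rn n) (ω : Metric.sphere (0 : Rn n) 1) =>
    ∑' k : ℕ, ballL2 h (x₀ + (μ * k) • (ω : Rn n)) μ) x₀ ⟨ω, by simpa using hω⟩ le_rfl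

theorem dlE_le {n : ℕ} {μ : ℝ} {h : Rn n → ℝ≥0∞} {b : ℝ≥0∞}
    (H : ∀ x₀ ω : Rn n, ‖ω‖ = 1 → ∑' k : ℕ, ballL2 h (x₀ + (μ * k) • ω) μ ≤ b) :
    dlE μ h ≤ b :=
  iSup₂_le fun x₀ ω => H x₀ ω (by simp)

/-- Minkowski's integral inequality in `L²`. -/
theorem lintegral_sq_lintegral_le {α β : Type*} [MeasurableSpace α] [MeasurableSpace β]
    {μ : Measure α} {ν : Measure β} [SFinite μ] [SFinite ν] {F : α → β → ℝ≥0∞}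
    (hF : Measurable (Function.uncurry F)) :
    (∫⁻ x, (∫⁻ y, F x y ∂ν) ^ 2 ∂μ) ^ (1 / 2 : ℝ)
      ≤ ∫⁻ y, (∫⁻ x, F x y ^ 2 ∂μ) ^ (1 / 2 : ℝ) ∂ν := by
  set a : β → ℝ≥0∞ := fun y => (∫⁻ x, F x y ^ 2 ∂μ) ^ (1 / 2 : ℝ) with ha
  have hFx : ∀ x, Measurable (F x) := fun x => hF.comp measurable_prodMk_left
  have hFy : ∀ y, Measurable (fun x => F x y) := fun y => hF.comp measurable_prodMk_right
  have ham : Measurable a := by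
    refine Measurable.pow_const ?_ _
    exact Measurable.lintegral_prod_left' (f := fun p : α × β => F p.1 p.2 ^ 2) (hF.pow_const 2)
  -- Write the square as a double integral in y and z, integrate in x first, and apply
  -- Cauchy-Schwarz in x for fixed y and z.
  have key : ∫⁻ x, (∫⁻ y, F x y ∂ν) ^ 2 ∂μ ≤ (∫⁻ y, a y ∂ν) ^ 2 := by
    calc ∫⁻ x, (∫⁻ y, F x y ∂ν) ^ 2 ∂μ = ∫⁻ x, ∫⁻ y, ∫⁻ z, F x y * F x z ∂ν ∂ν ∂μ := by
          refine lintegral_congr fun x => ?_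
          rw [lintegral_lintegral_mul (hFx x).aemeasurable (hFx x).aemeasurable, sq]
      _ = ∫⁻ y, ∫⁻ x, ∫⁻ z, F x y * F x z ∂ν ∂μ ∂ν := by
          refine lintegral_lintegral_swap (Measurable.aemeasurable ?_)
          refine Measurable.lintegral_prod_right'
            (f := fun p : (α × β) × β => F p.1.1 p.1.2 * F p.1.1 p.2) ?_
          exact (hF.comp measurable_fst).mul
            (hF.comp ((measurable_fst.comp measurable_fst).prodMk measurable_snd))
      _ = ∫⁻ y, ∫⁻ z, ∫⁻ x, F x y * F x z ∂μ ∂ν ∂ν := by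
          refine lintegral_congr fun y => lintegral_lintegral_swap (Measurable.aemeasurable ?_)
          exact ((hFy y).comp measurable_fst).mul hF
      _ ≤ ∫⁻ y, ∫⁻ z, a y * a z ∂ν ∂ν := by
          refine lintegral_mono fun y => lintegral_mono fun z => ?_
          have := ENNReal.lintegral_mul_le_Lp_mul_Lq μ
            (Real.HolderConjugate.two_two) (hFy y).aemeasurable (hFy z).aemeasurable
          simpa [ha] using this
      _ = (∫⁻ y, a y ∂ν) ^ 2 := by
          rw [lintegral_lintegral_mul ham.aemeasurable ham.aemeasurable, sq]
  calc (∫⁻ x, (∫⁻ y, F x y ∂ν) ^ 2 ∂μ) ^ (1 / 2 : ℝ)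
      ≤ ((∫⁻ y, a y ∂ν) ^ 2) ^ (1 / 2 : ℝ) := by gcongr
    _ = ∫⁻ y, a y ∂ν := by
        rw [← ENNReal.rpow_two, ← ENNReal.rpow_mul]; simp

theorem ballL2_comp_add {n : ℕ} (h : Rn n → ℝ≥0∞) (c y : Rn n) (r : ℝ) :
    ballL2 (fun x => h (x + y)) c r = ballL2 h (c + y) r := by
  unfold ballL2
  congr 1
  rw [← lintegral_indicator Metric.isOpen_ball.measurableSet,
    ← lintegral_indicator Metric.isOpen_ball.measurableSet,
    ← lintegral_add_right_eq_self (Set.indicator (Metric.ball (c + y) r) _) y]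
  refine lintegral_congr fun x => ?_
  simp [Set.indicator, Metric.mem_ball, dist_add_right]

theorem ballL2_const_mul {n : ℕ} {h : Rn n → ℝ≥0∞} (hh : Measurable h) (a : ℝ≥0∞) (c : Rn n)
    (r : ℝ) : ballL2 (fun x => a * h x) c r = a * ballL2 h c r := by
  unfold ballL2
  simp_rw [mul_pow]
  rw [lintegral_const_mul _ (hh.pow_const 2), ENNReal.mul_rpow_of_nonneg _ _ (by norm_num),
    ← ENNReal.rpow_two, ← ENNReal.rpow_mul]
  simp

theorem measurable_lintegral_mul_comp_add {n : ℕ} {K h : Rn n → ℝ≥0∞} (hK : Measurable K)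
    (hh : Measurable h) : Measurable fun x => ∫⁻ y, K y * h (x + y) :=
  Measurable.lintegral_prod_right' (f := fun p : Rn n × Rn n => K p.2 * h (p.1 + p.2))
    ((hK.comp measurable_snd).mul (hh.comp (measurable_fst.add measurable_snd)))

theorem measurable_ballL2_add {n : ℕ} {h : Rn n → ℝ≥0∞} (hh : Measurable h) (c : Rn n) (r : ℝ) :
    Measurable fun y => ballL2 h (c + y) r := by
  simp_rw [← ballL2_comp_add]
  unfold ballL2
  refine Measurable.pow_const ?_ _
  exact Measurable.lintegral_prod_left' (f := fun p : Rn n × Rn n => h (p.1 + p.2) ^ 2)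
    ((hh.comp (measurable_fst.add measurable_snd)).pow_const 2)

theorem ballL2_lintegral_le {n : ℕ} {K h : Rn n → ℝ≥0∞} (hK : Measurable K) (hh : Measurable h)
    (c : Rn n) (r : ℝ) :
    ballL2 (fun x => ∫⁻ y, K y * h (x + y)) c r ≤ ∫⁻ y, K y * ballL2 h (c + y) r := by
  refine (lintegral_sq_lintegral_le (F := fun x y => K y * h (x + y)) ?_).trans ?_
  · exact (hK.comp measurable_snd).mul (hh.comp (measurable_fst.add measurable_snd))
  · refine lintegral_mono fun y => ?_
    have := ballL2_const_mul (h := fun x => h (x + y)) (hh.comp (measurable_id.add_const y))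
      (K y) c r
    rw [← ballL2_comp_add, ← this]
    rfl

/-- Averages of translates are bounded in the directional norms. -/
theorem dlE_lintegral_le {n : ℕ} {K h : Rn n → ℝ≥0∞} (hK : Measurable K) (hh : Measurable h)
    (μ : ℝ) : dlE μ (fun x => ∫⁻ y, K y * h (x + y)) ≤ (∫⁻ y, K y) * dlE μ h := by
  refine dlE_le fun x₀ ω hω => ?_
  calc ∑' k : ℕ, ballL2 (fun x => ∫⁻ y, K y * h (x + y)) (x₀ + (μ * k) • ω) μ
      ≤ ∑' k : ℕ, ∫⁻ y, K y * ballL2 h (x₀ + (μ * k) • ω + y) μ :=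
        ENNReal.tsum_le_tsum fun k => ballL2_lintegral_le hK hh _ _
    _ = ∫⁻ y, ∑' k : ℕ, K y * ballL2 h (x₀ + (μ * k) • ω + y) μ := by
        rw [lintegral_tsum]
        exact fun k => (hK.mul (measurable_ballL2_add hh _ _)).aemeasurable
    _ ≤ ∫⁻ y, K y * dlE μ h := by
        refine lintegral_mono fun y => ?_
        simp only []
        rw [ENNReal.tsum_mul_left]
        gcongr
        -- Translation by y only moves the base point of the ray, over which the supremum is taken.
        refine le_trans (le_of_eq (tsum_congr fun k => ?_))
          (tsum_ballL2_le_dlE μ h (x₀ + y) ω hω)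
        rw [add_right_comm]
    _ = (∫⁻ y, K y) * dlE μ h := lintegral_mul_const _ hK

theorem ballL2_add_le {n : ℕ} {h h' : Rn n → ℝ≥0∞} (hh : Measurable h) (hh' : Measurable h')
    (c : Rn n) (r : ℝ) :
    ballL2 (fun x => h x + h' x) c r ≤ ballL2 h c r + ballL2 h' c r := by
  have := ENNReal.lintegral_Lp_add_le (μ := volume.restrict (Metric.ball c r)) hh.aemeasurable
    hh'.aemeasurable (p := 2) (by norm_num)
  simpa [ballL2] using this

theorem dlE_add_le {n : ℕ} {h h' : Rn n → ℝ≥0∞} (hh : Measurable h) (hh' : Measurable h')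
    (μ : ℝ) : dlE μ (fun x => h x + h' x) ≤ dlE μ h + dlE μ h' := by
  refine dlE_le fun x₀ ω hω => ?_
  calc _ ≤ ∑' k : ℕ, (ballL2 h (x₀ + (μ * k) • ω) μ + ballL2 h' (x₀ + (μ * k) • ω) μ) :=
        ENNReal.tsum_le_tsum fun k => ballL2_add_le hh hh' _ _
    _ ≤ _ := by
        rw [ENNReal.tsum_add]
        gcongr <;> exact tsum_ballL2_le_dlE _ _ _ _ hω

theorem dlE_const_mul {n : ℕ} {h : Rn n → ℝ≥0∞} (hh : Measurable h) (a : ℝ≥0∞) (μ : ℝ) :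
    dlE μ (fun x => a * h x) = a * dlE μ h := by
  unfold dlE
  simp_rw [ballL2_const_mul hh, ENNReal.tsum_mul_left, ENNReal.mul_iSup]

/-! ### Balls of different radii along a ray -/

/-- Grouping an infinite sum into blocks along an arithmetic progression of slope `a⁻¹`. -/
theorem tsum_le_tsum_blocks {a : ℝ} (ha : 0 < a) (f : ℕ → ℝ≥0∞) :
    ∑' k, f k ≤ ∑' j : ℕ, ∑ r ∈ Finset.range (⌊1 / a⌋₊ + 1), f (⌈(j : ℝ) / a⌉₊ + r) := by
  classical
  set N := ⌊1 / a⌋₊ + 1 with hN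
  -- The index k goes to its block ⌊ka⌋ and its offset from the start of that block, an offset of at
  -- most 1/a. Blocks of the common length N may overlap, so only injectivity is available and the
  -- result is an inequality.
  set e : ℕ → ℕ × ℕ := fun k => (⌊(k : ℝ) * a⌋₊, k - ⌈(⌊(k : ℝ) * a⌋₊ : ℝ) / a⌉₊)
  set F : ℕ × ℕ → ℝ≥0∞ := fun p => if p.2 < N then f (⌈(p.1 : ℝ) / a⌉₊ + p.2) else 0
  have hle : ∀ k : ℕ, ⌈(⌊(k : ℝ) * a⌋₊ : ℝ) / a⌉₊ ≤ k := fun k => by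
    rw [Nat.ceil_le, div_le_iff₀ ha]
    exact Nat.floor_le (by positivity)
  have hsum : ∀ k : ℕ, ⌈((e k).1 : ℝ) / a⌉₊ + (e k).2 = k := fun k => Nat.add_sub_cancel' (hle k)
  have hlt : ∀ k : ℕ, (e k).2 < N := fun k => by
    refine Nat.lt_succ_of_le (Nat.le_floor ?_)
    have h1 : (k : ℝ) * a < ⌊(k : ℝ) * a⌋₊ + 1 := Nat.lt_floor_add_one _
    have h2 : ((⌊(k : ℝ) * a⌋₊ : ℝ)) / a ≤ ⌈(⌊(k : ℝ) * a⌋₊ : ℝ) / a⌉₊ := Nat.le_ceil _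
    have h3 : (k : ℝ) < (⌊(k : ℝ) * a⌋₊ : ℝ) / a + 1 / a := by
      rw [← add_div, lt_div_iff₀ ha]; exact h1
    have h4 : ((e k).2 : ℝ) = k - ⌈(⌊(k : ℝ) * a⌋₊ : ℝ) / a⌉₊ := by
      simp only [e]; rw [Nat.cast_sub (hle k)]
    rw [h4]; linarith
  have hinj : Function.Injective e := fun k k' hk => by rw [← hsum k, ← hsum k', hk]
  calc ∑' k, f k = ∑' k, F (e k) := by
        refine tsum_congr fun k => ?_
        simp only [F]
        rw [if_pos (hlt k), hsum k]
    _ ≤ ∑' p, F p := ENNReal.tsum_comp_le_tsum_of_injective hinj F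
    _ = ∑' j : ℕ, ∑' r : ℕ, F (j, r) :=
        ENNReal.tsum_prod (f := fun j r => F (j, r))
    _ = _ := by
        refine tsum_congr fun j => ?_
        rw [tsum_eq_sum (s := Finset.range N)]
        · refine Finset.sum_congr rfl fun r hr => ?_
          simp only [F]
          rw [if_pos (Finset.mem_range.1 hr)]
        · intro r hr
          simp only [F]
          rw [if_neg (by simpa using hr)]

theorem volume_ball_eq {n : ℕ} (c : Rn n) {r : ℝ} (hr : 0 < r) :
    volume (Metric.ball c r) = ENNReal.ofReal (r ^ n) * volume (Metric.ball (0 : Rn n) 1) := by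
  have := Measure.addHaar_ball_of_pos (volume : Measure (Rn n)) c hr
  simpa using this

theorem sq_mul_volume_le {n : ℕ} {W : Rn n → ℝ≥0∞} {z : Rn n} {a : ℝ≥0∞}
    (H : ∀ p ∈ Metric.ball z 1, a ≤ W p) :
    a ^ 2 * volume (Metric.ball (0 : Rn n) 1) ≤ ∫⁻ p in Metric.ball z 1, W p ^ 2 := by
  have h1 : volume (Metric.ball (0 : Rn n) 1) = volume (Metric.ball z 1) := by
    rw [volume_ball_eq z one_pos]; simp
  rw [h1, ← setLIntegral_const]
  refine setLIntegral_mono' Metric.isOpen_ball.measurableSet fun p hp => ?_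
  gcongr
  exact H p hp

theorem volume_unitBall_ne_zero (n : ℕ) : volume (Metric.ball (0 : Rn n) 1) ≠ 0 :=
  (Metric.measure_ball_pos volume _ one_pos).ne'

theorem volume_unitBall_ne_top (n : ℕ) : volume (Metric.ball (0 : Rn n) 1) ≠ ∞ :=
  measure_ball_lt_top.ne

theorem ofReal_pow_rpow_half {n : ℕ} {r : ℝ} (hr : 0 ≤ r) :
    ENNReal.ofReal (r ^ n) ^ (1 / 2 : ℝ) = ENNReal.ofReal (r ^ ((n : ℝ) / 2)) := by
  rw [ENNReal.ofReal_rpow_of_nonneg (by positivity) (by norm_num), ← Real.rpow_natCast,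
    ← Real.rpow_mul hr]
  congr 2
  ring

/-- On the ball of radius r, w² is at most the mean of W² over the unit ball; the ratio of the
volumes is r^n, and its square root is the factor. -/
theorem ballL2_le_of_forall_le {n : ℕ} {w W : Rn n → ℝ≥0∞} {c z : Rn n} {r : ℝ} (hr : 0 < r)
    (H : ∀ x ∈ Metric.ball c r, ∀ p ∈ Metric.ball z 1, w x ≤ W p) :
    ballL2 w c r ≤ ENNReal.ofReal (r ^ ((n : ℝ) / 2)) * ballL2 W z 1 := by
  set V := volume (Metric.ball (0 : Rn n) 1) with hV
  have hV0 := volume_unitBall_ne_zero n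
  have hVt := volume_unitBall_ne_top n
  set I := ∫⁻ p in Metric.ball z 1, W p ^ 2
  have h1 : ∫⁻ x in Metric.ball c r, w x ^ 2 ≤ ENNReal.ofReal (r ^ n) * I := by
    calc ∫⁻ x in Metric.ball c r, w x ^ 2 ≤ ∫⁻ x in Metric.ball c r, I / V := by
          refine setLIntegral_mono' Metric.isOpen_ball.measurableSet fun x hx => ?_
          rw [ENNReal.le_div_iff_mul_le (Or.inl hV0) (Or.inl hVt)]
          exact sq_mul_volume_le fun p hp => H x hx p hp
      _ = I / V * (ENNReal.ofReal (r ^ n) * V) := by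
          rw [setLIntegral_const, volume_ball_eq c hr]
      _ = ENNReal.ofReal (r ^ n) * I := by
          rw [mul_comm (ENNReal.ofReal _), ← mul_assoc, ENNReal.div_mul_cancel hV0 hVt, mul_comm]
  unfold ballL2
  rw [← ofReal_pow_rpow_half hr.le, ← ENNReal.mul_rpow_of_nonneg _ _ (by norm_num)]
  gcongr

theorem block_index_bounds {a : ℝ} (ha : 0 < a) (j : ℕ) {r : ℕ}
    (hr : r ∈ Finset.range (⌊1 / a⌋₊ + 1)) :
    (j : ℝ) ≤ a * ((⌈(j : ℝ) / a⌉₊ + r : ℕ) : ℝ) ∧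
      a * ((⌈(j : ℝ) / a⌉₊ + r : ℕ) : ℝ) ≤ j + 1 + a := by
  have h1 : (j : ℝ) / a ≤ ⌈(j : ℝ) / a⌉₊ := Nat.le_ceil _
  have h2 : (⌈(j : ℝ) / a⌉₊ : ℝ) < (j : ℝ) / a + 1 := Nat.ceil_lt_add_one (by positivity)
  have h3 : (r : ℝ) ≤ 1 / a := by
    have : r ≤ ⌊1 / a⌋₊ := Nat.lt_succ_iff.1 (Finset.mem_range.1 hr)
    exact (Nat.cast_le.2 this).trans (Nat.floor_le (by positivity))
  have e1 : a * ((j : ℝ) / a) = j := by field_simp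
  have e2 : a * (1 / a) = 1 := by field_simp
  push_cast
  constructor
  · nlinarith [mul_le_mul_of_nonneg_left h1 ha.le, Nat.cast_nonneg (α := ℝ) r]
  · nlinarith [mul_le_mul_of_nonneg_left h2.le ha.le, mul_le_mul_of_nonneg_left h3 ha.le]

/-- The Bernstein inequality: control by nearby values compares radius `μ` to radius `1`. -/
theorem dlE_le_of_le_nearby {n : ℕ} {A μ : ℝ} (hμ : 0 < μ) (hμA : μ ≤ A) {w W : Rn n → ℝ≥0∞}
    (H : ∀ x p, ‖x - p‖ ≤ 2 * A + 2 → w x ≤ W p) :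
    dlE μ w ≤ ENNReal.ofReal ((1 + A) * μ ^ ((n : ℝ) / 2 - 1)) * dlE 1 W := by
  refine dlE_le fun x₀ ω hω => ?_
  -- N balls of radius μ are grouped with each unit ball. Each contributes μ^(n/2), and N ≤ (1+A)/μ
  -- lowers the exponent to n/2-1.
  set N := ⌊1 / μ⌋₊ + 1 with hN
  have hNle : (N : ℝ) ≤ (1 + A) / μ := by
    have : (⌊1 / μ⌋₊ : ℝ) ≤ 1 / μ := Nat.floor_le (by positivity)
    rw [hN, le_div_iff₀ hμ]
    push_cast
    have e : 1 / μ * μ = 1 := by field_simp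
    nlinarith [mul_le_mul_of_nonneg_right this hμ.le]
  have hterm : ∀ (j : ℕ), ∀ r ∈ Finset.range N,
      ballL2 w (x₀ + (μ * (⌈(j : ℝ) / μ⌉₊ + r : ℕ)) • ω) μ
        ≤ ENNReal.ofReal (μ ^ ((n : ℝ) / 2)) * ballL2 W (x₀ + ((1 : ℝ) * j) • ω) 1 := by
    intro j r hr
    obtain ⟨hb1, hb2⟩ := block_index_bounds hμ j hr
    -- The distances μ and 1 to the two centres and 1+μ between the centres add up to at most 2A+2.
    refine ballL2_le_of_forall_le hμ fun x hx p hp => H x p ?_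
    rw [Metric.mem_ball, dist_eq_norm] at hx hp
    set t := μ * ((⌈(j : ℝ) / μ⌉₊ + r : ℕ) : ℝ)
    have e : x - p = (x - (x₀ + t • ω)) - (p - (x₀ + ((1 : ℝ) * j) • ω)) + (t - j) • ω := by
      rw [sub_smul, one_mul]; abel
    rw [e]
    refine (norm_add_le _ _).trans ?_
    have h1 := norm_sub_le (x - (x₀ + t • ω)) (p - (x₀ + ((1 : ℝ) * j) • ω))
    have h2 : ‖(t - j) • ω‖ ≤ 1 + μ := by
      rw [norm_smul, hω, mul_one, Real.norm_eq_abs, abs_le]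
      constructor <;> linarith
    linarith
  calc ∑' k : ℕ, ballL2 w (x₀ + (μ * k) • ω) μ
      ≤ ∑' j : ℕ, ∑ r ∈ Finset.range N, ballL2 w (x₀ + (μ * (⌈(j : ℝ) / μ⌉₊ + r : ℕ)) • ω) μ :=
        tsum_le_tsum_blocks hμ (fun k : ℕ => ballL2 w (x₀ + (μ * k) • ω) μ)
    _ ≤ ∑' j : ℕ, N * (ENNReal.ofReal (μ ^ ((n : ℝ) / 2)) *
          ballL2 W (x₀ + ((1 : ℝ) * j) • ω) 1) := by
        refine ENNReal.tsum_le_tsum fun j => (Finset.sum_le_sum (hterm j)).trans ?_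
        simp
    _ = N * ENNReal.ofReal (μ ^ ((n : ℝ) / 2)) *
          ∑' j : ℕ, ballL2 W (x₀ + ((1 : ℝ) * j) • ω) 1 := by
        simp_rw [← mul_assoc]; rw [ENNReal.tsum_mul_left]
    _ ≤ ENNReal.ofReal ((1 + A) * μ ^ ((n : ℝ) / 2 - 1)) * dlE 1 W := by
        refine mul_le_mul' ?_ (tsum_ballL2_le_dlE 1 W x₀ ω hω)
        rw [← ENNReal.ofReal_natCast, ← ENNReal.ofReal_mul (by positivity)]
        refine ENNReal.ofReal_le_ofReal ?_
        rw [Real.rpow_sub_one hμ.ne', mul_div_assoc', mul_div_right_comm]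
        exact mul_le_mul_of_nonneg_right hNle (by positivity)

/-- Centres of balls sharing a point are less than 2μ apart while consecutive centres are μ apart,
so a point lies in at most two of the balls. -/
theorem sum_lintegral_overlap_le {n : ℕ} {h : Rn n → ℝ≥0∞} (hh : Measurable h) {μ : ℝ}
    (hμ : 0 < μ) (x₀ ω : Rn n) (hω : ‖ω‖ = 1) (m N : ℕ) {S : Set (Rn n)} (hS : MeasurableSet S)
    (hsub : ∀ r ∈ Finset.range N, Metric.ball (x₀ + (μ * (m + r : ℕ)) • ω) μ ⊆ S) :
    ∑ r ∈ Finset.range N, ∫⁻ x in Metric.ball (x₀ + (μ * (m + r : ℕ)) • ω) μ, h x ≤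
      2 * ∫⁻ x in S, h x := by
  classical
  set B : ℕ → Set (Rn n) := fun r => Metric.ball (x₀ + (μ * (m + r : ℕ)) • ω) μ
  have hB : ∀ r, MeasurableSet (B r) := fun r => Metric.isOpen_ball.measurableSet
  have hclose : ∀ x r r', x ∈ B r → x ∈ B r' → r' < r + 2 := by
    intro x r r' h1 h2
    rw [Metric.mem_ball, dist_eq_norm] at h1 h2
    have h3 : ‖(μ * ((r' : ℝ) - r)) • ω‖ < 2 * μ := by
      have e : (μ * ((r' : ℝ) - r)) • ω = (x - (x₀ + (μ * (m + r : ℕ)) • ω))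
          - (x - (x₀ + (μ * (m + r' : ℕ)) • ω)) := by
        rw [sub_sub_sub_cancel_left, add_sub_add_left_eq_sub, ← sub_smul]
        push_cast
        congr 1
        ring
      rw [e]
      refine (norm_sub_le _ _).trans_lt (by linarith)
    rw [norm_smul, hω, mul_one, Real.norm_eq_abs] at h3
    have h4 := (le_abs_self _).trans_lt h3
    have h5 : (r' : ℝ) - r < 2 := by nlinarith
    have h6 : (r' : ℝ) < ((r + 2 : ℕ) : ℝ) := by push_cast; linarith
    exact_mod_cast h6
  calc ∑ r ∈ Finset.range N, ∫⁻ x in B r, h x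
      = ∫⁻ x, ∑ r ∈ Finset.range N, (B r).indicator h x := by
        rw [lintegral_finsetSum _ fun r _ => hh.indicator (hB r)]
        exact Finset.sum_congr rfl fun r _ => (lintegral_indicator (hB r) h).symm
    _ ≤ ∫⁻ x, 2 * S.indicator h x := by
        refine lintegral_mono fun x => ?_
        simp only [Set.indicator_apply]
        rw [← Finset.sum_filter, Finset.sum_const]
        set T := (Finset.range N).filter (fun r => x ∈ B r)
        rcases T.eq_empty_or_nonempty with hT | hT
        · simp [hT]
        · have hmin := Finset.min'_mem T hT
          have hxS : x ∈ S := by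
            have := Finset.mem_filter.1 hmin
            exact hsub _ this.1 this.2
          have hcard : T.card ≤ 2 := by
            refine (Finset.card_le_card (t := {T.min' hT, T.min' hT + 1}) fun r hr => ?_).trans
              Finset.card_le_two
            have h1 := Finset.min'_le T r hr
            have h2 := hclose x _ r (Finset.mem_filter.1 hmin).2 (Finset.mem_filter.1 hr).2
            simp only [Finset.mem_insert, Finset.mem_singleton]
            omega
          rw [if_pos hxS, nsmul_eq_mul]
          gcongr
          exact_mod_cast hcard
    _ = 2 * ∫⁻ x in S, h x := by
        rw [lintegral_const_mul _ (hh.indicator hS), lintegral_indicator hS]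

/-- Cauchy-Schwarz against the constant 1. The root of the number of balls in a block is the loss
(ν/μ)^(1/2) in the comparison of scales. -/
theorem sum_rpow_half_le (N : ℕ) (f : ℕ → ℝ≥0∞) :
    ∑ r ∈ Finset.range N, f r ^ (1 / 2 : ℝ) ≤
      (N : ℝ≥0∞) ^ (1 / 2 : ℝ) * (∑ r ∈ Finset.range N, f r) ^ (1 / 2 : ℝ) := by
  have := ENNReal.inner_le_Lp_mul_Lq (Finset.range N) (fun _ => 1) (fun r => f r ^ (1 / 2 : ℝ))
    Real.HolderConjugate.two_two
  simp only [one_mul, ENNReal.one_rpow, Finset.sum_const, Finset.card_range, nsmul_eq_mul,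
    mul_one, ← ENNReal.rpow_mul] at this
  simpa using this

theorem rpow_half_sum_le {ι : Type*} (t : Finset ι) (f : ι → ℝ≥0∞) :
    (∑ i ∈ t, f i) ^ (1 / 2 : ℝ) ≤ ∑ i ∈ t, f i ^ (1 / 2 : ℝ) := by
  classical
  induction t using Finset.induction_on with
  | empty => simp
  | insert i t hi ih =>
    rw [Finset.sum_insert hi, Finset.sum_insert hi]
    exact (ENNReal.rpow_add_le_add_rpow _ _ (by norm_num) (by norm_num)).trans (by gcongr)

/-- Comparison of the directional norms at two scales. -/
theorem exists_dlE_le_scale (n : ℕ) {B : ℝ} (hB : 0 < B) :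
    ∃ C : ℝ, 0 < C ∧ ∀ (μ ν : ℝ), 0 < μ → 0 < ν → μ ≤ B * ν → ∀ h : Rn n → ℝ≥0∞, Measurable h →
      dlE μ h ≤ ENNReal.ofReal (C * (ν / μ) ^ (1 / 2 : ℝ)) * dlE ν h := by
  -- The small balls of one block stay within ν(1+a)+μ ≤ (1+2B)ν of the j-th large centre. A finite
  -- cover fixed once, dilated by ν, splits this region into balls of radius ν, with a number of
  -- balls independent of the scales.
  obtain ⟨t, -, ht, htcov⟩ := (isCompact_closedBall (0 : Rn n) (2 + 2 * B)).finite_cover_balls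
    (e := 1) one_pos
  lift t to Finset (Rn n) using ht
  refine ⟨(2 * (1 + B)) ^ (1 / 2 : ℝ) * (t.card + 1), by positivity, ?_⟩
  intro μ ν hμ hν hμν h hh
  refine dlE_le fun x₀ ω hω => ?_
  set a := μ / ν with ha_def
  have ha : 0 < a := by positivity
  have haB : a ≤ B := by rw [ha_def, div_le_iff₀ hν]; exact hμν
  have haν : a * ν = μ := by rw [ha_def]; field_simp
  set N := ⌊1 / a⌋₊ + 1 with hN
  have hNle : (N : ℝ) ≤ (1 + B) * (ν / μ) := by
    have h1 : (⌊1 / a⌋₊ : ℝ) ≤ 1 / a := Nat.floor_le (by positivity)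
    have h2 : ν / μ = 1 / a := by rw [ha_def, one_div_div]
    have h3 : 1 ≤ B * (1 / a) := by rw [mul_one_div, le_div_iff₀ ha]; linarith
    rw [hN, h2]; push_cast; linarith
  set z : ℕ → Rn n := fun j => x₀ + (ν * j) • ω
  have hblock : ∀ j : ℕ, ∑ r ∈ Finset.range N, ballL2 h (x₀ + (μ * (⌈(j : ℝ) / a⌉₊ + r : ℕ)) • ω) μ
      ≤ ENNReal.ofReal ((2 * (1 + B)) ^ (1 / 2 : ℝ) * (ν / μ) ^ (1 / 2 : ℝ)) *
        ∑ p ∈ t, ballL2 h (z j + ν • p) ν := by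
    intro j
    set S := Metric.ball (z j) ((2 + 2 * B) * ν)
    have hov := sum_lintegral_overlap_le (hh.pow_const 2) hμ x₀ ω hω ⌈(j : ℝ) / a⌉₊ N
      (S := S) Metric.isOpen_ball.measurableSet (by
        intro r hr x hx
        obtain ⟨hb1, hb2⟩ := block_index_bounds ha j hr
        rw [Metric.mem_ball, dist_eq_norm] at hx ⊢
        set q := ((⌈(j : ℝ) / a⌉₊ + r : ℕ) : ℝ)
        have e : x - z j = (x - (x₀ + (μ * q) • ω)) + (ν * (a * q - j)) • ω := by
          have : ν * (a * q - j) = μ * q - ν * j := by rw [← haν]; ring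
          rw [this, sub_smul]; simp only [z]; abel
        rw [e]
        refine (norm_add_le _ _).trans_lt ?_
        have h2 : ‖(ν * (a * q - j)) • ω‖ ≤ ν * (1 + a) := by
          rw [norm_smul, hω, mul_one, norm_mul, Real.norm_of_nonneg hν.le, Real.norm_eq_abs]
          refine mul_le_mul_of_nonneg_left ?_ hν.le
          rw [abs_le]; constructor <;> linarith
        nlinarith)
    have hcov : ∫⁻ x in S, h x ^ 2 ≤ ∑ p ∈ t, ∫⁻ x in Metric.ball (z j + ν • p) ν, h x ^ 2 := by
      have hS : S ⊆ ⋃ p ∈ t, Metric.ball (z j + ν • p) ν := by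
        intro x hx
        rw [Metric.mem_ball, dist_eq_norm] at hx
        have hx' : ν⁻¹ • (x - z j) ∈ Metric.closedBall (0 : Rn n) (2 + 2 * B) := by
          rw [mem_closedBall_zero_iff, norm_smul, norm_inv, Real.norm_of_nonneg hν.le,
            inv_mul_le_iff₀ hν]
          linarith
        obtain ⟨p, hp, hxp⟩ := Set.mem_iUnion₂.1 (htcov hx')
        refine Set.mem_iUnion₂.2 ⟨p, hp, ?_⟩
        rw [Metric.mem_ball, dist_eq_norm] at hxp ⊢
        have e : x - (z j + ν • p) = ν • (ν⁻¹ • (x - z j) - p) := by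
          rw [smul_sub, smul_smul, mul_inv_cancel₀ hν.ne', one_smul]; abel
        rw [e, norm_smul, Real.norm_of_nonneg hν.le]
        nlinarith
      calc ∫⁻ x in S, h x ^ 2 ≤ ∫⁻ x in ⋃ p ∈ t, Metric.ball (z j + ν • p) ν, h x ^ 2 :=
            lintegral_mono_set hS
        _ ≤ ∑ p ∈ t, ∫⁻ x in Metric.ball (z j + ν • p) ν, h x ^ 2 := by
            rw [← Finset.tsum_subtype t fun p => ∫⁻ x in Metric.ball (z j + ν • p) ν, h x ^ 2]
            refine le_trans (lintegral_mono_set ?_) (lintegral_iUnion_le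
              (fun p : t => Metric.ball (z j + ν • (p : Rn n)) ν) _)
            exact (Set.biUnion_eq_iUnion (t : Set (Rn n))
              fun p _ => Metric.ball (z j + ν • p) ν).subset
    calc ∑ r ∈ Finset.range N, ballL2 h (x₀ + (μ * (⌈(j : ℝ) / a⌉₊ + r : ℕ)) • ω) μ
        ≤ (N : ℝ≥0∞) ^ (1 / 2 : ℝ) * (∑ r ∈ Finset.range N,
            ∫⁻ x in Metric.ball (x₀ + (μ * (⌈(j : ℝ) / a⌉₊ + r : ℕ)) • ω) μ, h x ^ 2)
              ^ (1 / 2 : ℝ) := sum_rpow_half_le N _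
      _ ≤ (N : ℝ≥0∞) ^ (1 / 2 : ℝ) * (2 * ∑ p ∈ t,
            ∫⁻ x in Metric.ball (z j + ν • p) ν, h x ^ 2) ^ (1 / 2 : ℝ) := by
          gcongr
          exact hov.trans (by gcongr)
      _ ≤ (N : ℝ≥0∞) ^ (1 / 2 : ℝ) * (2 ^ (1 / 2 : ℝ) * ∑ p ∈ t, ballL2 h (z j + ν • p) ν) := by
          rw [ENNReal.mul_rpow_of_nonneg _ _ (by norm_num)]
          gcongr
          exact rpow_half_sum_le t _
      _ ≤ _ := by
          rw [← mul_assoc]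
          gcongr
          rw [← ENNReal.mul_rpow_of_nonneg _ _ (by norm_num), ← Real.mul_rpow (by positivity)
            (by positivity), ← ENNReal.ofReal_rpow_of_nonneg (by positivity) (by norm_num)]
          gcongr
          rw [← ENNReal.ofReal_natCast, ← ENNReal.ofReal_ofNat,
            ← ENNReal.ofReal_mul (by positivity)]
          refine ENNReal.ofReal_le_ofReal ?_
          nlinarith
  calc ∑' k : ℕ, ballL2 h (x₀ + (μ * k) • ω) μ
      ≤ ∑' j : ℕ, ∑ r ∈ Finset.range N, ballL2 h (x₀ + (μ * (⌈(j : ℝ) / a⌉₊ + r : ℕ)) • ω) μ :=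
        tsum_le_tsum_blocks ha (fun k : ℕ => ballL2 h (x₀ + (μ * k) • ω) μ)
    _ ≤ ∑' j : ℕ, ENNReal.ofReal ((2 * (1 + B)) ^ (1 / 2 : ℝ) * (ν / μ) ^ (1 / 2 : ℝ)) *
        ∑ p ∈ t, ballL2 h (z j + ν • p) ν := ENNReal.tsum_le_tsum hblock
    _ = ENNReal.ofReal ((2 * (1 + B)) ^ (1 / 2 : ℝ) * (ν / μ) ^ (1 / 2 : ℝ)) *
        ∑ p ∈ t, ∑' j : ℕ, ballL2 h (z j + ν • p) ν := by
        rw [ENNReal.tsum_mul_left, Summable.tsum_finsetSum fun _ _ => ENNReal.summable]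
    _ ≤ ENNReal.ofReal ((2 * (1 + B)) ^ (1 / 2 : ℝ) * (ν / μ) ^ (1 / 2 : ℝ)) *
        (t.card * dlE ν h) := by
        gcongr
        refine (Finset.sum_le_sum (g := fun _ => dlE ν h) fun p _ => ?_).trans (by simp)
        -- For fixed p in the cover, the balls of all blocks form a single ray with base point x₀ +
        -- νp.
        refine le_trans (le_of_eq (tsum_congr fun k => ?_))
          (tsum_ballL2_le_dlE ν h (x₀ + ν • p) ω hω)
        simp only [z]
        rw [add_right_comm]
    _ ≤ _ := by
        rw [← mul_assoc]
        gcongr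
        rw [← ENNReal.ofReal_natCast, ← ENNReal.ofReal_mul (by positivity)]
        refine ENNReal.ofReal_le_ofReal ?_
        have : 0 ≤ (2 * (1 + B)) ^ (1 / 2 : ℝ) * (ν / μ) ^ (1 / 2 : ℝ) := by positivity
        nlinarith

/-- Keep only the term k = 0. A direction must exist, which is where n ≥ 1 enters: for n = 0 the
sphere is empty and the norm vanishes. -/
theorem ballL2_le_dlE {n : ℕ} (hn : 1 ≤ n) (μ : ℝ) (h : Rn n → ℝ≥0∞) (c : Rn n) :
    ballL2 h c μ ≤ dlE μ h := by
  refine le_trans ?_ (tsum_ballL2_le_dlE μ h c (EuclideanSpace.single (⟨0, hn⟩ : Fin n) (1 : ℝ))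
    (by simp))
  refine le_trans (le_of_eq ?_) (ENNReal.le_tsum 0)
  simp

/-- Control by nearby values bounds a function pointwise. -/
theorem le_dlE_of_le_nearby {n : ℕ} (hn : 1 ≤ n) {μ : ℝ} (hμ : 1 ≤ μ) {w W : Rn n → ℝ≥0∞}
    (H : ∀ x p, ‖x - p‖ ≤ 1 → w x ≤ W p) (x : Rn n) :
    w x ≤ (volume (Metric.ball (0 : Rn n) 1))⁻¹ ^ (1 / 2 : ℝ) * dlE μ W := by
  have hV0 := volume_unitBall_ne_zero n
  have hVt := volume_unitBall_ne_top n
  have h1 := sq_mul_volume_le (W := W) (z := x) (a := w x) fun p hp => H x p (by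
    rw [Metric.mem_ball, dist_comm, dist_eq_norm] at hp; exact hp.le)
  have h2 : w x ^ 2 ≤ (volume (Metric.ball (0 : Rn n) 1))⁻¹ *
      ∫⁻ p in Metric.ball x μ, W p ^ 2 := by
    rw [← ENNReal.mul_le_iff_le_inv hV0 hVt, mul_comm]
    exact h1.trans (lintegral_mono_set (Metric.ball_subset_ball hμ))
  calc w x = (w x ^ 2) ^ (1 / 2 : ℝ) := by
        rw [← ENNReal.rpow_two, ← ENNReal.rpow_mul]; simp
    _ ≤ ((volume (Metric.ball (0 : Rn n) 1))⁻¹ *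
          ∫⁻ p in Metric.ball x μ, W p ^ 2) ^ (1 / 2 : ℝ) := by gcongr
    _ ≤ _ := by
        rw [ENNReal.mul_rpow_of_nonneg _ _ (by norm_num)]
        gcongr
        exact ballL2_le_dlE hn μ W x

/-! ### Distributions given by functions -/

/-- Products of g with bump functions equal to 1 on growing balls are integrable, hence measurable,
and converge to g everywhere. -/
theorem IsFunction.aestronglyMeasurable {n m : ℕ} {u : 𝓢'(Rn n, Cm m)} {g : Rn n → Cm m}
    (hg : IsFunction u g) : AEStronglyMeasurable g volume := by
  let b : ∀ N : ℕ, ContDiffBump (0 : Rn n) := fun N => ⟨N + 1, N + 2, by positivity, by linarith⟩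
  let φ : ∀ N : ℕ, 𝓢(Rn n, ℂ) := fun N =>
    HasCompactSupport.toSchwartzMap (f := Complex.ofRealCLM ∘ (b N))
      ((b N).hasCompactSupport.comp_left rfl) (Complex.ofRealCLM.contDiff.comp (b N).contDiff)
  refine aestronglyMeasurable_of_tendsto_ae (f := fun N x => φ N x • g x) Filter.atTop
    (fun N => (hg (φ N)).1.aestronglyMeasurable) (Filter.Eventually.of_forall fun x => ?_)
  refine tendsto_const_nhds.congr' ?_
  obtain ⟨N₀, hN₀⟩ := exists_nat_ge ‖x‖
  filter_upwards [Filter.eventually_ge_atTop N₀] with N hN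
  have h1 : (b N) x = 1 := by
    refine (b N).one_of_mem_closedBall ?_
    rw [mem_closedBall_zero_iff]
    have : (N₀ : ℝ) ≤ N := by exact_mod_cast hN
    change ‖x‖ ≤ (N : ℝ) + 1
    linarith
  have h2 : φ N x = 1 := by
    change ((b N x : ℝ) : ℂ) = 1
    rw [h1]; simp
  rw [h2, one_smul]

theorem IsFunction.congr_ae {n m : ℕ} {u : 𝓢'(Rn n, Cm m)} {g g' : Rn n → Cm m}
    (hg : IsFunction u g) (h : g =ᵐ[volume] g') : IsFunction u g' := by
  intro φ
  have h1 : (fun x => φ x • g x) =ᵐ[volume] fun x => φ x • g' x := by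
    filter_upwards [h] with x hx
    rw [hx]
  exact ⟨(hg φ).1.congr h1, (hg φ).2.trans (integral_congr_ae h1)⟩

theorem IsFunction.add {n m : ℕ} {u u' : 𝓢'(Rn n, Cm m)} {g g' : Rn n → Cm m}
    (hg : IsFunction u g) (hg' : IsFunction u' g') :
    IsFunction (u + u') (fun x => g x + g' x) := by
  intro φ
  simp_rw [smul_add]
  refine ⟨(hg φ).1.add (hg' φ).1, ?_⟩
  rw [integral_add (hg φ).1 (hg' φ).1, ← (hg φ).2, ← (hg' φ).2]
  rfl

theorem IsFunction.smul {n m : ℕ} {u : 𝓢'(Rn n, Cm m)} {g : Rn n → Cm m}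
    (hg : IsFunction u g) (c : ℂ) : IsFunction (c • u) (fun x => c • g x) := by
  intro φ
  simp_rw [smul_comm _ c]
  refine ⟨(hg φ).1.smul c, ?_⟩
  rw [integral_smul, ← (hg φ).2]
  rfl

theorem isFunction_zero (n m : ℕ) : IsFunction (0 : 𝓢'(Rn n, Cm m)) (fun _ => 0) := by
  intro φ
  simp

theorem dlFun_congr_ae {n : ℕ} {G : Type*} [NormedAddCommGroup G] {g g' : Rn n → G} (μ : ℝ)
    (h : g =ᵐ[volume] g') : dlFun μ g = dlFun μ g' := by
  unfold dlFun
  refine iSup_congr fun x₀ => iSup_congr fun ω => tsum_congr fun k => eLpNorm_congr_ae ?_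
  filter_upwards [h] with x hx
  simp [Set.indicator, hx]

theorem IsFunction.exists_stronglyMeasurable {n m : ℕ} {u : 𝓢'(Rn n, Cm m)} {g : Rn n → Cm m}
    (hg : IsFunction u g) : ∃ g', StronglyMeasurable g' ∧ IsFunction u g' ∧ g =ᵐ[volume] g' :=
  ⟨_, hg.aestronglyMeasurable.stronglyMeasurable_mk,
    hg.congr_ae hg.aestronglyMeasurable.ae_eq_mk, hg.aestronglyMeasurable.ae_eq_mk⟩

/-! ### Elementary properties of the norms -/

theorem dlNorm_le_dlFun {n m : ℕ} {u : 𝓢'(Rn n, Cm m)} {g : Rn n → Cm m} (hg : IsFunction u g)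
    (μ : ℝ) : dlNorm μ u ≤ dlFun μ g := iInf₂_le g hg

/-- Reduces a bound by the infimum to one measurable representative of finite norm. The factor must
be nonzero to dispose of an infinite norm, so the constants below are kept strictly positive, some
of them by an added 1. -/
theorem le_mul_dlNorm {n m : ℕ} {u : 𝓢'(Rn n, Cm m)} {μ : ℝ} {X C : ℝ≥0∞} (hC : C ≠ 0)
    (hC' : C ≠ ∞) (H : ∀ g, StronglyMeasurable g → IsFunction u g → dlFun μ g < ∞ →
      X ≤ C * dlFun μ g) : X ≤ C * dlNorm μ u := by
  unfold dlNorm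
  rw [ENNReal.mul_iInf_of_ne hC hC']
  refine le_iInf fun g => ?_
  rw [ENNReal.mul_iInf_of_ne hC hC']
  refine le_iInf fun hg => ?_
  obtain ⟨g', hm, hg', he⟩ := hg.exists_stronglyMeasurable
  rw [dlFun_congr_ae μ he]
  by_cases ht : dlFun μ g' = ∞
  · rw [ht, ENNReal.mul_top hC]; exact le_top
  · exact H g' hm hg' (lt_top_iff_ne_top.2 ht)

theorem le_dlNorm_add {n m : ℕ} {u : 𝓢'(Rn n, Cm m)} {μ : ℝ} {X b : ℝ≥0∞}
    (H : ∀ g, StronglyMeasurable g → IsFunction u g → X ≤ dlFun μ g + b) :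
    X ≤ dlNorm μ u + b := by
  unfold dlNorm
  rw [ENNReal.iInf_add]
  refine le_iInf fun g => ?_
  rw [ENNReal.iInf_add]
  refine le_iInf fun hg => ?_
  obtain ⟨g', hm, hg', he⟩ := hg.exists_stronglyMeasurable
  rw [dlFun_congr_ae μ he]
  exact H g' hm hg'

theorem dlFun_add_le {n : ℕ} {G : Type*} [NormedAddCommGroup G] {g g' : Rn n → G} {μ : ℝ}
    (hμ : 0 < μ) (hg : StronglyMeasurable g) (hg' : StronglyMeasurable g') :
    dlFun μ (fun x => g x + g' x) ≤ dlFun μ g + dlFun μ g' := by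
  rw [dlFun_eq_dlE hμ, dlFun_eq_dlE hμ, dlFun_eq_dlE hμ]
  exact (dlE_mono (fun x => enorm_add_le _ _) μ).trans (dlE_add_le hg.enorm hg'.enorm μ)

theorem dlNorm_add_le {n m : ℕ} {μ : ℝ} (hμ : 0 < μ) (u v : 𝓢'(Rn n, Cm m)) :
    dlNorm μ (u + v) ≤ dlNorm μ u + dlNorm μ v := by
  refine le_dlNorm_add fun g hg hug => ?_
  rw [add_comm (dlFun μ g)]
  refine le_dlNorm_add fun g' hg' hvg' => ?_
  rw [add_comm (dlFun μ g')]
  exact (dlNorm_le_dlFun (hug.add hvg') μ).trans (dlFun_add_le hμ hg hg')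

theorem dlNorm_zero {n m : ℕ} {μ : ℝ} (hμ : 0 < μ) : dlNorm μ (0 : 𝓢'(Rn n, Cm m)) = 0 := by
  refine le_antisymm ((dlNorm_le_dlFun (isFunction_zero n m) μ).trans ?_) zero_le
  rw [dlFun_eq_dlE hμ]
  refine dlE_le fun x₀ ω _ => ?_
  simp [ballL2]

theorem dlNorm_smul_le {n m : ℕ} {μ : ℝ} (hμ : 0 < μ) (c : ℂ) (u : 𝓢'(Rn n, Cm m)) :
    dlNorm μ (c • u) ≤ ‖c‖ₑ * dlNorm μ u := by
  rcases eq_or_ne c 0 with rfl | hc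
  · have h0 : (0 : ℂ) • u = 0 := zero_smul ℂ u
    rw [h0, dlNorm_zero hμ]; exact zero_le
  · refine le_mul_dlNorm (by simpa using hc) (by simp) fun g hg hug _ => ?_
    refine (dlNorm_le_dlFun (hug.smul c) μ).trans (le_of_eq ?_)
    rw [dlFun_eq_dlE hμ, dlFun_eq_dlE hμ, ← dlE_const_mul hg.enorm]
    simp_rw [enorm_smul]

theorem dlNorm_sub_le {n m : ℕ} {μ : ℝ} (hμ : 0 < μ) (u v : 𝓢'(Rn n, Cm m)) :
    dlNorm μ (u - v) ≤ dlNorm μ u + dlNorm μ v := by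
  rw [sub_eq_add_neg, ← neg_one_smul ℂ v]
  refine (dlNorm_add_le hμ _ _).trans ?_
  gcongr
  exact (dlNorm_smul_le hμ _ _).trans (by simp)

theorem dlNorm_sum_le {n m : ℕ} {μ : ℝ} (hμ : 0 < μ) {ι : Type*} (t : Finset ι)
    (u : ι → 𝓢'(Rn n, Cm m)) : dlNorm μ (∑ i ∈ t, u i) ≤ ∑ i ∈ t, dlNorm μ (u i) := by
  classical
  induction t using Finset.induction_on with
  | empty => simp [dlNorm_zero hμ]
  | insert i t hi ih =>
    rw [Finset.sum_insert hi, Finset.sum_insert hi]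
    exact (dlNorm_add_le hμ _ _).trans (by gcongr)

/-- Comparison of the `𝒟L²` norms at two scales. -/
theorem exists_dlNorm_le_scale (n m : ℕ) {B : ℝ} (hB : 0 < B) :
    ∃ C : ℝ, 0 < C ∧ ∀ (μ ν : ℝ), 0 < μ → 0 < ν → μ ≤ B * ν → ∀ u : 𝓢'(Rn n, Cm m),
      dlNorm μ u ≤ ENNReal.ofReal (C * (ν / μ) ^ (1 / 2 : ℝ)) * dlNorm ν u := by
  obtain ⟨C, hC, H⟩ := exists_dlE_le_scale n hB
  refine ⟨C, hC, fun μ ν hμ hν hμν u => le_mul_dlNorm ?_ ENNReal.ofReal_ne_top fun g hg hug _ => ?_⟩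
  · rw [Ne, ENNReal.ofReal_eq_zero, not_le]; positivity
  · refine (dlNorm_le_dlFun hug μ).trans ?_
    rw [dlFun_eq_dlE hμ, dlFun_eq_dlE hν]
    exact H μ ν hμ hν hμν _ hg.enorm

/-- The ℓ² size of the gradient is at most the ℓ¹ size. If the inequality failed, representatives of
the partial derivatives, each optimal up to a small δ, would contradict it. -/
theorem dlGradNorm_le_sum {n m : ℕ} {μ : ℝ} (hμ : 0 < μ) (u : 𝓢'(Rn n, Cm m)) :
    dlGradNorm μ u ≤ ∑ i : Fin n, dlNorm μ (∂_{EuclideanSpace.single i (1 : ℝ)} u) := by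
  by_contra! hlt
  have hne : ∀ i : Fin n, dlNorm μ (∂_{EuclideanSpace.single i (1 : ℝ)} u) ≠ ∞ := fun i hi =>
    (hlt.trans_le le_top).ne (ENNReal.sum_eq_top.2 ⟨i, Finset.mem_univ i, hi⟩)
  obtain ⟨c, hc1, hc2⟩ := exists_between hlt
  obtain ⟨δ, hδ, hδs⟩ : ∃ δ : ℝ≥0, 0 < δ ∧
      ∑ i : Fin n, dlNorm μ (∂_{EuclideanSpace.single i (1 : ℝ)} u) + n * δ < c := by
    obtain ⟨η, hη, hη'⟩ := ENNReal.lt_iff_exists_add_pos_lt.1 hc1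
    refine ⟨η / (n + 1), by positivity, lt_of_le_of_lt ?_ hη'⟩
    gcongr
    have : (n : ℝ≥0) * (η / (n + 1)) ≤ η := by
      rw [mul_div_assoc', div_le_iff₀ (by positivity), mul_comm]
      gcongr; simp
    exact_mod_cast this
  have hex : ∀ i : Fin n, ∃ g, StronglyMeasurable g ∧
      IsFunction (∂_{EuclideanSpace.single i (1 : ℝ)} u) g ∧
      dlFun μ g ≤ dlNorm μ (∂_{EuclideanSpace.single i (1 : ℝ)} u) + δ := by
    intro i
    have h1 := ENNReal.lt_add_right (hne i) (ENNReal.coe_ne_zero.2 hδ.ne')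
    obtain ⟨g, hg⟩ := iInf_lt_iff.1 (show iInf _ < _ from h1)
    obtain ⟨hg1, hg2⟩ := iInf_lt_iff.1 hg
    obtain ⟨g', hm, hg', he⟩ := hg1.exists_stronglyMeasurable
    exact ⟨g', hm, hg', by rw [← dlFun_congr_ae μ he]; exact hg2.le⟩
  choose g hgm hgf hgb using hex
  have hsum : ∀ t : Finset (Fin n), dlE μ (fun x => ∑ i ∈ t, ‖g i x‖ₑ) ≤
      ∑ i ∈ t, dlFun μ (g i) := by
    classical
    intro t
    induction t using Finset.induction_on with
    | empty => exact dlE_le fun x₀ ω _ => by simp [ballL2]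
    | insert i t hi ih =>
      simp_rw [Finset.sum_insert hi]
      refine (dlE_add_le (hgm i).enorm
        (Finset.measurable_fun_sum t fun j _ => (hgm j).enorm) μ).trans ?_
      rw [dlFun_eq_dlE hμ (g i)]
      gcongr
  have hfin : dlGradNorm μ u ≤ ∑ i, dlFun μ (g i) := by
    refine (iInf₂_le g hgf).trans ?_
    rw [dlFun_eq_dlE hμ]
    refine (dlE_mono (fun x => ?_) μ).trans (hsum Finset.univ)
    have h1 : ‖(WithLp.toLp 2 (fun i => g i x) : PiLp 2 (fun _ : Fin n => Cm m))‖ ≤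
        ∑ i, ‖g i x‖ := by
      rw [PiLp.norm_eq_of_L2]
      refine Real.sqrt_le_iff.2 ⟨by positivity, ?_⟩
      exact Finset.sum_sq_le_sq_sum_of_nonneg fun i _ => norm_nonneg _
    rw [← ofReal_norm]
    refine (ENNReal.ofReal_le_ofReal h1).trans ?_
    rw [ENNReal.ofReal_sum_of_nonneg fun i _ => norm_nonneg _]
    simp [ofReal_norm]
  refine absurd (hfin.trans (Finset.sum_le_sum fun i _ => hgb i)) (not_le.2 ?_)
  rw [Finset.sum_add_distrib]
  simp only [Finset.sum_const, Finset.card_univ, Fintype.card_fin, nsmul_eq_mul]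
  exact hδs.trans hc2

/-! ### The uniform norm -/

theorem linftyNorm_le_eLpNorm {n m : ℕ} {u : 𝓢'(Rn n, Cm m)} {g : Rn n → Cm m}
    (hg : IsFunction u g) : linftyNorm u ≤ eLpNorm g ∞ volume := iInf₂_le g hg

theorem linftyNorm_le_of_enorm_le {n m : ℕ} {u : 𝓢'(Rn n, Cm m)} {g : Rn n → Cm m}
    (hg : IsFunction u g) {b : ℝ≥0∞} (hb : ∀ x, ‖g x‖ₑ ≤ b) : linftyNorm u ≤ b := by
  refine (linftyNorm_le_eLpNorm hg).trans ?_
  rw [eLpNorm_exponent_top]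
  exact essSup_le_of_ae_le _ (Filter.Eventually.of_forall hb)

/-- Replacing a representative by 0 on the null set where it exceeds b makes the bound hold
everywhere, so that series of representatives converge at every point. -/
theorem exists_bounded_of_linftyNorm_lt {n m : ℕ} {u : 𝓢'(Rn n, Cm m)} {b : ℝ≥0∞}
    (h : linftyNorm u < b) : ∃ g, StronglyMeasurable g ∧ IsFunction u g ∧ ∀ x, ‖g x‖ₑ ≤ b := by
  obtain ⟨g, hg⟩ := iInf_lt_iff.1 h
  obtain ⟨hg1, hg2⟩ := iInf_lt_iff.1 hg
  obtain ⟨g', hm, hg', he⟩ := hg1.exists_stronglyMeasurable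
  rw [eLpNorm_congr_ae he, eLpNorm_exponent_top] at hg2
  have hms : MeasurableSet {x | ‖g' x‖ₑ ≤ b} := measurableSet_le hm.enorm measurable_const
  refine ⟨{x | ‖g' x‖ₑ ≤ b}.indicator g', hm.indicator hms, hg'.congr_ae ?_, fun x => ?_⟩
  · filter_upwards [enorm_ae_le_eLpNormEssSup g' volume] with x hx
    rw [Set.indicator_of_mem]
    exact hx.trans hg2.le
  · by_cases hx : x ∈ {x | ‖g' x‖ₑ ≤ b}
    · rw [Set.indicator_of_mem hx]; exact hx
    · rw [Set.indicator_of_notMem hx]; simp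

/-- The uniform norm is countably subadditive. -/
theorem linftyNorm_le_tsum {n m : ℕ} {u : 𝓢'(Rn n, Cm m)} {v : ℕ → 𝓢'(Rn n, Cm m)}
    (hlim : ∀ φ : 𝓢(Rn n, ℂ), Filter.Tendsto (fun N => ∑ i ∈ Finset.range N, v i φ) Filter.atTop
      (nhds (u φ))) : linftyNorm u ≤ ∑' i, linftyNorm (v i) := by
  refine ENNReal.le_of_forall_pos_le_add fun δ hδ htop => ?_
  -- A summable slack η allows a bounded representative for each term; their sum converges uniformly
  -- and represents u by dominated summation against a test function.
  obtain ⟨η, hη, hηs⟩ := ENNReal.exists_pos_sum_of_countable' (ENNReal.coe_ne_zero.2 hδ.ne') ℕ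
  have hfin : ∀ i, linftyNorm (v i) ≠ ∞ := fun i => (lt_of_le_of_lt (ENNReal.le_tsum i) htop).ne
  choose g hgm hgf hgb using fun i =>
    exists_bounded_of_linftyNorm_lt (ENNReal.lt_add_right (hfin i) (hη i).ne')
  set b : ℕ → ℝ≥0∞ := fun i => linftyNorm (v i) + η i with hb
  have hbsum : ∑' i, b i ≤ ∑' i, linftyNorm (v i) + δ := by
    rw [hb, ENNReal.tsum_add]
    gcongr
  have hbtop : ∑' i, b i ≠ ∞ := (hbsum.trans_lt (ENNReal.add_lt_top.2
    ⟨htop, ENNReal.coe_lt_top⟩)).ne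
  have hbs : Summable fun i => (b i).toReal := ENNReal.summable_toReal hbtop
  have hgb' : ∀ i x, ‖g i x‖ ≤ (b i).toReal := fun i x => by
    rw [← toReal_enorm]
    exact ENNReal.toReal_mono (ne_top_of_le_ne_top hbtop (ENNReal.le_tsum i)) (hgb i x)
  have hsx : ∀ x, Summable fun i => g i x := fun x =>
    Summable.of_norm_bounded hbs fun i => hgb' i x
  set G : Rn n → Cm m := fun x => ∑' i, g i x with hG
  have hGm : StronglyMeasurable G := by
    refine stronglyMeasurable_of_tendsto (f := fun N x => ∑ i ∈ Finset.range N, g i x)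
      Filter.atTop (fun N => Finset.stronglyMeasurable_fun_sum _ fun i _ => hgm i) ?_
    exact tendsto_pi_nhds.2 fun x => (hsx x).hasSum.tendsto_sum_nat
  have hGb : ∀ x, ‖G x‖ₑ ≤ ∑' i, b i := fun x => by
    have h1 : ‖G x‖ ≤ ∑' i, (b i).toReal :=
      tsum_of_norm_bounded hbs.hasSum fun i => hgb' i x
    rw [← ENNReal.tsum_toReal_eq fun i => ne_top_of_le_ne_top hbtop (ENNReal.le_tsum i)] at h1
    rw [← ofReal_norm]
    exact (ENNReal.ofReal_le_ofReal h1).trans ENNReal.ofReal_toReal_le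
  refine (linftyNorm_le_of_enorm_le (g := G) (fun φ => ?_) hGb).trans hbsum
  have hφ : Integrable (fun x => ‖φ x‖) := φ.integrable.norm
  have hsum : Summable fun i => ∫ x, ‖φ x • g i x‖ := by
    refine Summable.of_nonneg_of_le (fun i => integral_nonneg fun x => norm_nonneg _) (fun i => ?_)
      (hbs.mul_left (∫ x, ‖φ x‖))
    rw [← integral_mul_const]
    refine integral_mono (hgf i φ).1.norm (hφ.mul_const _) fun x => ?_
    simp only [norm_smul]
    exact mul_le_mul_of_nonneg_left (hgb' i x) (norm_nonneg _)
  have hs := hasSum_integral_of_summable_integral_norm (fun i => (hgf i φ).1) hsum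
  have he : ∀ x, ∑' i, φ x • g i x = φ x • G x := fun x => (hsx x).tsum_const_smul _
  simp_rw [he] at hs
  constructor
  · refine (hφ.mul_const (∑' i, b i).toReal).mono
      (φ.continuous.aestronglyMeasurable.smul hGm.aestronglyMeasurable)
      (Filter.Eventually.of_forall fun x => ?_)
    rw [norm_smul, norm_mul, norm_norm, Real.norm_of_nonneg ENNReal.toReal_nonneg]
    refine mul_le_mul_of_nonneg_left ?_ (norm_nonneg _)
    rw [← toReal_enorm]
    exact ENNReal.toReal_mono hbtop (hGb x)
  · refine tendsto_nhds_unique (hlim φ) ?_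
    refine hs.tendsto_sum_nat.congr fun N => Finset.sum_congr rfl fun i _ => ?_
    exact (hgf i φ).2.symm

theorem le_linftyNorm_add {n m : ℕ} {u : 𝓢'(Rn n, Cm m)} {X b : ℝ≥0∞}
    (H : ∀ g, IsFunction u g → X ≤ eLpNorm g ∞ volume + b) : X ≤ linftyNorm u + b := by
  unfold linftyNorm
  rw [ENNReal.iInf_add]
  refine le_iInf fun g => ?_
  rw [ENNReal.iInf_add]
  exact le_iInf fun hg => H g hg

theorem linftyNorm_add_le {n m : ℕ} (u v : 𝓢'(Rn n, Cm m)) :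
    linftyNorm (u + v) ≤ linftyNorm u + linftyNorm v := by
  refine le_linftyNorm_add fun g hg => ?_
  rw [add_comm (eLpNorm g ∞ volume)]
  refine le_linftyNorm_add fun g' hg' => ?_
  rw [add_comm (eLpNorm g' ∞ volume)]
  exact (linftyNorm_le_eLpNorm (hg.add hg')).trans
    (eLpNorm_add_le hg.aestronglyMeasurable hg'.aestronglyMeasurable le_top)

theorem linftyNorm_sub_le {n m : ℕ} (u v : 𝓢'(Rn n, Cm m)) :
    linftyNorm (u - v) ≤ linftyNorm u + linftyNorm v := by
  rw [sub_eq_add_neg, ← neg_one_smul ℂ v]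
  refine (linftyNorm_add_le _ _).trans ?_
  gcongr
  refine le_iInf₂ fun g hg => (linftyNorm_le_eLpNorm (hg.smul (-1))).trans (le_of_eq ?_)
  simp_rw [neg_one_smul]
  exact eLpNorm_neg g ∞ volume

theorem linftyNorm_sum_le {n m : ℕ} {ι : Type*} (t : Finset ι) (u : ι → 𝓢'(Rn n, Cm m)) :
    linftyNorm (∑ i ∈ t, u i) ≤ ∑ i ∈ t, linftyNorm (u i) := by
  classical
  induction t using Finset.induction_on with
  | empty => exact linftyNorm_le_of_enorm_le (isFunction_zero n m) (by simp)
  | insert i t hi ih =>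
    rw [Finset.sum_insert hi, Finset.sum_insert hi]
    exact (linftyNorm_add_le _ _).trans (by gcongr)

/-! ### Rescaling -/

theorem lintegral_comp_smul {n : ℕ} {h : Rn n → ℝ≥0∞} (hh : Measurable h) {ε : ℝ} (hε : 0 < ε) :
    ∫⁻ x, h (ε • x) = ENNReal.ofReal ((ε ^ n)⁻¹) * ∫⁻ x, h x := by
  rw [← lintegral_map hh (measurable_const_smul ε),
    Measure.map_addHaar_smul volume hε.ne', lintegral_smul_measure, finrank_euclideanSpace_fin,
    abs_of_pos (by positivity), smul_eq_mul]

theorem ballL2_comp_smul {n : ℕ} {h : Rn n → ℝ≥0∞} (hh : Measurable h) {ε : ℝ} (hε : 0 < ε)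
    (c : Rn n) (r : ℝ) : ballL2 (fun x => h (ε • x)) c r =
      ENNReal.ofReal (ε ^ (-((n : ℝ) / 2))) * ballL2 h (ε • c) (ε * r) := by
  unfold ballL2
  have h1 : ENNReal.ofReal (ε ^ (-((n : ℝ) / 2))) =
      ENNReal.ofReal ((ε ^ n)⁻¹) ^ (1 / 2 : ℝ) := by
    rw [← inv_pow, ofReal_pow_rpow_half (by positivity), Real.inv_rpow hε.le, Real.rpow_neg hε.le]
  rw [h1, ← ENNReal.mul_rpow_of_nonneg _ _ (by norm_num)]
  congr 1
  rw [← lintegral_indicator Metric.isOpen_ball.measurableSet,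
    ← lintegral_indicator Metric.isOpen_ball.measurableSet,
    ← lintegral_comp_smul ((hh.pow_const 2).indicator Metric.isOpen_ball.measurableSet) hε]
  refine lintegral_congr fun x => ?_
  have : ε • x ∈ Metric.ball (ε • c) (ε * r) ↔ x ∈ Metric.ball c r := by
    rw [Metric.mem_ball, Metric.mem_ball, dist_smul₀, Real.norm_of_nonneg hε.le,
      mul_lt_mul_iff_right₀ hε]
  simp [Set.indicator, this]

theorem dlE_comp_smul_le {n : ℕ} {h : Rn n → ℝ≥0∞} (hh : Measurable h) {ε : ℝ} (hε : 0 < ε)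
    (μ : ℝ) : dlE μ (fun x => h (ε • x)) ≤
      ENNReal.ofReal (ε ^ (-((n : ℝ) / 2))) * dlE (ε * μ) h := by
  refine dlE_le fun x₀ ω hω => ?_
  simp_rw [ballL2_comp_smul hh hε]
  rw [ENNReal.tsum_mul_left]
  gcongr
  refine le_trans (le_of_eq (tsum_congr fun k => ?_)) (tsum_ballL2_le_dlE (ε * μ) h (ε • x₀) ω hω)
  rw [smul_add, smul_smul, mul_assoc]

theorem rescale_apply {n m : ℕ} {ε : ℝ} (hε : 0 < ε) (u : 𝓢'(Rn n, Cm m)) (φ : 𝓢(Rn n, ℂ)) :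
    rescale ε hε u φ = ((ε * (ε ^ n)⁻¹ : ℝ) : ℂ) •
      u (SchwartzMap.compCLMOfContinuousLinearEquiv ℂ (invDilation n ε hε) φ) := rfl

theorem compDilation_apply {n : ℕ} {ε : ℝ} (hε : 0 < ε) (φ : 𝓢(Rn n, ℂ)) (x : Rn n) :
    SchwartzMap.compCLMOfContinuousLinearEquiv ℂ (invDilation n ε hε) φ x = φ (ε⁻¹ • x) := rfl

theorem IsFunction.rescale {n m : ℕ} {u : 𝓢'(Rn n, Cm m)} {g : Rn n → Cm m}
    (hg : IsFunction u g) {ε : ℝ} (hε : 0 < ε) :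
    IsFunction (rescale ε hε u) (fun x => (ε : ℂ) • g (ε • x)) := by
  intro φ
  obtain ⟨h1, h2⟩ := hg (SchwartzMap.compCLMOfContinuousLinearEquiv ℂ (invDilation n ε hε) φ)
  have he : ∀ x, φ x • (ε : ℂ) • g (ε • x) = (ε : ℂ) •
      (fun y => SchwartzMap.compCLMOfContinuousLinearEquiv ℂ (invDilation n ε hε) φ y • g y)
        (ε • x) := fun x => by
    simp only [compDilation_apply, smul_smul, inv_mul_cancel₀ hε.ne', one_smul]
    rw [mul_comm]
  simp_rw [he]
  constructor
  · exact ((integrable_comp_smul_iff volume _ hε.ne').2 h1).smul (ε : ℂ)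
  · rw [integral_smul, Measure.integral_comp_smul volume (fun y =>
        SchwartzMap.compCLMOfContinuousLinearEquiv ℂ (invDilation n ε hε) φ y • g y),
      rescale_apply, h2, finrank_euclideanSpace_fin, abs_of_pos (by positivity),
      Complex.ofReal_mul, mul_smul, Complex.coe_smul ((ε ^ n)⁻¹)]

theorem dlNorm_rescale_le {n m : ℕ} {ε μ : ℝ} (hε : 0 < ε) (hμ : 0 < μ) (u : 𝓢'(Rn n, Cm m)) :
    dlNorm μ (rescale ε hε u) ≤
      ENNReal.ofReal (ε ^ (1 - (n : ℝ) / 2)) * dlNorm (ε * μ) u := by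
  refine le_mul_dlNorm ?_ ENNReal.ofReal_ne_top fun g hg hug _ => ?_
  · rw [Ne, ENNReal.ofReal_eq_zero, not_le]; positivity
  · refine (dlNorm_le_dlFun (hug.rescale hε) μ).trans ?_
    rw [dlFun_eq_dlE hμ, dlFun_eq_dlE (by positivity)]
    simp_rw [enorm_smul]
    have hm : Measurable fun x => ‖g x‖ₑ := hg.enorm
    rw [dlE_const_mul (h := fun x => ‖g (ε • x)‖ₑ) (hm.comp (measurable_const_smul ε))]
    refine (mul_le_mul_right (dlE_comp_smul_le hm hε μ) _).trans (le_of_eq ?_)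
    rw [← mul_assoc, ← ofReal_norm, Complex.norm_of_nonneg hε.le, ← ENNReal.ofReal_mul hε.le,
      sub_eq_add_neg, Real.rpow_add hε, Real.rpow_one]

theorem linftyNorm_rescale_le {n m : ℕ} {ε : ℝ} (hε : 0 < ε) (u : 𝓢'(Rn n, Cm m)) :
    linftyNorm (rescale ε hε u) ≤ ENNReal.ofReal ε * linftyNorm u := by
  by_cases htop : linftyNorm u = ∞
  · rw [htop, ENNReal.mul_top (by simpa using hε)]; exact le_top
  have hlt : ∀ b, linftyNorm u < b → linftyNorm (rescale ε hε u) ≤ ENNReal.ofReal ε * b := by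
    intro b hb
    obtain ⟨g, -, hug, hgb⟩ := exists_bounded_of_linftyNorm_lt hb
    refine linftyNorm_le_of_enorm_le (hug.rescale hε) fun x => ?_
    rw [enorm_smul, ← ofReal_norm, Complex.norm_of_nonneg hε.le]
    gcongr
    exact hgb _
  have hcont : Filter.Tendsto (fun b => ENNReal.ofReal ε * b) (nhdsWithin (linftyNorm u)
      (Set.Ioi (linftyNorm u))) (nhds (ENNReal.ofReal ε * linftyNorm u)) :=
    ((ENNReal.continuous_const_mul ENNReal.ofReal_ne_top).tendsto _).mono_left nhdsWithin_le_nhds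
  have : (nhdsWithin (linftyNorm u) (Set.Ioi (linftyNorm u))).NeBot :=
    nhdsGT_neBot_of_exists_gt ⟨∞, lt_top_iff_ne_top.2 htop⟩
  exact ge_of_tendsto hcont (Filter.eventually_of_mem self_mem_nhdsWithin hlt)

open FourierTransform in
theorem fourier_comp_smul {n : ℕ} {ε : ℝ} (hε : 0 < ε) (f : Rn n → ℂ) (y : Rn n) :
    𝓕 (fun x => f (ε • x)) y = (ε ^ n)⁻¹ • 𝓕 f (ε⁻¹ • y) := by
  rw [Real.fourier_eq', Real.fourier_eq']
  have := Measure.integral_comp_smul volume (fun v : Rn n =>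
    Complex.exp ((↑(-2 * Real.pi * inner ℝ v (ε⁻¹ • y)) * Complex.I)) • f v) ε
  rw [finrank_euclideanSpace_fin, abs_of_pos (by positivity)] at this
  rw [← this]
  refine integral_congr_ae (Filter.Eventually.of_forall fun v => ?_)
  simp only [inner_smul_left, inner_smul_right]
  simp [hε.ne']

open FourierTransform in
theorem fourierInv_comp_smul {n : ℕ} {ε : ℝ} (hε : 0 < ε) (f : Rn n → ℂ) (y : Rn n) :
    𝓕⁻ (fun x => f (ε • x)) y = (ε ^ n)⁻¹ • 𝓕⁻ f (ε⁻¹ • y) := by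
  rw [Real.fourierInv_eq_fourier_neg, Real.fourierInv_eq_fourier_neg, fourier_comp_smul hε,
    smul_neg]

open FourierTransform in
-- The transposed form, on test functions, of the scaling rule for multipliers: the Jacobians of the
-- two Fourier transforms are inverse to each other.
theorem compDilation_fourier_smulLeftCLM {n : ℕ} {ε : ℝ} (hε : 0 < ε) {σ : Rn n → ℂ}
    (hσ : σ.HasTemperateGrowth) (φ : 𝓢(Rn n, ℂ)) :
    SchwartzMap.compCLMOfContinuousLinearEquiv ℂ (invDilation n ε hε)
        (𝓕 (SchwartzMap.smulLeftCLM ℂ σ (𝓕⁻ φ))) =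
      𝓕 (SchwartzMap.smulLeftCLM ℂ (fun ξ => σ (ε • ξ))
        (𝓕⁻ (SchwartzMap.compCLMOfContinuousLinearEquiv ℂ (invDilation n ε hε) φ))) := by
  have hσ' : (fun ξ => σ (ε • ξ)).HasTemperateGrowth := by fun_prop
  ext y
  rw [compDilation_apply]
  have h1 : ((SchwartzMap.smulLeftCLM ℂ (fun ξ => σ (ε • ξ))
      (𝓕⁻ (SchwartzMap.compCLMOfContinuousLinearEquiv ℂ (invDilation n ε hε) φ)) :
        𝓢(Rn n, ℂ)) : Rn n → ℂ) = (ε ^ n : ℝ) • fun ξ =>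
          (SchwartzMap.smulLeftCLM ℂ σ (𝓕⁻ φ)) (ε • ξ) := by
    ext ξ
    rw [SchwartzMap.smulLeftCLM_apply_apply hσ', Pi.smul_apply,
      SchwartzMap.smulLeftCLM_apply_apply hσ, SchwartzMap.fourierInv_coe]
    have h2 := fourierInv_comp_smul (inv_pos.2 hε) φ ξ
    have h3 : (SchwartzMap.compCLMOfContinuousLinearEquiv ℂ (invDilation n ε hε) φ :
      Rn n → ℂ) = fun x => φ (ε⁻¹ • x) := rfl
    rw [h3, h2, inv_inv, inv_pow, inv_inv, smul_comm, SchwartzMap.fourierInv_coe]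
  rw [SchwartzMap.fourier_coe, SchwartzMap.fourier_coe, h1]
  have h4 : 𝓕 ((ε ^ n : ℝ) • fun ξ => (SchwartzMap.smulLeftCLM ℂ σ (𝓕⁻ φ)) (ε • ξ)) y =
      (ε ^ n : ℝ) • 𝓕 (fun ξ => (SchwartzMap.smulLeftCLM ℂ σ (𝓕⁻ φ)) (ε • ξ)) y := by
    rw [Real.fourier_eq, Real.fourier_eq, ← integral_smul]
    refine integral_congr_ae (Filter.Eventually.of_forall fun v => ?_)
    simp only [Pi.smul_apply]
    rw [smul_comm]
  rw [h4, fourier_comp_smul hε, smul_smul, mul_inv_cancel₀ (by positivity), one_smul]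

theorem fourierMultiplierCLM_rescale {n m : ℕ} {ε : ℝ} (hε : 0 < ε) {σ : Rn n → ℂ}
    (hσ : σ.HasTemperateGrowth) (u : 𝓢'(Rn n, Cm m)) :
    TemperedDistribution.fourierMultiplierCLM (Cm m) σ (rescale ε hε u) =
      rescale ε hε (TemperedDistribution.fourierMultiplierCLM (Cm m) (fun ξ => σ (ε • ξ)) u) := by
  ext1 φ
  rw [TemperedDistribution.fourierMultiplierCLM_apply_apply, rescale_apply, rescale_apply,
    TemperedDistribution.fourierMultiplierCLM_apply_apply,
    compDilation_fourier_smulLeftCLM hε hσ]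

theorem rescale_rescale_of_mul_eq_one {n m : ℕ} {a b : ℝ} (ha : 0 < a) (hb : 0 < b)
    (hab : a * b = 1) (u : 𝓢'(Rn n, Cm m)) : rescale a ha (rescale b hb u) = u := by
  obtain rfl : b = a⁻¹ := eq_inv_of_mul_eq_one_right hab
  ext1 φ
  rw [rescale_apply, rescale_apply, smul_smul]
  have h1 : SchwartzMap.compCLMOfContinuousLinearEquiv ℂ (invDilation n a⁻¹ hb)
      (SchwartzMap.compCLMOfContinuousLinearEquiv ℂ (invDilation n a ha) φ) = φ := by
    ext x
    rw [compDilation_apply, compDilation_apply, inv_inv, smul_smul, inv_mul_cancel₀ ha.ne',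
      one_smul]
  rw [h1, ← Complex.ofReal_mul]
  have h2 : a * (a ^ n)⁻¹ * (a⁻¹ * (a⁻¹ ^ n)⁻¹) = 1 := by rw [inv_pow]; field_simp
  rw [h2, Complex.ofReal_one, one_smul]

/-! ### Fourier multipliers with Schwartz symbols -/

/-- The values of a Schwartz function within a bounded distance have an integrable bound. -/
theorem exists_integrable_nearby_bound {n : ℕ} (k : 𝓢(Rn n, ℂ)) {ρ : ℝ} (hρ : 0 ≤ ρ) :
    ∃ D : Rn n → ℝ≥0∞, Measurable D ∧ ∫⁻ y, D y < ∞ ∧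
      ∀ x y, ‖x - y‖ ≤ ρ → ‖k x‖ₑ ≤ D y := by
  set S := 2 ^ (n + 1) * ((Finset.Iic (n + 1, 0)).sup fun p => SchwartzMap.seminorm ℝ p.1 p.2) k
    with hS
  have hdec : ∀ x, (1 + ‖x‖) ^ (n + 1) * ‖k x‖ ≤ S := fun x => by
    have := SchwartzMap.one_add_le_sup_seminorm_apply (𝕜 := ℝ) (m := (n + 1, 0)) (k := n + 1)
      (n := 0) le_rfl le_rfl k x
    simpa using this
  have hS0 : 0 ≤ S := le_trans (by positivity) (hdec 0)
  set d : Rn n → ℝ := fun y => S * (1 + ρ) ^ (n + 1) * (1 + ‖y‖) ^ (-((n + 1 : ℕ) : ℝ)) with hd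
  have hint : Integrable d := by
    refine (integrable_one_add_norm ?_).const_mul _
    rw [finrank_euclideanSpace_fin]; push_cast; linarith
  refine ⟨fun y => ENNReal.ofReal (d y), ?_, ?_, ?_⟩
  · refine ENNReal.measurable_ofReal.comp (Measurable.const_mul ?_ _)
    exact (measurable_norm.const_add 1).pow_const _
  · have := hint.lintegral_lt_top
    exact this
  · intro x y hxy
    rw [← ofReal_norm]
    refine ENNReal.ofReal_le_ofReal ?_
    -- A Peetre-type inequality: moving by ρ changes the weight by a bounded factor, so decay of
    -- order n+1 survives and is integrable.
    have h1 : 1 + ‖y‖ ≤ (1 + ρ) * (1 + ‖x‖) := by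
      have : ‖y‖ ≤ ‖x‖ + ρ := by
        have := norm_sub_le x (x - y)
        rw [sub_sub_cancel] at this
        linarith
      nlinarith [norm_nonneg x]
    rw [hd]
    simp only []
    rw [Real.rpow_neg (by positivity), Real.rpow_natCast, ← div_eq_mul_inv,
      le_div_iff₀ (by positivity)]
    calc ‖k x‖ * (1 + ‖y‖) ^ (n + 1) ≤ ‖k x‖ * ((1 + ρ) * (1 + ‖x‖)) ^ (n + 1) := by gcongr
      _ = ((1 + ‖x‖) ^ (n + 1) * ‖k x‖) * (1 + ρ) ^ (n + 1) := by rw [mul_pow]; ring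
      _ ≤ S * (1 + ρ) ^ (n + 1) := by gcongr; exact hdec x

theorem lintegral_ball_le_ballL2 {n : ℕ} {h : Rn n → ℝ≥0∞} (hh : Measurable h) (c : Rn n) (r : ℝ) :
    ∫⁻ x in Metric.ball c r, h x ≤ volume (Metric.ball c r) ^ (1 / 2 : ℝ) * ballL2 h c r := by
  have := ENNReal.lintegral_mul_le_Lp_mul_Lq (volume.restrict (Metric.ball c r))
    Real.HolderConjugate.two_two (aemeasurable_const (b := (1 : ℝ≥0∞))) hh.aemeasurable
  simpa [ballL2] using this

/-- Functions in `𝒟L²_μ` are integrable against Schwartz functions. -/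
theorem lintegral_schwartz_mul_lt_top {n : ℕ} (hn : 1 ≤ n) (φ : 𝓢(Rn n, ℂ)) {h : Rn n → ℝ≥0∞}
    (hh : Measurable h) {μ : ℝ} (hμ : 0 < μ) (hfin : dlE μ h < ∞) :
    ∫⁻ x, ‖φ x‖ₑ * h x < ∞ := by
  obtain ⟨D, hDm, hDi, hD⟩ := exists_integrable_nearby_bound φ hμ.le
  set V := volume (Metric.ball (0 : Rn n) μ) with hV
  have hV0 : V ≠ 0 := (Metric.measure_ball_pos volume _ hμ).ne'
  have hVt : V ≠ ∞ := measure_ball_lt_top.ne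
  have hVc : ∀ c : Rn n, volume (Metric.ball c μ) = V := fun c => by
    rw [hV, volume_ball_eq c hμ, volume_ball_eq 0 hμ]
  have hφm : Measurable fun x => ‖φ x‖ₑ := φ.continuous.enorm.measurable
  have hset : MeasurableSet {p : Rn n × Rn n | dist p.1 p.2 < μ} :=
    measurableSet_lt measurable_dist measurable_const
  -- Average over y in the ball of radius μ about x, replace φ(x) by its envelope D(y), and exchange
  -- the integrals: only the mass of h on single balls remains.
  have key : V * ∫⁻ x, ‖φ x‖ₑ * h x ≤ (∫⁻ y, D y) * (V ^ (1 / 2 : ℝ) * dlE μ h) := by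
    calc V * ∫⁻ x, ‖φ x‖ₑ * h x = ∫⁻ x, ∫⁻ y in Metric.ball x μ, ‖φ x‖ₑ * h x := by
          rw [← lintegral_const_mul V (f := fun x => ‖φ x‖ₑ * h x) (hφm.mul hh)]
          refine lintegral_congr fun x => ?_
          rw [setLIntegral_const, hVc, mul_comm]
      _ ≤ ∫⁻ x, ∫⁻ y in Metric.ball x μ, D y * h x := by
          refine lintegral_mono fun x => setLIntegral_mono' Metric.isOpen_ball.measurableSet
            fun y hy => ?_
          gcongr
          refine hD x y ?_
          rw [Metric.mem_ball, dist_comm, dist_eq_norm] at hy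
          exact hy.le
      _ = ∫⁻ x, ∫⁻ y, {p : Rn n × Rn n | dist p.1 p.2 < μ}.indicator
            (fun p => D p.2 * h p.1) (x, y) := by
          refine lintegral_congr fun x => ?_
          rw [← lintegral_indicator Metric.isOpen_ball.measurableSet]
          refine lintegral_congr fun y => ?_
          simp [Set.indicator, dist_comm]
      _ = ∫⁻ y, ∫⁻ x, {p : Rn n × Rn n | dist p.1 p.2 < μ}.indicator
            (fun p => D p.2 * h p.1) (x, y) := by
          refine lintegral_lintegral_swap (Measurable.aemeasurable ?_)
          exact ((hDm.comp measurable_snd).mul (hh.comp measurable_fst)).indicator hset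
      _ = ∫⁻ y, D y * ∫⁻ x in Metric.ball y μ, h x := by
          refine lintegral_congr fun y => ?_
          rw [← lintegral_const_mul _ hh, ← lintegral_indicator Metric.isOpen_ball.measurableSet]
          refine lintegral_congr fun x => ?_
          simp [Set.indicator]
      _ ≤ ∫⁻ y, D y * (V ^ (1 / 2 : ℝ) * dlE μ h) := by
          refine lintegral_mono fun y => ?_
          simp only []
          gcongr
          refine (lintegral_ball_le_ballL2 hh y μ).trans ?_
          rw [hVc]
          gcongr
          exact ballL2_le_dlE hn μ h y
      _ = _ := lintegral_mul_const _ hDm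
  by_contra htop
  rw [not_lt, top_le_iff] at htop
  rw [htop, ENNReal.mul_top hV0, top_le_iff] at key
  refine absurd key (ENNReal.mul_lt_top hDi (ENNReal.mul_lt_top ?_ hfin)).ne
  exact ENNReal.rpow_lt_top_of_nonneg (by norm_num) hVt

open FourierTransform in
-- The convolution theorem, applied to the inverse transforms 𝓕⁻σ and 𝓕⁻𝓕⁻φ; the two reflections x ↦
-- -x and y ↦ -y turn these into 𝓕σ and φ.
theorem fourier_smulLeftCLM_fourierInv_apply {n : ℕ} (σ φ : 𝓢(Rn n, ℂ)) (x : Rn n) :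
    𝓕 (SchwartzMap.smulLeftCLM ℂ σ (𝓕⁻ φ)) x = ∫ y, 𝓕 σ y * φ (x - y) := by
  have hneg : ∀ (f : 𝓢(Rn n, ℂ)) (y : Rn n), 𝓕⁻ f y = 𝓕 f (-y) := fun f y => by
    rw [SchwartzMap.fourierInv_coe, SchwartzMap.fourier_coe, Real.fourierInv_eq_fourier_neg]
  have h1 : SchwartzMap.convolution (ContinuousLinearMap.lsmul ℂ ℂ) (𝓕⁻ σ) (𝓕⁻ (𝓕⁻ φ)) =
      𝓕⁻ (SchwartzMap.smulLeftCLM ℂ σ (𝓕⁻ φ)) := by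
    rw [← FourierTransform.fourierInv_fourier_eq (E := 𝓢(Rn n, ℂ)) (F := 𝓢(Rn n, ℂ))
      (SchwartzMap.convolution _ _ _), SchwartzMap.fourier_convolution]
    congr 1
    ext ξ
    simp [SchwartzMap.smulLeftCLM_apply_apply σ.hasTemperateGrowth]
  have h2 := SchwartzMap.convolution_apply (ContinuousLinearMap.lsmul ℂ ℂ) (𝓕⁻ σ)
    (𝓕⁻ (𝓕⁻ φ)) (-x)
  rw [h1, hneg, neg_neg] at h2
  rw [h2, MeasureTheory.convolution, ← integral_neg_eq_self]
  refine integral_congr_ae (Filter.Eventually.of_forall fun y => ?_)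
  simp only [ContinuousLinearMap.lsmul_apply, smul_eq_mul]
  rw [hneg, neg_neg, hneg (𝓕⁻ φ), FourierTransform.fourier_fourierInv_eq]
  congr 2
  abel

theorem measurable_lintegral_enorm {n m : ℕ} (k : 𝓢(Rn n, ℂ)) {g : Rn n → Cm m}
    (hg : StronglyMeasurable g) : Measurable fun x => ∫⁻ y, ‖k y‖ₑ * ‖g (x + y)‖ₑ :=
  measurable_lintegral_mul_comp_add (h := fun x => ‖g x‖ₑ) k.continuous.enorm.measurable hg.enorm

open FourierTransform in
/-- A Fourier multiplier with a Schwartz symbol acts on functions as a convolution. -/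
theorem IsFunction.fourierMultiplierCLM {n m : ℕ} (hn : 1 ≤ n) (σ : 𝓢(Rn n, ℂ))
    {u : 𝓢'(Rn n, Cm m)} {g : Rn n → Cm m} (hug : IsFunction u g) (hg : StronglyMeasurable g)
    {μ : ℝ} (hμ : 0 < μ) (hfin : dlFun μ g < ∞) :
    IsFunction (TemperedDistribution.fourierMultiplierCLM (Cm m) σ u)
      (fun x => ∫ y, 𝓕 σ y • g (x + y)) := by
  intro φ
  set k : 𝓢(Rn n, ℂ) := 𝓕 σ with hk
  have hkm : Measurable fun x => ‖k x‖ₑ := k.continuous.enorm.measurable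
  have hgm : Measurable fun x => ‖g x‖ₑ := hg.enorm
  rw [dlFun_eq_dlE hμ] at hfin
  -- The average of |g| against |k| again has finite norm, hence pairs with φ; this justifies both
  -- uses of Fubini.
  have hF : ∫⁻ x, ‖φ x‖ₑ * ∫⁻ y, ‖k y‖ₑ * ‖g (x + y)‖ₑ < ∞ := by
    refine lintegral_schwartz_mul_lt_top hn φ (measurable_lintegral_enorm k hg) hμ ?_
    refine (dlE_lintegral_le hkm hgm μ).trans_lt (ENNReal.mul_lt_top ?_ hfin)
    exact k.integrable.2
  have hI1 : Integrable (Function.uncurry fun x y => φ x • k y • g (x + y))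
      (volume.prod volume) := by
    constructor
    · refine StronglyMeasurable.aestronglyMeasurable ?_
      exact (φ.continuous.stronglyMeasurable.comp_measurable measurable_fst).smul
        ((k.continuous.stronglyMeasurable.comp_measurable measurable_snd).smul
          (hg.comp_measurable (measurable_fst.add measurable_snd)))
    · refine lt_of_le_of_lt (le_of_eq ?_) hF
      rw [lintegral_prod _ (by
        refine Measurable.aemeasurable (StronglyMeasurable.enorm ?_)
        exact (φ.continuous.stronglyMeasurable.comp_measurable measurable_fst).smul
          ((k.continuous.stronglyMeasurable.comp_measurable measurable_snd).smul
            (hg.comp_measurable (measurable_fst.add measurable_snd))))]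
      refine lintegral_congr fun x => ?_
      rw [← lintegral_const_mul _ (f := fun y => ‖k y‖ₑ * ‖g (x + y)‖ₑ)
        (hkm.mul (hgm.comp (measurable_const_add x)))]
      refine lintegral_congr fun y => ?_
      simp [enorm_smul]
  -- This is `hI1` after the measure-preserving shear (x, y) ↦ (x - y, y).
  have hI2 : Integrable (Function.uncurry fun x y => (k y * φ (x - y)) • g x)
      (volume.prod volume) := by
    have hmp : MeasurePreserving (fun p : Rn n × Rn n => (p.1 - p.2, p.2))
        (volume.prod volume) (volume.prod volume) := by
      have := (measurePreserving_sub_prod (volume : Measure (Rn n)) (volume : Measure (Rn n)))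
      exact this
    have := hmp.integrable_comp_of_integrable hI1
    refine this.congr (Filter.Eventually.of_forall fun p => ?_)
    simp [Function.uncurry, smul_smul, mul_comm]
  constructor
  · have := hI1.integral_prod_left
    refine this.congr (Filter.Eventually.of_forall fun x => ?_)
    simp only [Function.uncurry]
    rw [integral_smul]
  · rw [TemperedDistribution.fourierMultiplierCLM_apply_apply, (hug _).2]
    calc ∫ x, (𝓕 (SchwartzMap.smulLeftCLM ℂ σ (𝓕⁻ φ))) x • g x
        = ∫ x, ∫ y, (k y * φ (x - y)) • g x := by
          refine integral_congr_ae (Filter.Eventually.of_forall fun x => ?_)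
          simp only []
          rw [fourier_smulLeftCLM_fourierInv_apply, integral_smul_const]
      _ = ∫ y, ∫ x, (k y * φ (x - y)) • g x := integral_integral_swap hI2
      _ = ∫ y, ∫ x, φ x • k y • g (x + y) := by
          refine integral_congr_ae (Filter.Eventually.of_forall fun y => ?_)
          simp only []
          rw [← integral_add_right_eq_self (fun x => (k y * φ (x - y)) • g x) y]
          refine integral_congr_ae (Filter.Eventually.of_forall fun x => ?_)
          simp only [add_sub_cancel_right, smul_smul]
          rw [mul_comm]
      _ = ∫ x, ∫ y, φ x • k y • g (x + y) := (integral_integral_swap hI1).symm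
      _ = ∫ x, φ x • ∫ y, k y • g (x + y) := by simp_rw [integral_smul]

theorem enorm_integral_smul_le {n m : ℕ} (k : 𝓢(Rn n, ℂ)) (g : Rn n → Cm m) (x : Rn n) :
    ‖∫ y, k y • g (x + y)‖ₑ ≤ ∫⁻ y, ‖k y‖ₑ * ‖g (x + y)‖ₑ := by
  refine (enorm_integral_le_lintegral_enorm _).trans (le_of_eq ?_)
  simp_rw [enorm_smul]

/-- A change of variables moves the shift x - p from g to the kernel, whose envelope D absorbs it.
This is the uncertainty principle in the form needed for the Bernstein bounds. -/
theorem lintegral_enorm_le_nearby {n m : ℕ} {k : 𝓢(Rn n, ℂ)} {ρ : ℝ} {D : Rn n → ℝ≥0∞}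
    (hD : ∀ x y, ‖x - y‖ ≤ ρ → ‖k x‖ₑ ≤ D y) (g : Rn n → Cm m) (x p : Rn n)
    (hxp : ‖x - p‖ ≤ ρ) :
    ∫⁻ y, ‖k y‖ₑ * ‖g (x + y)‖ₑ ≤ ∫⁻ y, D y * ‖g (p + y)‖ₑ := by
  rw [← lintegral_add_right_eq_self _ (p - x)]
  refine lintegral_mono fun y => ?_
  have e : x + (y + (p - x)) = p + y := by abel
  simp only []
  rw [e]
  gcongr
  refine hD _ _ ?_
  rwa [add_sub_cancel_left, norm_sub_rev]

theorem le_ofReal_toReal_add_one {a : ℝ≥0∞} (ha : a ≠ ∞) : a ≤ ENNReal.ofReal (a.toReal + 1) := by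
  refine (ENNReal.ofReal_toReal ha).symm.le.trans (ENNReal.ofReal_le_ofReal ?_)
  linarith

/-- Multipliers with Schwartz symbols are bounded in all `𝒟L²_μ`. -/
theorem exists_dlNorm_multiplier_le {n : ℕ} (hn : 1 ≤ n) (m : ℕ) (σ : 𝓢(Rn n, ℂ)) :
    ∃ C : ℝ, 0 < C ∧ ∀ μ : ℝ, 0 < μ → ∀ u : 𝓢'(Rn n, Cm m),
      dlNorm μ (TemperedDistribution.fourierMultiplierCLM (Cm m) σ u) ≤
        ENNReal.ofReal C * dlNorm μ u := by
  set k : 𝓢(Rn n, ℂ) := FourierTransform.fourier σ with hk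
  refine ⟨(∫⁻ y, ‖k y‖ₑ).toReal + 1, by positivity, fun μ hμ u =>
    le_mul_dlNorm ?_ ENNReal.ofReal_ne_top fun g hg hug hfin => ?_⟩
  · rw [Ne, ENNReal.ofReal_eq_zero, not_le]; positivity
  · refine (dlNorm_le_dlFun (hug.fourierMultiplierCLM hn σ hg hμ hfin) μ).trans ?_
    rw [dlFun_eq_dlE hμ, dlFun_eq_dlE hμ]
    refine (dlE_mono (enorm_integral_smul_le k g) μ).trans ?_
    refine (dlE_lintegral_le (h := fun x => ‖g x‖ₑ) k.continuous.enorm.measurable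
      hg.enorm μ).trans ?_
    gcongr
    exact le_ofReal_toReal_add_one k.integrable.2.ne

/-- The Bernstein inequality at unit frequency. -/
theorem exists_dlNorm_multiplier_le_bernstein {n : ℕ} (hn : 1 ≤ n) (m : ℕ) (σ : 𝓢(Rn n, ℂ))
    {A : ℝ} (hA : 0 < A) :
    ∃ C : ℝ, 0 < C ∧ ∀ μ : ℝ, 0 < μ → μ ≤ A → ∀ u : 𝓢'(Rn n, Cm m),
      dlNorm μ (TemperedDistribution.fourierMultiplierCLM (Cm m) σ u) ≤
        ENNReal.ofReal (C * μ ^ ((n : ℝ) / 2 - 1)) * dlNorm 1 u := by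
  obtain ⟨D, hDm, hDi, hD⟩ := exists_integrable_nearby_bound
    (FourierTransform.fourier σ : 𝓢(Rn n, ℂ)) (ρ := 2 * A + 2) (by positivity)
  refine ⟨((∫⁻ y, D y).toReal + 1) * (1 + A), by positivity, fun μ hμ hμA u =>
    le_mul_dlNorm ?_ ENNReal.ofReal_ne_top fun g hg hug hfin => ?_⟩
  · rw [Ne, ENNReal.ofReal_eq_zero, not_le]; positivity
  · refine (dlNorm_le_dlFun (hug.fourierMultiplierCLM hn σ hg one_pos hfin) μ).trans ?_
    rw [dlFun_eq_dlE hμ, dlFun_eq_dlE one_pos]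
    refine (dlE_le_of_le_nearby hμ hμA (W := fun p => ∫⁻ y, D y * ‖g (p + y)‖ₑ) fun x p hxp =>
      (enorm_integral_smul_le _ g x).trans (lintegral_enorm_le_nearby hD g x p hxp)).trans ?_
    refine (mul_le_mul_right (dlE_lintegral_le (h := fun x => ‖g x‖ₑ) hDm hg.enorm 1) _).trans ?_
    rw [← mul_assoc]
    gcongr
    rw [← ENNReal.ofReal_toReal hDi.ne, ← ENNReal.ofReal_mul (by positivity)]
    refine ENNReal.ofReal_le_ofReal ?_
    rw [ENNReal.toReal_ofReal ENNReal.toReal_nonneg]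
    have : 0 ≤ (1 + A) * μ ^ ((n : ℝ) / 2 - 1) := by positivity
    nlinarith

theorem exists_linftyNorm_multiplier_le {n : ℕ} (hn : 1 ≤ n) (m : ℕ) (σ : 𝓢(Rn n, ℂ)) :
    ∃ C : ℝ, 0 < C ∧ ∀ μ : ℝ, 1 ≤ μ → ∀ u : 𝓢'(Rn n, Cm m),
      linftyNorm (TemperedDistribution.fourierMultiplierCLM (Cm m) σ u) ≤
        ENNReal.ofReal C * dlNorm μ u := by
  obtain ⟨D, hDm, hDi, hD⟩ := exists_integrable_nearby_bound
    (FourierTransform.fourier σ : 𝓢(Rn n, ℂ)) (ρ := 1) (by positivity)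
  set V := (volume (Metric.ball (0 : Rn n) 1))⁻¹ ^ (1 / 2 : ℝ) with hV
  have hVt : V ≠ ∞ := ENNReal.rpow_ne_top_of_nonneg (by norm_num)
    (ENNReal.inv_ne_top.2 (volume_unitBall_ne_zero n))
  refine ⟨V.toReal * (∫⁻ y, D y).toReal + 1, by positivity, fun μ hμ u =>
    le_mul_dlNorm ?_ ENNReal.ofReal_ne_top fun g hg hug hfin => ?_⟩
  · rw [Ne, ENNReal.ofReal_eq_zero, not_le]; positivity
  · have hμ0 : 0 < μ := by linarith
    refine linftyNorm_le_of_enorm_le (hug.fourierMultiplierCLM hn σ hg hμ0 hfin) fun x => ?_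
    rw [dlFun_eq_dlE hμ0]
    refine (le_dlE_of_le_nearby hn hμ (w := fun x => ‖∫ y, _ • g (x + y)‖ₑ)
      (W := fun p => ∫⁻ y, D y * ‖g (p + y)‖ₑ) (fun x p hxp =>
      (enorm_integral_smul_le _ g x).trans (lintegral_enorm_le_nearby hD g x p hxp)) x).trans ?_
    refine (mul_le_mul_right (dlE_lintegral_le (h := fun x => ‖g x‖ₑ) hDm hg.enorm μ) _).trans ?_
    rw [← mul_assoc]
    gcongr
    rw [← ENNReal.toReal_mul]
    exact le_ofReal_toReal_add_one (ENNReal.mul_ne_top hVt hDi.ne)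

open TemperedDistribution (fourierMultiplierCLM)

/-! ### Dilated multipliers -/

/-- Conjugation by rescalings reduces every estimate at frequency 1/t to unit frequency. -/
theorem fourierMultiplierCLM_dilate {n m : ℕ} {t : ℝ} (ht : 0 < t) {σ : Rn n → ℂ}
    (hσ : σ.HasTemperateGrowth) (u : 𝓢'(Rn n, Cm m)) :
    fourierMultiplierCLM (Cm m) (fun ξ => σ (t • ξ)) u =
      rescale t⁻¹ (inv_pos.2 ht) (fourierMultiplierCLM (Cm m) σ (rescale t ht u)) := by
  rw [fourierMultiplierCLM_rescale ht hσ,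
    rescale_rescale_of_mul_eq_one _ _ (inv_mul_cancel₀ ht.ne')]

theorem ofReal_rpow_mul_rpow_inv {t a : ℝ} (ht : 0 < t) :
    ENNReal.ofReal (t⁻¹ ^ a) * ENNReal.ofReal (t ^ a) = 1 := by
  rw [← ENNReal.ofReal_mul (by positivity), ← Real.mul_rpow (by positivity) ht.le,
    inv_mul_cancel₀ ht.ne', Real.one_rpow, ENNReal.ofReal_one]

/-- The bound at unit frequency holds at every radius and the factors of the two rescalings cancel,
so the constant does not depend on t. -/
theorem exists_dlNorm_dilated_multiplier_le {n : ℕ} (hn : 1 ≤ n) (m : ℕ) (σ : 𝓢(Rn n, ℂ)) :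
    ∃ C : ℝ, 0 < C ∧ ∀ t : ℝ, 0 < t → ∀ μ : ℝ, 0 < μ → ∀ u : 𝓢'(Rn n, Cm m),
      dlNorm μ (fourierMultiplierCLM (Cm m) (fun ξ => σ (t • ξ)) u) ≤
        ENNReal.ofReal C * dlNorm μ u := by
  obtain ⟨C, hC, H⟩ := exists_dlNorm_multiplier_le hn m σ
  refine ⟨C, hC, fun t ht μ hμ u => ?_⟩
  rw [fourierMultiplierCLM_dilate ht σ.hasTemperateGrowth]
  have hμt : 0 < t⁻¹ * μ := by positivity
  calc _ ≤ ENNReal.ofReal (t⁻¹ ^ (1 - (n : ℝ) / 2)) *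
        dlNorm (t⁻¹ * μ) (fourierMultiplierCLM (Cm m) σ (rescale t ht u)) :=
        dlNorm_rescale_le _ hμ _
    _ ≤ ENNReal.ofReal (t⁻¹ ^ (1 - (n : ℝ) / 2)) * (ENNReal.ofReal C *
        (ENNReal.ofReal (t ^ (1 - (n : ℝ) / 2)) * dlNorm (t * (t⁻¹ * μ)) u)) := by
        gcongr
        exact (H _ hμt _).trans (by gcongr; exact dlNorm_rescale_le ht hμt u)
    _ = (ENNReal.ofReal (t⁻¹ ^ (1 - (n : ℝ) / 2)) * ENNReal.ofReal (t ^ (1 - (n : ℝ) / 2))) *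
        (ENNReal.ofReal C * dlNorm (t * (t⁻¹ * μ)) u) := by ring
    _ = _ := by rw [ofReal_rpow_mul_rpow_inv ht, one_mul, mul_inv_cancel_left₀ ht.ne']

/-- The Bernstein inequality at frequency `l`. -/
theorem exists_dlNorm_bernstein {n : ℕ} (hn : 1 ≤ n) (m : ℕ) (σ : 𝓢(Rn n, ℂ)) {A : ℝ}
    (hA : 0 < A) :
    ∃ C : ℝ, 0 < C ∧ ∀ l ν : ℝ, 1 ≤ l → 0 < ν → l * ν ≤ A → ∀ u : 𝓢'(Rn n, Cm m),
      dlNorm ν (fourierMultiplierCLM (Cm m) (fun ξ => σ (l⁻¹ • ξ)) u) ≤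
        ENNReal.ofReal (C * ((l * ν) ^ ((n : ℝ) / 2 - 1) * l)) * dlNorm l u := by
  obtain ⟨C, hC, H⟩ := exists_dlNorm_multiplier_le_bernstein hn m σ hA
  obtain ⟨C', hC', H'⟩ := exists_dlNorm_le_scale n m one_pos
  refine ⟨C * C', by positivity, fun l ν hl hν hA u => ?_⟩
  have hl0 : 0 < l := by linarith
  rw [fourierMultiplierCLM_dilate (inv_pos.2 hl0) σ.hasTemperateGrowth]
  calc _ ≤ ENNReal.ofReal (l⁻¹⁻¹ ^ (1 - (n : ℝ) / 2)) * dlNorm (l⁻¹⁻¹ * ν)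
          (fourierMultiplierCLM (Cm m) σ (rescale l⁻¹ (inv_pos.2 hl0) u)) :=
        dlNorm_rescale_le _ hν _
    _ ≤ ENNReal.ofReal (l⁻¹⁻¹ ^ (1 - (n : ℝ) / 2)) *
        (ENNReal.ofReal (C * (l * ν) ^ ((n : ℝ) / 2 - 1)) *
        (ENNReal.ofReal (l⁻¹ ^ (1 - (n : ℝ) / 2)) *
          (ENNReal.ofReal (C' * (l / (l⁻¹ * 1)) ^ (1 / 2 : ℝ)) * dlNorm l u))) := by
        gcongr
        rw [inv_inv]
        refine (H _ (by positivity) hA _).trans ?_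
        gcongr
        refine (dlNorm_rescale_le _ one_pos u).trans ?_
        gcongr
        -- The rescaled function at radius 1 is u at radius 1/l; the change to radius l costs
        -- (l²)^(1/2) = l, the extra factor in the bound.
        refine H' _ _ (by positivity) hl0 ?_ u
        rw [mul_one, one_mul]
        exact (inv_le_one_of_one_le₀ hl).trans hl
    _ = (ENNReal.ofReal (l⁻¹⁻¹ ^ (1 - (n : ℝ) / 2)) * ENNReal.ofReal (l⁻¹ ^ (1 - (n : ℝ) / 2))) *
        ((ENNReal.ofReal (C * (l * ν) ^ ((n : ℝ) / 2 - 1)) *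
          ENNReal.ofReal (C' * (l / (l⁻¹ * 1)) ^ (1 / 2 : ℝ))) * dlNorm l u) := by ring
    _ = _ := by
        rw [ofReal_rpow_mul_rpow_inv (inv_pos.2 hl0), one_mul, ← ENNReal.ofReal_mul (by positivity)]
        congr 2
        have h1 : (l / (l⁻¹ * 1)) ^ (1 / 2 : ℝ) = l := by
          rw [mul_one, div_inv_eq_mul, ← Real.sqrt_eq_rpow, Real.sqrt_mul_self hl0.le]
        rw [h1]; ring

/-- Radius l at frequency l becomes radius l² ≥ 1 at unit frequency, where a single ball already
controls the value at its centre. The exponent n/2 is 1 from the amplitude plus n/2-1 from the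
rescaled norm. -/
theorem exists_linftyNorm_bernstein {n : ℕ} (hn : 1 ≤ n) (m : ℕ) (σ : 𝓢(Rn n, ℂ)) :
    ∃ C : ℝ, 0 < C ∧ ∀ l : ℝ, 1 ≤ l → ∀ u : 𝓢'(Rn n, Cm m),
      linftyNorm (fourierMultiplierCLM (Cm m) (fun ξ => σ (l⁻¹ • ξ)) u) ≤
        ENNReal.ofReal (C * l ^ ((n : ℝ) / 2)) * dlNorm l u := by
  obtain ⟨C, hC, H⟩ := exists_linftyNorm_multiplier_le hn m σ
  refine ⟨C, hC, fun l hl u => ?_⟩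
  have hl0 : 0 < l := by linarith
  rw [fourierMultiplierCLM_dilate (inv_pos.2 hl0) σ.hasTemperateGrowth]
  have hl2 : 1 ≤ l * l := by nlinarith
  calc _ ≤ ENNReal.ofReal l⁻¹⁻¹ * linftyNorm
          (fourierMultiplierCLM (Cm m) σ (rescale l⁻¹ (inv_pos.2 hl0) u)) :=
        linftyNorm_rescale_le _ _
    _ ≤ ENNReal.ofReal l⁻¹⁻¹ * (ENNReal.ofReal C * (ENNReal.ofReal (l⁻¹ ^ (1 - (n : ℝ) / 2)) *
          dlNorm (l⁻¹ * (l * l)) u)) := by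
        gcongr
        refine (H _ hl2 _).trans ?_
        gcongr
        exact dlNorm_rescale_le _ (by positivity) u
    _ = _ := by
        rw [inv_mul_cancel_left₀ hl0.ne', inv_inv, ← mul_assoc, ← mul_assoc,
          ← ENNReal.ofReal_mul hl0.le, ← ENNReal.ofReal_mul (by positivity)]
        congr 2
        rw [Real.inv_rpow hl0.le, ← Real.rpow_neg hl0.le, neg_sub, Real.rpow_sub_one hl0.ne']
        field_simp

/-! ### Littlewood-Paley symbols -/

/-- The symbol of `χ(t D)`. -/
def LPCutoff.sym {n : ℕ} (χ : LPCutoff n) (t : ℝ) (ξ : Rn n) : ℂ :=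
  (χ.toFun ((2 * Real.pi * t) • ξ) : ℂ)

theorem LPCutoff.sym_smul {n : ℕ} (χ : LPCutoff n) (s t : ℝ) (ξ : Rn n) :
    χ.sym t (s • ξ) = χ.sym (t * s) ξ := by
  unfold LPCutoff.sym
  rw [smul_smul, mul_assoc]

theorem LPCutoff.norm_smul_eq {n : ℕ} {t : ℝ} (ht : 0 < t) (ξ : Rn n) :
    ‖(2 * Real.pi * t) • ξ‖ = t * ‖(2 * Real.pi) • ξ‖ := by
  rw [norm_smul, norm_smul, norm_mul, Real.norm_of_nonneg ht.le]
  ring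

theorem LPCutoff.sym_eq_one {n : ℕ} (χ : LPCutoff n) {t : ℝ} (ht : 0 < t) {ξ : Rn n}
    (h : t * ‖(2 * Real.pi) • ξ‖ ≤ 1) : χ.sym t ξ = 1 := by
  unfold LPCutoff.sym
  rw [χ.eq_one _ (by rwa [norm_smul_eq ht]), Complex.ofReal_one]

theorem LPCutoff.sym_eq_zero {n : ℕ} (χ : LPCutoff n) {t : ℝ} (ht : 0 < t) {ξ : Rn n}
    (h : 2 ≤ t * ‖(2 * Real.pi) • ξ‖) : χ.sym t ξ = 0 := by
  unfold LPCutoff.sym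
  rw [χ.eq_zero _ (by rwa [norm_smul_eq ht]), Complex.ofReal_zero]

theorem LPCutoff.hasCompactSupport_sym {n : ℕ} (χ : LPCutoff n) {t : ℝ} (ht : 0 < t) :
    HasCompactSupport (χ.sym t) := by
  refine HasCompactSupport.of_support_subset_isCompact
    (isCompact_closedBall (0 : Rn n) (2 / (2 * Real.pi * t))) fun ξ hξ => ?_
  rw [mem_closedBall_zero_iff]
  by_contra! hlt
  refine hξ (χ.sym_eq_zero ht ?_)
  rw [div_lt_iff₀ (by positivity)] at hlt
  rw [← norm_smul_eq ht, norm_smul, Real.norm_of_nonneg (by positivity)]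
  linarith

theorem LPCutoff.contDiff_sym {n : ℕ} (χ : LPCutoff n) (t : ℝ) :
    ContDiff ℝ ((⊤ : ℕ∞) : WithTop ℕ∞) (χ.sym t) :=
  Complex.ofRealCLM.contDiff.comp (χ.smooth.comp (contDiff_const_smul _))

theorem LPCutoff.hasTemperateGrowth_sym {n : ℕ} (χ : LPCutoff n) {t : ℝ} (ht : 0 < t) :
    (χ.sym t).HasTemperateGrowth :=
  (χ.hasCompactSupport_sym ht).hasTemperateGrowth (χ.contDiff_sym t)

/-- The symbol of `χ(t D)` as a Schwartz function. -/
def LPCutoff.symSchwartz {n : ℕ} (χ : LPCutoff n) {t : ℝ} (ht : 0 < t) : 𝓢(Rn n, ℂ) :=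
  (χ.hasCompactSupport_sym ht).toSchwartzMap (χ.contDiff_sym t)

theorem LPCutoff.symSchwartz_apply {n : ℕ} (χ : LPCutoff n) {t : ℝ} (ht : 0 < t) (ξ : Rn n) :
    χ.symSchwartz ht ξ = χ.sym t ξ := rfl

/-- Where the narrower cutoff is nonzero, b|2πξ| < 2, so the wider one equals 1. This lets a
fattened cutoff reproduce each piece. -/
theorem LPCutoff.sym_mul_sym {n : ℕ} (χ : LPCutoff n) {a b : ℝ} (ha : 0 < a) (hab : a ≤ b / 2) :
    χ.sym a * χ.sym b = χ.sym b := by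
  ext ξ
  have hb : 0 < b := by linarith
  rw [Pi.mul_apply]
  rcases le_or_gt 2 (b * ‖(2 * Real.pi) • ξ‖) with h | h
  · rw [χ.sym_eq_zero hb h, mul_zero]
  · rw [χ.sym_eq_one ha, one_mul]
    nlinarith [norm_nonneg ((2 * Real.pi) • ξ)]

theorem LPCutoff.lowSymbol_eq_sym {n : ℕ} (χ : LPCutoff n) (j : ℕ) :
    χ.lowSymbol j = χ.sym ((2 : ℝ) ^ j)⁻¹ := rfl

theorem LPCutoff.hasTemperateGrowth_dyadicSymbol {n : ℕ} (χ : LPCutoff n) (j : ℕ) :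
    (χ.dyadicSymbol j).HasTemperateGrowth := by
  cases j with
  | zero => exact χ.hasTemperateGrowth_sym (by positivity)
  | succ j =>
    exact (χ.hasTemperateGrowth_sym (t := ((2 : ℝ) ^ (j + 1))⁻¹) (by positivity)).sub
      (χ.hasTemperateGrowth_sym (t := ((2 : ℝ) ^ j)⁻¹) (by positivity))

theorem LPCutoff.sum_dyadicSymbol {n : ℕ} (χ : LPCutoff n) (N : ℕ) (ξ : Rn n) :
    ∑ i ∈ Finset.range (N + 1), χ.dyadicSymbol i ξ = χ.sym ((2 : ℝ) ^ N)⁻¹ ξ := by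
  induction N with
  | zero => simp [LPCutoff.dyadicSymbol, LPCutoff.lowSymbol_eq_sym]
  | succ N ih =>
    rw [Finset.sum_range_succ, ih]
    simp [LPCutoff.dyadicSymbol, LPCutoff.lowSymbol_eq_sym]

theorem LPCutoff.sum_Icc_dyadicSymbol {n : ℕ} (χ : LPCutoff n) (a b : ℕ) (hab : a ≤ b) (ξ : Rn n) :
    ∑ i ∈ Finset.Icc (a + 1) b, χ.dyadicSymbol i ξ =
      χ.sym ((2 : ℝ) ^ b)⁻¹ ξ - χ.sym ((2 : ℝ) ^ a)⁻¹ ξ := by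
  rw [eq_sub_iff_add_eq, ← χ.sum_dyadicSymbol a, ← χ.sum_dyadicSymbol b, add_comm]
  rw [Finset.range_eq_Ico, Finset.range_eq_Ico, ← Finset.sum_Ico_consecutive _ (Nat.zero_le (a + 1))
    (Nat.succ_le_succ hab)]
  rfl

theorem LPCutoff.sym_mul_dyadicSymbol {n : ℕ} (χ : LPCutoff n) {t : ℝ} (ht : 0 < t) {j : ℕ}
    (htj : t ≤ ((2 : ℝ) ^ j)⁻¹ / 2) : χ.sym t * χ.dyadicSymbol j = χ.dyadicSymbol j := by
  cases j with
  | zero => exact χ.sym_mul_sym ht htj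
  | succ j =>
    have h1 := χ.sym_mul_sym ht htj
    have h2 := χ.sym_mul_sym (b := ((2 : ℝ) ^ j)⁻¹) ht (htj.trans (by
      gcongr
      · norm_num
      · omega))
    change χ.sym t * (χ.sym _ - χ.sym _) = χ.sym _ - χ.sym _
    rw [mul_sub, h1, h2]

theorem LPCutoff.dyadicSymbol_eq_zero {n : ℕ} (χ : LPCutoff n) {j : ℕ} {ξ : Rn n}
    (h : (2 : ℝ) ^ (j + 1) ≤ ‖(2 * Real.pi) • ξ‖) : χ.dyadicSymbol j ξ = 0 := by
  have h1 : ∀ i : ℕ, i ≤ j → χ.sym ((2 : ℝ) ^ i)⁻¹ ξ = 0 := fun i hi => by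
    refine χ.sym_eq_zero (by positivity) ?_
    rw [inv_mul_eq_div, le_div_iff₀ (by positivity)]
    refine le_trans ?_ h
    rw [← pow_succ']
    exact pow_le_pow_right₀ (by norm_num) (by omega)
  cases j with
  | zero => exact h1 0 le_rfl
  | succ j =>
    change χ.sym _ ξ - χ.sym _ ξ = 0
    rw [h1 (j + 1) le_rfl, h1 j (by omega), sub_zero]

theorem LPCutoff.dyadicSymbol_succ_eq_zero {n : ℕ} (χ : LPCutoff n) {j : ℕ} {ξ : Rn n}
    (h : ‖(2 * Real.pi) • ξ‖ ≤ (2 : ℝ) ^ j) : χ.dyadicSymbol (j + 1) ξ = 0 := by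
  have h1 : ∀ i : ℕ, j ≤ i → χ.sym ((2 : ℝ) ^ i)⁻¹ ξ = 1 := fun i hi => by
    refine χ.sym_eq_one (by positivity) ?_
    rw [inv_mul_eq_div, div_le_iff₀ (by positivity), one_mul]
    exact h.trans (pow_le_pow_right₀ (by norm_num) hi)
  change χ.sym _ ξ - χ.sym _ ξ = 0
  rw [h1 (j + 1) (by omega), h1 j le_rfl, sub_self]

theorem fourierMultiplierCLM_sub_symbol {n m : ℕ} {σ τ : Rn n → ℂ} (hσ : σ.HasTemperateGrowth)
    (hτ : τ.HasTemperateGrowth) (u : 𝓢'(Rn n, Cm m)) :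
    fourierMultiplierCLM (Cm m) (σ - τ) u =
      fourierMultiplierCLM (Cm m) σ u - fourierMultiplierCLM (Cm m) τ u := by
  rw [TemperedDistribution.fourierMultiplierCLM_apply,
    TemperedDistribution.smulLeftCLM_sub hσ hτ]
  rw [TemperedDistribution.fourierMultiplierCLM_apply,
    TemperedDistribution.fourierMultiplierCLM_apply]
  exact map_sub (FourierTransform.fourierInvCLM ℂ 𝓢'(Rn n, Cm m)) _ _

theorem LPCutoff.sum_piece {n m : ℕ} (χ : LPCutoff n) (t : Finset ℕ) (u : 𝓢'(Rn n, Cm m)) :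
    ∑ i ∈ t, χ.piece i u =
      fourierMultiplierCLM (Cm m) (fun ξ => ∑ i ∈ t, χ.dyadicSymbol i ξ) u := by
  rw [TemperedDistribution.fourierMultiplierCLM_sum (Cm m)
    fun i _ => χ.hasTemperateGrowth_dyadicSymbol i, sum_apply]
  rfl

theorem LPCutoff.sum_range_piece {n m : ℕ} (χ : LPCutoff n) (N : ℕ) (u : 𝓢'(Rn n, Cm m)) :
    ∑ i ∈ Finset.range (N + 1), χ.piece i u =
      fourierMultiplierCLM (Cm m) (χ.sym ((2 : ℝ) ^ N)⁻¹) u := by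
  rw [χ.sum_piece]
  simp_rw [χ.sum_dyadicSymbol]

theorem LPCutoff.multiplier_sym_piece {n m : ℕ} (χ : LPCutoff n) {t : ℝ} (ht : 0 < t) {j : ℕ}
    (htj : t ≤ ((2 : ℝ) ^ j)⁻¹ / 2) (u : 𝓢'(Rn n, Cm m)) :
    fourierMultiplierCLM (Cm m) (χ.sym t) (χ.piece j u) = χ.piece j u := by
  unfold LPCutoff.piece
  rw [TemperedDistribution.fourierMultiplierCLM_fourierMultiplierCLM_apply
    (χ.hasTemperateGrowth_dyadicSymbol j) (χ.hasTemperateGrowth_sym ht), mul_comm,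
    χ.sym_mul_dyadicSymbol ht htj]

/-- Only finitely many pieces meet the support of χ(εD), so the low part needs no limit. -/
theorem LPCutoff.multiplier_sym_eq_sum {n m : ℕ} (χ : LPCutoff n) {ε : ℝ} {N : ℕ}
    (hN : ((2 : ℝ) ^ N)⁻¹ ≤ ε / 2) (u : 𝓢'(Rn n, Cm m)) :
    fourierMultiplierCLM (Cm m) (χ.sym ε) u =
      ∑ i ∈ Finset.range (N + 1), fourierMultiplierCLM (Cm m) (χ.sym ε) (χ.piece i u) := by
  have hp : (0 : ℝ) < ((2 : ℝ) ^ N)⁻¹ := by positivity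
  have hε : 0 < ε := by linarith
  rw [← map_sum, χ.sum_range_piece,
    TemperedDistribution.fourierMultiplierCLM_fourierMultiplierCLM_apply
      (χ.hasTemperateGrowth_sym hp) (χ.hasTemperateGrowth_sym hε), χ.sym_mul_sym hp hN]

theorem fourierMultiplierCLM_comm {n m : ℕ} {σ τ : Rn n → ℂ} (hσ : σ.HasTemperateGrowth)
    (hτ : τ.HasTemperateGrowth) (u : 𝓢'(Rn n, Cm m)) :
    fourierMultiplierCLM (Cm m) σ (fourierMultiplierCLM (Cm m) τ u) =
      fourierMultiplierCLM (Cm m) τ (fourierMultiplierCLM (Cm m) σ u) := by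
  rw [TemperedDistribution.fourierMultiplierCLM_fourierMultiplierCLM_apply hτ hσ,
    TemperedDistribution.fourierMultiplierCLM_fourierMultiplierCLM_apply hσ hτ, mul_comm]

theorem LPCutoff.low_rescale {n m : ℕ} (χ : LPCutoff n) {ε : ℝ} (hε : 0 < ε)
    (u : 𝓢'(Rn n, Cm m)) :
    χ.low (rescale ε hε u) = rescale ε hε (fourierMultiplierCLM (Cm m) (χ.sym ε) u) := by
  have h := fourierMultiplierCLM_rescale hε (χ.hasTemperateGrowth_sym one_pos) u
  simp_rw [χ.sym_smul, one_mul] at h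
  rw [← h]
  unfold LPCutoff.low LPCutoff.piece LPCutoff.dyadicSymbol
  rw [χ.lowSymbol_eq_sym]
  simp

theorem rescale_smul {n m : ℕ} {ε : ℝ} (hε : 0 < ε) (c : ℂ) (u : 𝓢'(Rn n, Cm m)) :
    rescale ε hε (c • u) = c • rescale ε hε u := by
  unfold rescale
  rw [map_smul, smul_comm]

theorem rescale_sub {n m : ℕ} {ε : ℝ} (hε : 0 < ε) (u v : 𝓢'(Rn n, Cm m)) :
    rescale ε hε (u - v) = rescale ε hε u - rescale ε hε v := by
  unfold rescale
  rw [map_sub, smul_sub]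

theorem lineDerivOp_rescale {n m : ℕ} {ε : ℝ} (hε : 0 < ε) (e : Rn n) (u : 𝓢'(Rn n, Cm m)) :
    ∂_{e} (rescale ε hε u) = rescale ε hε ((ε : ℂ) • ∂_{e} u) := by
  have hi : (fun ξ : Rn n => ((inner ℝ ξ e : ℝ) : ℂ)).HasTemperateGrowth := by fun_prop
  have h := fourierMultiplierCLM_rescale hε hi u
  have h2 : (fun ξ : Rn n => ((inner ℝ (ε • ξ) e : ℝ) : ℂ)) =
      (ε : ℂ) • fun ξ : Rn n => ((inner ℝ ξ e : ℝ) : ℂ) := by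
    ext ξ
    rw [inner_smul_left]
    simp
  rw [h2, TemperedDistribution.fourierMultiplierCLM_smul hi] at h
  rw [TemperedDistribution.lineDeriv_eq_fourierMultiplierCLM,
    TemperedDistribution.lineDeriv_eq_fourierMultiplierCLM, h]
  rw [smul_comm, rescale_smul]
  rfl

/-- The multiplier `S_j (1 - χ(ε D))` only sees the pieces with `2 ^ i` close to `2 ^ j / ε`. -/
theorem LPCutoff.dyadicSymbol_mul_localized {n : ℕ} (χ : LPCutoff n) {ε : ℝ} (hε : 0 < ε) {p : ℕ}
    (hp1 : (2 : ℝ) ^ p * ε ≤ 1) (hp2 : 1 ≤ (2 : ℝ) ^ (p + 1) * ε) (j : ℕ) (ξ : Rn n) :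
    (∑ i ∈ Finset.Icc (j + p - 1) (j + p + 2), χ.dyadicSymbol i ξ) *
      ((1 - χ.sym ε ξ) * χ.dyadicSymbol j (ε • ξ)) =
      (1 - χ.sym ε ξ) * χ.dyadicSymbol j (ε • ξ) := by
  by_cases h0 : (1 - χ.sym ε ξ) * χ.dyadicSymbol j (ε • ξ) = 0
  · rw [h0, mul_zero]
  obtain ⟨h1, h2⟩ := mul_ne_zero_iff.1 h0
  set r := ‖(2 * Real.pi) • ξ‖ with hr
  have hr0 : 0 ≤ r := norm_nonneg _
  have hrε : ‖(2 * Real.pi) • ε • ξ‖ = ε * r := by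
    rw [smul_comm, norm_smul, Real.norm_of_nonneg hε.le]
  have hup : ε * r < (2 : ℝ) ^ (j + 1) := by
    by_contra! hc
    exact h2 (χ.dyadicSymbol_eq_zero (by rwa [hrε]))
  -- For j = 0 the dyadic symbol gives no lower bound on the frequency; it comes from the factor 1 -
  -- χ(εD).
  have hlow : (2 : ℝ) ^ j ≤ 2 * (ε * r) := by
    by_contra! hc
    cases j with
    | zero =>
      refine h1 (sub_eq_zero.2 (χ.sym_eq_one hε ?_).symm)
      rw [pow_zero] at hc
      linarith
    | succ j =>
      refine h2 (χ.dyadicSymbol_succ_eq_zero ?_)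
      rw [hrε]
      rw [pow_succ] at hc
      linarith
  have hb : χ.sym ((2 : ℝ) ^ (j + p + 2))⁻¹ ξ = 1 := by
    refine χ.sym_eq_one (by positivity) ?_
    rw [inv_mul_eq_div, div_le_iff₀ (by positivity), one_mul]
    have e : (2 : ℝ) ^ (j + p + 2) = 2 ^ (j + 1) * 2 ^ (p + 1) := by ring
    rw [e]
    calc r ≤ r * ((2 : ℝ) ^ (p + 1) * ε) := le_mul_of_one_le_right hr0 hp2
      _ = (ε * r) * 2 ^ (p + 1) := by ring
      _ ≤ 2 ^ (j + 1) * 2 ^ (p + 1) := by gcongr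
  -- The sum telescopes to a difference of two cutoffs, 1 and 0 at this frequency. If j + p < 2, the
  -- truncated subtraction makes the window start at 0 and there is no lower cutoff.
  have hθ : ∑ i ∈ Finset.Icc (j + p - 1) (j + p + 2), χ.dyadicSymbol i ξ = 1 := by
    rcases Nat.lt_or_ge (j + p) 2 with h | h
    · have e : Finset.Icc (j + p - 1) (j + p + 2) = Finset.range (j + p + 2 + 1) := by
        rw [show j + p - 1 = 0 by omega]; ext i; simp
      rw [e, χ.sum_dyadicSymbol, hb]
    · obtain ⟨a, ha⟩ := Nat.exists_eq_add_of_le' h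
      have e : Finset.Icc (j + p - 1) (j + p + 2) = Finset.Icc (a + 1) (j + p + 2) := by
        rw [show j + p - 1 = a + 1 by omega]
      rw [e, χ.sum_Icc_dyadicSymbol a (j + p + 2) (by omega), hb, χ.sym_eq_zero (by positivity),
        sub_zero]
      rw [inv_mul_eq_div, le_div_iff₀ (by positivity)]
      have e1 : (2 : ℝ) * 2 ^ a * 2 = 2 ^ j * 2 ^ p := by rw [← pow_add, ha]; ring
      have : (2 : ℝ) ^ j * 2 ^ p ≤ 2 * r := by
        calc (2 : ℝ) ^ j * 2 ^ p ≤ 2 * (ε * r) * 2 ^ p := by gcongr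
          _ = 2 * r * (2 ^ p * ε) := by ring
          _ ≤ 2 * r * 1 := by gcongr
          _ = 2 * r := mul_one _
      linarith
  rw [hθ, one_mul]

/-- By localization the window of pieces can be inserted for free after undoing the rescaling, with
2^p comparable to 1/ε. -/
theorem LPCutoff.piece_high_rescale {n m : ℕ} (χ : LPCutoff n) {ε : ℝ} (hε : 0 < ε) {p : ℕ}
    (hp1 : (2 : ℝ) ^ p * ε ≤ 1) (hp2 : 1 ≤ (2 : ℝ) ^ (p + 1) * ε) (j : ℕ)
    (u : 𝓢'(Rn n, Cm m)) :
    χ.piece j (χ.high (rescale ε hε u)) = rescale ε hε (∑ i ∈ Finset.Icc (j + p - 1) (j + p + 2),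
      fourierMultiplierCLM (Cm m) (fun ξ => χ.dyadicSymbol j (ε • ξ))
        (χ.piece i u - fourierMultiplierCLM (Cm m) (χ.sym ε) (χ.piece i u))) := by
  have hdj : (fun ξ => χ.dyadicSymbol j (ε • ξ)).HasTemperateGrowth := by
    have := χ.hasTemperateGrowth_dyadicSymbol j
    fun_prop
  have hsε := χ.hasTemperateGrowth_sym hε
  have hone : (fun _ : Rn n => (1 : ℂ)).HasTemperateGrowth := by fun_prop
  have hQ : ∀ v : 𝓢'(Rn n, Cm m), v - fourierMultiplierCLM (Cm m) (χ.sym ε) v =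
      fourierMultiplierCLM (Cm m) ((fun _ => 1) - χ.sym ε) v := fun v => by
    rw [fourierMultiplierCLM_sub_symbol hone hsε]
    simp
  have h1 : χ.piece j (χ.high (rescale ε hε u)) = rescale ε hε
      (fourierMultiplierCLM (Cm m) (fun ξ => χ.dyadicSymbol j (ε • ξ))
        (u - fourierMultiplierCLM (Cm m) (χ.sym ε) u)) := by
    unfold LPCutoff.piece LPCutoff.high
    rw [χ.low_rescale, ← rescale_sub,
      fourierMultiplierCLM_rescale hε (χ.hasTemperateGrowth_dyadicSymbol j)]
  have hdiff : ((fun _ : Rn n => (1 : ℂ)) - χ.sym ε).HasTemperateGrowth := hone.sub hsε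
  rw [h1]
  congr 1
  rw [← map_sum]
  simp_rw [hQ]
  rw [← map_sum, χ.sum_piece,
    TemperedDistribution.fourierMultiplierCLM_fourierMultiplierCLM_apply hdiff hdj,
    TemperedDistribution.fourierMultiplierCLM_fourierMultiplierCLM_apply
      (Function.HasTemperateGrowth.sum fun i _ => χ.hasTemperateGrowth_dyadicSymbol i) hdiff,
    TemperedDistribution.fourierMultiplierCLM_fourierMultiplierCLM_apply
      ((Function.HasTemperateGrowth.sum fun i _ => χ.hasTemperateGrowth_dyadicSymbol i).mul hdiff)
      hdj]
  congr 2
  ext ξ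
  have := χ.dyadicSymbol_mul_localized hε hp1 hp2 j ξ
  simp only [Pi.mul_apply, Pi.sub_apply]
  rw [mul_assoc, this]

/-! ### Bounds for the Littlewood-Paley pieces -/

theorem LPCutoff.exists_dlNorm_sym_le {n : ℕ} (hn : 1 ≤ n) (m : ℕ) (χ : LPCutoff n) :
    ∃ C : ℝ, 0 < C ∧ ∀ t : ℝ, 0 < t → ∀ μ : ℝ, 0 < μ → ∀ u : 𝓢'(Rn n, Cm m),
      dlNorm μ (fourierMultiplierCLM (Cm m) (χ.sym t) u) ≤ ENNReal.ofReal C * dlNorm μ u := by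
  obtain ⟨C, hC, H⟩ := exists_dlNorm_dilated_multiplier_le hn m (χ.symSchwartz one_pos)
  refine ⟨C, hC, fun t ht μ hμ u => ?_⟩
  have := H t ht μ hμ u
  simp_rw [χ.symSchwartz_apply, χ.sym_smul, one_mul] at this
  exact this

/-- The cutoff at twice the frequency reproduces the piece and is a dilate of one fixed Schwartz
symbol, so the Bernstein bound applies uniformly in j. -/
theorem LPCutoff.exists_dlNorm_piece_le {n : ℕ} (hn : 1 ≤ n) (m : ℕ) (χ : LPCutoff n) {A : ℝ}
    (hA : 0 < A) :
    ∃ C : ℝ, 0 < C ∧ ∀ (j : ℕ) (ν : ℝ), 0 < ν → (2 : ℝ) ^ j * ν ≤ A → ∀ u : 𝓢'(Rn n, Cm m),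
      dlNorm ν (χ.piece j u) ≤ ENNReal.ofReal
        (C * (((2 : ℝ) ^ j * ν) ^ ((n : ℝ) / 2 - 1) * (2 : ℝ) ^ j)) *
          dlNorm ((2 : ℝ) ^ j) (χ.piece j u) := by
  obtain ⟨C, hC, H⟩ := exists_dlNorm_bernstein hn m
    (χ.symSchwartz (t := 1 / 2) (by norm_num)) hA
  refine ⟨C, hC, fun j ν hν hjν u => ?_⟩
  have := H ((2 : ℝ) ^ j) ν (one_le_pow₀ (by norm_num)) hν hjν (χ.piece j u)
  simp_rw [χ.symSchwartz_apply, χ.sym_smul] at this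
  change dlNorm ν (fourierMultiplierCLM (Cm m) (χ.sym (1 / 2 * ((2 : ℝ) ^ j)⁻¹)) _) ≤ _ at this
  rwa [χ.multiplier_sym_piece (by positivity) (by linarith)] at this

theorem LPCutoff.exists_dlNorm_lineDeriv_piece_le {n : ℕ} (hn : 1 ≤ n) (m : ℕ) (χ : LPCutoff n)
    {A : ℝ} (hA : 0 < A) (e : Rn n) :
    ∃ C : ℝ, 0 < C ∧ ∀ (j : ℕ) (ν : ℝ), 0 < ν → (2 : ℝ) ^ j * ν ≤ A → ∀ u : 𝓢'(Rn n, Cm m),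
      dlNorm ν (∂_{e} (χ.piece j u)) ≤ ENNReal.ofReal
        (C * (((2 : ℝ) ^ j * ν) ^ ((n : ℝ) / 2 - 1) * (2 : ℝ) ^ j * (2 : ℝ) ^ j)) *
          dlNorm ((2 : ℝ) ^ j) (χ.piece j u) := by
  have hi : (fun ξ : Rn n => ((inner ℝ ξ e : ℝ) : ℂ)).HasTemperateGrowth := by fun_prop
  -- Homogeneity of the linear symbol turns the derivative of a piece into 2πi l times a dilate of
  -- the fixed symbol τ, which accounts for the additional power of 2^j.
  set τ : 𝓢(Rn n, ℂ) := SchwartzMap.smulLeftCLM ℂ (fun ξ : Rn n => ((inner ℝ ξ e : ℝ) : ℂ))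
    (χ.symSchwartz (t := 1 / 2) (by norm_num)) with hτ
  have hτa : ∀ ξ, τ ξ = ((inner ℝ ξ e : ℝ) : ℂ) * χ.sym (1 / 2) ξ := fun ξ => by
    rw [hτ, SchwartzMap.smulLeftCLM_apply_apply hi]
    rfl
  obtain ⟨C, hC, H⟩ := exists_dlNorm_bernstein hn m τ hA
  refine ⟨2 * Real.pi * C, by positivity, fun j ν hν hjν u => ?_⟩
  set l : ℝ := (2 : ℝ) ^ j with hl
  have hl0 : 0 < l := by positivity
  set w := χ.piece j u with hw
  have hτg : (fun ξ => τ (l⁻¹ • ξ)).HasTemperateGrowth := by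
    have := τ.hasTemperateGrowth
    fun_prop
  have hrep : ∂_{e} w = (2 * Real.pi * Complex.I * (l : ℂ)) •
      fourierMultiplierCLM (Cm m) (fun ξ => τ (l⁻¹ • ξ)) w := by
    have hsym : (0 : ℝ) < 1 / 2 * l⁻¹ := by positivity
    conv_lhs => rw [hw, ← χ.multiplier_sym_piece hsym (by rw [hl]; linarith) u, ← hw]
    rw [TemperedDistribution.lineDeriv_eq_fourierMultiplierCLM,
      TemperedDistribution.fourierMultiplierCLM_fourierMultiplierCLM_apply
        (χ.hasTemperateGrowth_sym hsym) hi]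
    have hfun : (χ.sym (1 / 2 * l⁻¹) * fun ξ : Rn n => ((inner ℝ ξ e : ℝ) : ℂ)) =
        (l : ℂ) • fun ξ => τ (l⁻¹ • ξ) := by
      ext ξ
      rw [Pi.mul_apply, Pi.smul_apply, hτa, χ.sym_smul, inner_smul_left]
      have : (l : ℂ) ≠ 0 := by exact_mod_cast hl0.ne'
      simp only [conj_trivial, Complex.ofReal_mul, smul_eq_mul, Complex.ofReal_inv]
      field_simp
    rw [hfun, TemperedDistribution.fourierMultiplierCLM_smul hτg,
      mul_smul (2 * Real.pi * Complex.I)]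
    rfl
  rw [hrep]
  refine (dlNorm_smul_le hν _ _).trans ?_
  refine (mul_le_mul_right (H l ν (one_le_pow₀ (by norm_num)) hν hjν w) _).trans (le_of_eq ?_)
  rw [← mul_assoc, ← ofReal_norm, ← ENNReal.ofReal_mul (norm_nonneg _)]
  congr 2
  rw [norm_mul, norm_mul, norm_mul, Complex.norm_I, Complex.norm_of_nonneg hl0.le,
    Complex.norm_of_nonneg Real.pi_pos.le]
  simp only [Complex.norm_ofNat]
  ring

/-- The cutoff χ(tD) commutes with the reproducing cutoff, so it may act first, in the norm of
radius 2^j, where it is bounded uniformly in t. -/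
theorem LPCutoff.exists_linftyNorm_piece_le {n : ℕ} (hn : 1 ≤ n) (m : ℕ) (χ : LPCutoff n) :
    ∃ C : ℝ, 0 < C ∧ ∀ (j : ℕ) (t : ℝ), 0 < t → ∀ u : 𝓢'(Rn n, Cm m),
      linftyNorm (χ.piece j u) ≤ ENNReal.ofReal (C * ((2 : ℝ) ^ j) ^ ((n : ℝ) / 2)) *
          dlNorm ((2 : ℝ) ^ j) (χ.piece j u) ∧
      linftyNorm (fourierMultiplierCLM (Cm m) (χ.sym t) (χ.piece j u)) ≤
        ENNReal.ofReal (C * ((2 : ℝ) ^ j) ^ ((n : ℝ) / 2)) *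
          dlNorm ((2 : ℝ) ^ j) (χ.piece j u) := by
  obtain ⟨C, hC, H⟩ := exists_linftyNorm_bernstein hn m
    (χ.symSchwartz (t := 1 / 2) (by norm_num))
  obtain ⟨C', hC', H'⟩ := χ.exists_dlNorm_sym_le hn m
  have H2 : ∀ (j : ℕ) (w : 𝓢'(Rn n, Cm m)),
      linftyNorm (fourierMultiplierCLM (Cm m) (χ.sym (1 / 2 * ((2 : ℝ) ^ j)⁻¹)) w) ≤
        ENNReal.ofReal (C * ((2 : ℝ) ^ j) ^ ((n : ℝ) / 2)) * dlNorm ((2 : ℝ) ^ j) w := by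
    intro j w
    have := H ((2 : ℝ) ^ j) (one_le_pow₀ (by norm_num)) w
    simp_rw [χ.symSchwartz_apply, χ.sym_smul] at this
    exact this
  refine ⟨C * (1 + C'), by positivity, fun j t ht u => ?_⟩
  have hs : (0 : ℝ) < 1 / 2 * ((2 : ℝ) ^ j)⁻¹ := by positivity
  have hinv := χ.multiplier_sym_piece (j := j) hs (by linarith) u
  have hpow : 0 ≤ ((2 : ℝ) ^ j) ^ ((n : ℝ) / 2) := by positivity
  constructor
  · have := H2 j (χ.piece j u)
    rw [hinv] at this
    refine this.trans ?_
    gcongr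
    nlinarith
  · have hcomm := fourierMultiplierCLM_comm (χ.hasTemperateGrowth_sym hs)
      (χ.hasTemperateGrowth_sym ht) (χ.piece j u)
    rw [hinv] at hcomm
    rw [← hcomm]
    refine (H2 j _).trans ((mul_le_mul_right (H' t ht _ (by positivity) _) _).trans ?_)
    rw [← mul_assoc, ← ENNReal.ofReal_mul (by positivity)]
    refine mul_le_mul' (ENNReal.ofReal_le_ofReal ?_) le_rfl
    have : 0 ≤ C * ((2 : ℝ) ^ j) ^ ((n : ℝ) / 2) := by positivity
    nlinarith

/-! ### Convergence of the Littlewood-Paley decomposition -/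

/-- The difference vanishes where 2πt|x| < 1. Elsewhere one extra power of |x|, available for a
Schwartz function, buys the factor t. -/
theorem LPCutoff.exists_seminorm_sym_sub_le {n : ℕ} (χ : LPCutoff n) (ψ : 𝓢(Rn n, ℂ)) (k l : ℕ) :
    ∃ C : ℝ, 0 ≤ C ∧ ∀ t : ℝ, 0 < t → t ≤ 1 →
      SchwartzMap.seminorm ℝ k l (SchwartzMap.smulLeftCLM ℂ (χ.sym t) ψ - ψ) ≤ C * t := by
  set S := χ.symSchwartz one_pos with hS
  set C₀ : ℝ := ∑ i ∈ Finset.range (l + 1), (l.choose i : ℝ) * SchwartzMap.seminorm ℝ 0 i S *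
    SchwartzMap.seminorm ℝ (k + 1) (l - i) ψ + SchwartzMap.seminorm ℝ (k + 1) l ψ with hC₀
  have hC₀0 : 0 ≤ C₀ := by positivity
  refine ⟨2 * Real.pi * C₀, by positivity, fun t ht ht1 => ?_⟩
  refine SchwartzMap.seminorm_le_bound ℝ k l _ (by positivity) fun x => ?_
  have hcoe : ((SchwartzMap.smulLeftCLM ℂ (χ.sym t) ψ - ψ : 𝓢(Rn n, ℂ)) : Rn n → ℂ) =
      (fun y => χ.sym t y * ψ y) - (ψ : Rn n → ℂ) := by
    ext y
    change SchwartzMap.smulLeftCLM ℂ (χ.sym t) ψ y - ψ y = _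
    rw [SchwartzMap.smulLeftCLM_apply_apply (χ.hasTemperateGrowth_sym ht)]
    rfl
  rw [hcoe]
  have hnorm : ∀ y : Rn n, t * ‖(2 * Real.pi) • y‖ = 2 * Real.pi * t * ‖y‖ := fun y => by
    rw [norm_smul, Real.norm_of_nonneg (by positivity)]; ring
  rcases lt_or_ge (2 * Real.pi * t * ‖x‖) 1 with hx | hx
  · have hev : ((fun y => χ.sym t y * ψ y) - (ψ : Rn n → ℂ)) =ᶠ[nhds x] fun _ => 0 := by
      have hopen : IsOpen {y : Rn n | 2 * Real.pi * t * ‖y‖ < 1} :=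
        isOpen_lt (by fun_prop) continuous_const
      filter_upwards [hopen.mem_nhds hx] with y hy
      rw [Pi.sub_apply, χ.sym_eq_one ht (by rw [hnorm]; exact le_of_lt hy), one_mul, sub_self]
    have hz : iteratedFDeriv ℝ l ((fun y => χ.sym t y * ψ y) - (ψ : Rn n → ℂ)) x = 0 := by
      rw [(Filter.EventuallyEq.iteratedFDeriv ℝ hev l).eq_of_nhds]
      have := iteratedFDeriv_fun_zero (𝕜 := ℝ) (E := Rn n) (F := ℂ) (n := l)
      exact congrFun this x
    rw [hz, norm_zero, mul_zero]
    positivity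
  · have hsm : ContDiff ℝ l (χ.sym t) := (χ.contDiff_sym t).of_le (by exact_mod_cast le_top)
    have hψ : ContDiff ℝ l ψ := ψ.smooth l
    have hsub : ‖iteratedFDeriv ℝ l ((fun y => χ.sym t y * ψ y) - (ψ : Rn n → ℂ)) x‖ ≤
        ‖iteratedFDeriv ℝ l (fun y => χ.sym t y * ψ y) x‖ + ‖iteratedFDeriv ℝ l ψ x‖ := by
      rw [iteratedFDeriv_sub_apply (hsm.mul hψ).contDiffAt hψ.contDiffAt]
      exact norm_sub_le _ _
    have hD : ∀ i, ‖iteratedFDeriv ℝ i (χ.sym t) x‖ ≤ SchwartzMap.seminorm ℝ 0 i S := fun i => by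
      have hcomp : χ.sym t = fun y => S (t • y) := by
        ext y
        change _ = χ.sym 1 (t • y)
        rw [χ.sym_smul, one_mul]
      rw [hcomp, iteratedFDeriv_comp_const_smul t (S.smooth i)]
      change ‖t ^ i • iteratedFDeriv ℝ i S (t • x)‖ ≤ _
      rw [norm_smul, norm_pow, Real.norm_of_nonneg ht.le]
      refine (mul_le_of_le_one_left (norm_nonneg _) (pow_le_one₀ ht.le ht1)).trans ?_
      exact SchwartzMap.norm_iteratedFDeriv_le_seminorm ℝ S i _
    have hmul := norm_iteratedFDeriv_mul_le hsm hψ x (n := l) le_rfl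
    have hxk : ‖x‖ ^ k ≤ 2 * Real.pi * t * ‖x‖ ^ (k + 1) := by
      rw [pow_succ']
      calc ‖x‖ ^ k ≤ (2 * Real.pi * t * ‖x‖) * ‖x‖ ^ k :=
            le_mul_of_one_le_left (by positivity) hx
        _ = _ := by ring
    calc ‖x‖ ^ k * ‖iteratedFDeriv ℝ l ((fun y => χ.sym t y * ψ y) - (ψ : Rn n → ℂ)) x‖
        ≤ (2 * Real.pi * t * ‖x‖ ^ (k + 1)) *
          (‖iteratedFDeriv ℝ l (fun y => χ.sym t y * ψ y) x‖ + ‖iteratedFDeriv ℝ l ψ x‖) := by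
          gcongr
      _ = 2 * Real.pi * t * (‖x‖ ^ (k + 1) * ‖iteratedFDeriv ℝ l (fun y => χ.sym t y * ψ y) x‖ +
          ‖x‖ ^ (k + 1) * ‖iteratedFDeriv ℝ l ψ x‖) := by ring
      _ ≤ 2 * Real.pi * t * C₀ := by
          gcongr
          rw [hC₀]
          refine add_le_add ?_ (SchwartzMap.le_seminorm ℝ (k + 1) l ψ x)
          refine (mul_le_mul_of_nonneg_left hmul (by positivity)).trans ?_
          rw [Finset.mul_sum]
          refine Finset.sum_le_sum fun i _ => ?_
          calc ‖x‖ ^ (k + 1) * ((l.choose i : ℝ) * ‖iteratedFDeriv ℝ i (χ.sym t) x‖ *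
                ‖iteratedFDeriv ℝ (l - i) ψ x‖)
              = (l.choose i : ℝ) * ‖iteratedFDeriv ℝ i (χ.sym t) x‖ *
                (‖x‖ ^ (k + 1) * ‖iteratedFDeriv ℝ (l - i) ψ x‖) := by ring
            _ ≤ _ := by
                gcongr
                · exact hD i
                · exact SchwartzMap.le_seminorm ℝ (k + 1) (l - i) ψ x
      _ = 2 * Real.pi * C₀ * t := by ring

theorem LPCutoff.tendsto_smulLeftCLM_sym {n : ℕ} (χ : LPCutoff n) (ψ : 𝓢(Rn n, ℂ)) :
    Filter.Tendsto (fun N : ℕ => SchwartzMap.smulLeftCLM ℂ (χ.sym ((2 : ℝ) ^ N)⁻¹) ψ)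
      Filter.atTop (nhds ψ) := by
  rw [(schwartz_withSeminorms ℝ (Rn n) ℂ).tendsto_nhds]
  rintro ⟨k, l⟩ δ hδ
  obtain ⟨C, hC, H⟩ := χ.exists_seminorm_sym_sub_le ψ k l
  have hlim : Filter.Tendsto (fun N : ℕ => C * ((2 : ℝ) ^ N)⁻¹) Filter.atTop (nhds 0) := by
    have := (tendsto_pow_atTop_nhds_zero_of_lt_one (r := (2 : ℝ)⁻¹) (by norm_num)
      (by norm_num)).const_mul C
    simpa [inv_pow] using this
  filter_upwards [hlim.eventually_lt_const hδ] with N hN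
  refine lt_of_le_of_lt (H _ (by positivity) ?_) hN
  exact inv_le_one_of_one_le₀ (one_le_pow₀ (by norm_num))

/-- The partial sums telescope to χ(2^(-N) D)u, and by duality it suffices that the cutoffs converge
on Schwartz functions. -/
theorem LPCutoff.tendsto_sum_piece {n m : ℕ} (χ : LPCutoff n) (u : 𝓢'(Rn n, Cm m))
    (φ : 𝓢(Rn n, ℂ)) :
    Filter.Tendsto (fun N => ∑ i ∈ Finset.range N, χ.piece i u φ) Filter.atTop (nhds (u φ)) := by
  rw [← Filter.tendsto_add_atTop_iff_nat 1]
  have h1 : ∀ N, ∑ i ∈ Finset.range (N + 1), χ.piece i u φ =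
      u (FourierTransform.fourier (SchwartzMap.smulLeftCLM ℂ (χ.sym ((2 : ℝ) ^ N)⁻¹)
        (FourierTransform.fourierInv φ))) := fun N => by
    rw [← TemperedDistribution.fourierMultiplierCLM_apply_apply, ← χ.sum_range_piece]
    exact (sum_apply (Finset.range (N + 1)) (fun i => χ.piece i u) φ).symm
  simp_rw [h1]
  have hc : Continuous fun ψ : 𝓢(Rn n, ℂ) => u (FourierTransform.fourier ψ) :=
    (map_continuous u).comp (FourierTransform.fourierCLM ℂ 𝓢(Rn n, ℂ)).continuous
  have := (hc.tendsto _).comp (χ.tendsto_smulLeftCLM_sym (FourierTransform.fourierInv φ))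
  rw [FourierTransform.fourier_fourierInv_eq] at this
  exact this

/-! ### Summation over dyadic frequencies -/

theorem dhNorm_eq {n m : ℕ} (χ : LPCutoff n) (s : ℝ) (u : 𝓢'(Rn n, Cm m)) :
    dhNorm χ s u = (∑' j : ℕ, (ENNReal.ofReal (((2 : ℝ) ^ j) ^ s) *
      dlNorm ((2 : ℝ) ^ j) (χ.piece j u)) ^ 2) ^ (1 / 2 : ℝ) := by
  unfold dhNorm
  congr 1
  refine tsum_congr fun j => ?_
  rw [mul_pow, ← ENNReal.ofReal_pow (by positivity), ← Real.rpow_mul_natCast (by positivity)]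
  congr 3
  push_cast
  ring

theorem le_tsum_sq_rpow_half (f : ℕ → ℝ≥0∞) (j : ℕ) : f j ≤ (∑' i, f i ^ 2) ^ (1 / 2 : ℝ) := by
  calc f j = (f j ^ 2) ^ (1 / 2 : ℝ) := by
        rw [← ENNReal.rpow_two, ← ENNReal.rpow_mul]; simp
    _ ≤ _ := by
        gcongr
        exact ENNReal.le_tsum (f := fun i => f i ^ 2) j

/-- One term of the square sum already gives ‖u_λ‖ ≤ λ^(-s) M. Weights λ^a thus become geometric
with ratio 2^(a-s). -/
theorem dlNorm_piece_le_dhNorm {n m : ℕ} (χ : LPCutoff n) (s : ℝ) (u : 𝓢'(Rn n, Cm m)) (j : ℕ)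
    {c : ℝ} (hc : 0 ≤ c) (a : ℝ) :
    ENNReal.ofReal (c * ((2 : ℝ) ^ j) ^ a) * dlNorm ((2 : ℝ) ^ j) (χ.piece j u) ≤
      ENNReal.ofReal (c * ((2 : ℝ) ^ (a - s)) ^ j) * dhNorm χ s u := by
  have h2 : (0 : ℝ) < (2 : ℝ) ^ j := by positivity
  have e : c * ((2 : ℝ) ^ j) ^ a = c * ((2 : ℝ) ^ (a - s)) ^ j * ((2 : ℝ) ^ j) ^ s := by
    have e1 : ((2 : ℝ) ^ (a - s)) ^ j = ((2 : ℝ) ^ j) ^ (a - s) := by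
      rw [← Real.rpow_mul_natCast (by norm_num), mul_comm, Real.rpow_natCast_mul (by norm_num)]
    rw [e1, mul_assoc, ← Real.rpow_add h2, sub_add_cancel]
  rw [e, ENNReal.ofReal_mul (by positivity), mul_assoc, dhNorm_eq]
  gcongr
  exact le_tsum_sq_rpow_half (fun i => ENNReal.ofReal (((2 : ℝ) ^ i) ^ s) *
    dlNorm ((2 : ℝ) ^ i) (χ.piece i u)) j

theorem sum_range_geometric_le {r : ℝ} (hr0 : 0 ≤ r) (hr1 : r < 1) (N : ℕ) :
    ∑ i ∈ Finset.range N, r ^ i ≤ (1 - r)⁻¹ := by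
  rw [← tsum_geometric_of_lt_one hr0 hr1]
  exact (summable_geometric_of_lt_one hr0 hr1).sum_le_tsum _ fun i _ => by positivity

theorem sum_ofReal_mul {c : ℝ} (hc : 0 ≤ c) {r : ℝ} (hr : 0 ≤ r) (N : ℕ) (M : ℝ≥0∞) :
    ∑ i ∈ Finset.range N, ENNReal.ofReal (c * r ^ i) * M =
      ENNReal.ofReal (c * ∑ i ∈ Finset.range N, r ^ i) * M := by
  rw [← Finset.sum_mul, Finset.mul_sum, ENNReal.ofReal_sum_of_nonneg fun i _ => by positivity]

/-- A window has at most 4 indices, which costs 4² = 16, and an index lies in at most 4 windows; 64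
is the product. -/
theorem tsum_sq_sum_Icc_le (f : ℕ → ℝ≥0∞) (p : ℕ) :
    ∑' j : ℕ, (∑ i ∈ Finset.Icc (j + p - 1) (j + p + 2), f i) ^ 2 ≤ 64 * ∑' i, f i ^ 2 := by
  classical
  have h1 : ∀ j : ℕ, (∑ i ∈ Finset.Icc (j + p - 1) (j + p + 2), f i) ^ 2 ≤
      16 * ∑ i ∈ Finset.Icc (j + p - 1) (j + p + 2), f i ^ 2 := by
    intro j
    set I := Finset.Icc (j + p - 1) (j + p + 2)
    have hcard : I.card ≤ 4 := by rw [Nat.card_Icc]; omega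
    have hle : ∀ i ∈ I, f i ≤ (∑ i ∈ I, f i ^ 2) ^ (1 / 2 : ℝ) := fun i hi => by
      calc f i = (f i ^ 2) ^ (1 / 2 : ℝ) := by
            rw [← ENNReal.rpow_two, ← ENNReal.rpow_mul]; simp
        _ ≤ _ := by
            gcongr
            exact Finset.single_le_sum (f := fun i => f i ^ 2) (fun _ _ => zero_le) hi
    have hsum : ∑ i ∈ I, f i ≤ 4 * (∑ i ∈ I, f i ^ 2) ^ (1 / 2 : ℝ) := by
      refine (Finset.sum_le_card_nsmul I f _ hle).trans ?_
      rw [nsmul_eq_mul]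
      gcongr
      exact_mod_cast hcard
    calc (∑ i ∈ I, f i) ^ 2 ≤ (4 * (∑ i ∈ I, f i ^ 2) ^ (1 / 2 : ℝ)) ^ 2 := by gcongr
      _ = 16 * ∑ i ∈ I, f i ^ 2 := by
          rw [mul_pow, ← ENNReal.rpow_mul_natCast]
          norm_num
  have h2 : ∑' j : ℕ, ∑ i ∈ Finset.Icc (j + p - 1) (j + p + 2), f i ^ 2 ≤ 4 * ∑' i, f i ^ 2 := by
    calc ∑' j : ℕ, ∑ i ∈ Finset.Icc (j + p - 1) (j + p + 2), f i ^ 2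
        = ∑' j : ℕ, ∑' i : ℕ, if i ∈ Finset.Icc (j + p - 1) (j + p + 2) then f i ^ 2 else 0 := by
          refine tsum_congr fun j => ?_
          rw [tsum_eq_sum (s := Finset.Icc (j + p - 1) (j + p + 2)) fun i hi => if_neg hi]
          exact Finset.sum_congr rfl fun i hi => (if_pos hi).symm
      _ = ∑' i : ℕ, ∑' j : ℕ, if i ∈ Finset.Icc (j + p - 1) (j + p + 2) then f i ^ 2 else 0 :=
          ENNReal.tsum_comm
      _ ≤ ∑' i : ℕ, 4 * f i ^ 2 := by
          refine ENNReal.tsum_le_tsum fun i => ?_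
          rw [tsum_eq_sum (s := Finset.Icc (i - p - 2) (i + 1 - p)) fun j hj => if_neg fun hi =>
            hj (by simp only [Finset.mem_Icc] at hi ⊢; omega)]
          refine (Finset.sum_le_card_nsmul _ _ (f i ^ 2) fun j _ => ?_).trans ?_
          · split_ifs
            · exact le_rfl
            · exact zero_le
          · rw [nsmul_eq_mul]
            gcongr
            have : (Finset.Icc (i - p - 2) (i + 1 - p)).card ≤ 4 := by rw [Nat.card_Icc]; omega
            exact_mod_cast this
      _ = _ := ENNReal.tsum_mul_left
  calc _ ≤ ∑' j : ℕ, 16 * ∑ i ∈ Finset.Icc (j + p - 1) (j + p + 2), f i ^ 2 :=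
        ENNReal.tsum_le_tsum h1
    _ = 16 * ∑' j : ℕ, ∑ i ∈ Finset.Icc (j + p - 1) (j + p + 2), f i ^ 2 := ENNReal.tsum_mul_left
    _ ≤ 16 * (4 * ∑' i, f i ^ 2) := by gcongr
    _ = _ := by rw [← mul_assoc]; norm_num

theorem exists_dyadic_near {ε : ℝ} (hε : 0 < ε) (hε1 : ε ≤ 1) :
    ∃ p : ℕ, (2 : ℝ) ^ p * ε ≤ 1 ∧ 1 ≤ (2 : ℝ) ^ (p + 1) * ε := by
  obtain ⟨p, h1, h2⟩ := exists_nat_pow_near (x := 1 / ε) (y := 2)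
    (by rwa [le_div_iff₀ hε, one_mul]) (by norm_num)
  refine ⟨p, ?_, ?_⟩
  · rwa [le_div_iff₀ hε] at h1
  · rw [div_lt_iff₀ hε] at h2; exact h2.le

/-! ### Bounds for the rescaled data -/

theorem exists_linftyNorm_le {n : ℕ} (hn : 1 ≤ n) (m : ℕ) {s : ℝ} (hs : (n : ℝ) / 2 < s)
    (χ : LPCutoff n) :
    ∃ C : ℝ, 0 ≤ C ∧ ∀ (u : 𝓢'(Rn n, Cm m)) (ε : ℝ) (hε : 0 < ε), ε ≤ 1 →
      linftyNorm (χ.low (rescale ε hε u)) + linftyNorm (χ.high (rescale ε hε u)) ≤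
        ENNReal.ofReal (C * ε) * dhNorm χ s u := by
  obtain ⟨C, hC, H⟩ := χ.exists_linftyNorm_piece_le hn m
  set r : ℝ := 2 ^ ((n : ℝ) / 2 - s) with hr
  have hr0 : 0 ≤ r := by positivity
  have hr1 : r < 1 := Real.rpow_lt_one_of_one_lt_of_neg (by norm_num) (by linarith)
  have hG : 0 ≤ (1 - r)⁻¹ := inv_nonneg.2 (by linarith)
  refine ⟨3 * (C * (1 - r)⁻¹), by positivity, fun u ε hε hε1 => ?_⟩
  set K := ENNReal.ofReal (C * (1 - r)⁻¹) * dhNorm χ s u with hK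
  obtain ⟨p, hp1, hp2⟩ := exists_dyadic_near hε hε1
  have hlow : linftyNorm (χ.low (rescale ε hε u)) ≤ ENNReal.ofReal ε * K := by
    rw [χ.low_rescale]
    refine (linftyNorm_rescale_le hε _).trans ?_
    gcongr
    rw [χ.multiplier_sym_eq_sum (N := p + 2) (by
      rw [inv_le_comm₀ (by positivity) (by positivity), inv_le_iff_one_le_mul₀ (by positivity)]
      calc (1 : ℝ) ≤ 2 ^ (p + 1) * ε := hp2
        _ = _ := by ring)]
    refine (linftyNorm_sum_le _ _).trans ?_
    refine (Finset.sum_le_sum fun i _ => ((H i ε hε u).2.trans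
      (dlNorm_piece_le_dhNorm χ s u i hC.le _))).trans ?_
    rw [sum_ofReal_mul hC.le hr0]
    refine mul_le_mul' (ENNReal.ofReal_le_ofReal ?_) le_rfl
    exact mul_le_mul_of_nonneg_left (sum_range_geometric_le hr0 hr1 _) hC.le
  have hall : linftyNorm (rescale ε hε u) ≤ ENNReal.ofReal ε * K := by
    refine (linftyNorm_rescale_le hε u).trans ?_
    gcongr
    refine (linftyNorm_le_tsum (χ.tendsto_sum_piece u)).trans ?_
    refine (ENNReal.tsum_le_tsum fun i => (H i 1 one_pos u).1.trans
      (dlNorm_piece_le_dhNorm χ s u i hC.le _)).trans (le_of_eq ?_)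
    rw [ENNReal.tsum_mul_right, ← ENNReal.ofReal_tsum_of_nonneg (fun i => by positivity)
      ((summable_geometric_of_lt_one hr0 hr1).mul_left C), tsum_mul_left,
      tsum_geometric_of_lt_one hr0 hr1]
  -- The high part is the whole function minus its low part, both already bounded, hence the 3 in
  -- the total constant.
  have hhigh : linftyNorm (χ.high (rescale ε hε u)) ≤ ENNReal.ofReal ε * K + ENNReal.ofReal ε * K :=
    (linftyNorm_sub_le _ _).trans (add_le_add hall hlow)
  refine (add_le_add hlow hhigh).trans (le_of_eq ?_)
  rw [hK, ← mul_assoc, ← ENNReal.ofReal_mul hε.le, ← add_mul, ← add_mul,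
    ← ENNReal.ofReal_add (by positivity) (by positivity),
    ← ENNReal.ofReal_add (by positivity) (by positivity)]
  congr 2
  ring

theorem exists_dlNorm_low_le {n : ℕ} (hn : 1 ≤ n) (m : ℕ) {s : ℝ} (hs : (n : ℝ) / 2 < s)
    (χ : LPCutoff n) :
    ∃ C : ℝ, 0 ≤ C ∧ ∀ (u : 𝓢'(Rn n, Cm m)) (ε : ℝ) (hε : 0 < ε), ε ≤ 1 →
      dlNorm 1 (χ.low (rescale ε hε u)) ≤ ENNReal.ofReal C * dhNorm χ s u := by
  obtain ⟨C₁, hC₁, H₁⟩ := χ.exists_dlNorm_sym_le hn m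
  obtain ⟨C₂, hC₂, H₂⟩ := χ.exists_dlNorm_piece_le hn m (A := 4) (by norm_num)
  set r : ℝ := 2 ^ ((n : ℝ) / 2 - s) with hr
  have hr0 : 0 ≤ r := by positivity
  have hr1 : r < 1 := Real.rpow_lt_one_of_one_lt_of_neg (by norm_num) (by linarith)
  have hG : 0 ≤ (1 - r)⁻¹ := inv_nonneg.2 (by linarith)
  refine ⟨C₁ * C₂ * (1 - r)⁻¹, by positivity, fun u ε hε hε1 => ?_⟩
  obtain ⟨p, hp1, hp2⟩ := exists_dyadic_near hε hε1
  rw [χ.low_rescale]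
  refine (dlNorm_rescale_le hε one_pos _).trans ?_
  rw [mul_one, χ.multiplier_sym_eq_sum (N := p + 2) (by
      rw [inv_le_comm₀ (by positivity) (by positivity), inv_le_iff_one_le_mul₀ (by positivity)]
      calc (1 : ℝ) ≤ 2 ^ (p + 1) * ε := hp2
        _ = _ := by ring)]
  refine (mul_le_mul' le_rfl (dlNorm_sum_le hε _ _)).trans ?_
  rw [Finset.mul_sum]
  have hterm : ∀ i ∈ Finset.range (p + 2 + 1), ENNReal.ofReal (ε ^ (1 - (n : ℝ) / 2)) *
      dlNorm ε (fourierMultiplierCLM (Cm m) (χ.sym ε) (χ.piece i u)) ≤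
      ENNReal.ofReal (C₁ * C₂ * r ^ i) * dhNorm χ s u := by
    intro i hi
    have h2i : (0 : ℝ) < (2 : ℝ) ^ i := by positivity
    have hiε : (2 : ℝ) ^ i * ε ≤ 4 := by
      have : (2 : ℝ) ^ i ≤ 2 ^ (p + 2) :=
        pow_le_pow_right₀ (by norm_num) (Nat.lt_succ_iff.1 (Finset.mem_range.1 hi))
      calc (2 : ℝ) ^ i * ε ≤ 2 ^ (p + 2) * ε := by gcongr
        _ = 4 * (2 ^ p * ε) := by ring
        _ ≤ 4 := by linarith
    refine (mul_le_mul' le_rfl ((H₁ ε hε ε hε _).trans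
      (mul_le_mul' le_rfl (H₂ i ε hε hiε u)))).trans ?_
    rw [← mul_assoc, ← mul_assoc, ← ENNReal.ofReal_mul (by positivity),
      ← ENNReal.ofReal_mul (by positivity)]
    refine le_trans (le_of_eq ?_) (dlNorm_piece_le_dhNorm χ s u i (c := C₁ * C₂) (by positivity)
      ((n : ℝ) / 2))
    congr 2
    -- The factor ε^(1-n/2) of the rescaling cancels against ε^(n/2-1) from Bernstein, leaving
    -- (2^i)^(n/2).
    rw [Real.mul_rpow h2i.le hε.le, Real.rpow_sub_one h2i.ne']
    have e : ε ^ (1 - (n : ℝ) / 2) * ε ^ ((n : ℝ) / 2 - 1) = 1 := by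
      rw [← Real.rpow_add hε]; simp
    generalize ε ^ (1 - (n : ℝ) / 2) = a at e ⊢
    generalize ε ^ ((n : ℝ) / 2 - 1) = b at e ⊢
    field_simp
    linear_combination e
  refine (Finset.sum_le_sum hterm).trans ?_
  rw [sum_ofReal_mul (by positivity) hr0]
  refine mul_le_mul' (ENNReal.ofReal_le_ofReal ?_) le_rfl
  exact mul_le_mul_of_nonneg_left (sum_range_geometric_le hr0 hr1 _) (by positivity)

theorem lineDerivOp_multiplier_sym {n m : ℕ} (χ : LPCutoff n) {ε : ℝ} (hε : 0 < ε) (e : Rn n)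
    (u : 𝓢'(Rn n, Cm m)) : ∂_{e} (fourierMultiplierCLM (Cm m) (χ.sym ε) u) =
      fourierMultiplierCLM (Cm m) (χ.sym ε) (∂_{e} u) := by
  rw [TemperedDistribution.lineDeriv_eq_fourierMultiplierCLM,
    TemperedDistribution.lineDeriv_eq_fourierMultiplierCLM, map_smul,
    fourierMultiplierCLM_comm (by fun_prop) (χ.hasTemperateGrowth_sym hε)]

/-- The same count as for the low part itself, with ε from differentiating the dilation and 2^i from
the derivative of the piece. The geometric sum is left unevaluated so that one bound serves all s.
-/
theorem exists_dlGradNorm_low_le {n : ℕ} (hn : 1 ≤ n) (m : ℕ) (s : ℝ) (χ : LPCutoff n) :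
    ∃ C : ℝ, 0 ≤ C ∧ ∀ (u : 𝓢'(Rn n, Cm m)) (ε : ℝ) (hε : 0 < ε) (p : ℕ),
      (2 : ℝ) ^ p * ε ≤ 1 → 1 ≤ (2 : ℝ) ^ (p + 1) * ε →
      dlGradNorm 1 (χ.low (rescale ε hε u)) ≤ ENNReal.ofReal
        (C * ε * ∑ i ∈ Finset.range (p + 3), ((2 : ℝ) ^ ((n : ℝ) / 2 + 1 - s)) ^ i) *
          dhNorm χ s u := by
  obtain ⟨C₁, hC₁, H₁⟩ := χ.exists_dlNorm_sym_le hn m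
  choose C₃ hC₃ H₃ using fun l : Fin n => χ.exists_dlNorm_lineDeriv_piece_le hn m (A := 4)
    (by norm_num) (EuclideanSpace.single l (1 : ℝ))
  set r : ℝ := 2 ^ ((n : ℝ) / 2 + 1 - s) with hr
  have hr0 : 0 ≤ r := by positivity
  refine ⟨∑ l, C₁ * C₃ l, Finset.sum_nonneg fun l _ => mul_nonneg hC₁.le (hC₃ l).le,
    fun u ε hε p hp1 hp2 => ?_⟩
  have hdir : ∀ l : Fin n, dlNorm 1 (∂_{EuclideanSpace.single l (1 : ℝ)}
      (χ.low (rescale ε hε u))) ≤ ENNReal.ofReal (C₁ * C₃ l * ε *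
        ∑ i ∈ Finset.range (p + 3), r ^ i) * dhNorm χ s u := by
    intro l
    have hl := hC₃ l
    rw [χ.low_rescale, lineDerivOp_rescale]
    refine (dlNorm_rescale_le hε one_pos _).trans ?_
    rw [mul_one]
    refine (mul_le_mul' le_rfl (dlNorm_smul_le hε _ _)).trans ?_
    rw [lineDerivOp_multiplier_sym χ hε]
    have hsum : fourierMultiplierCLM (Cm m) (χ.sym ε) (∂_{EuclideanSpace.single l (1 : ℝ)} u) =
        ∑ i ∈ Finset.range (p + 2 + 1), fourierMultiplierCLM (Cm m) (χ.sym ε)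
          (∂_{EuclideanSpace.single l (1 : ℝ)} (χ.piece i u)) := by
      simp_rw [← lineDerivOp_multiplier_sym χ hε]
      rw [χ.multiplier_sym_eq_sum (N := p + 2) (by
        rw [inv_le_comm₀ (by positivity) (by positivity), inv_le_iff_one_le_mul₀ (by positivity)]
        calc (1 : ℝ) ≤ 2 ^ (p + 1) * ε := hp2
          _ = _ := by ring)]
      exact map_sum (LineDeriv.lineDerivOpCLM ℂ 𝓢'(Rn n, Cm m)
        (EuclideanSpace.single l (1 : ℝ))) _ _
    rw [hsum]
    refine (mul_le_mul' le_rfl (mul_le_mul' le_rfl (dlNorm_sum_le hε _ _))).trans ?_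
    rw [Finset.mul_sum, Finset.mul_sum]
    have hterm : ∀ i ∈ Finset.range (p + 2 + 1), ENNReal.ofReal (ε ^ (1 - (n : ℝ) / 2)) *
        (‖(ε : ℂ)‖ₑ * dlNorm ε (fourierMultiplierCLM (Cm m) (χ.sym ε)
          (∂_{EuclideanSpace.single l (1 : ℝ)} (χ.piece i u)))) ≤
        ENNReal.ofReal (C₁ * C₃ l * ε * r ^ i) * dhNorm χ s u := by
      intro i hi
      have h2i : (0 : ℝ) < (2 : ℝ) ^ i := by positivity
      have hiε : (2 : ℝ) ^ i * ε ≤ 4 := by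
        have : (2 : ℝ) ^ i ≤ 2 ^ (p + 2) :=
          pow_le_pow_right₀ (by norm_num) (Nat.lt_succ_iff.1 (Finset.mem_range.1 hi))
        calc (2 : ℝ) ^ i * ε ≤ 2 ^ (p + 2) * ε := by gcongr
          _ = 4 * (2 ^ p * ε) := by ring
          _ ≤ 4 := by linarith
      refine (mul_le_mul' le_rfl (mul_le_mul' le_rfl ((H₁ ε hε ε hε _).trans
        (mul_le_mul' le_rfl (H₃ l i ε hε hiε u))))).trans ?_
      rw [← ofReal_norm, Complex.norm_of_nonneg hε.le, ← mul_assoc, ← mul_assoc, ← mul_assoc,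
        ← ENNReal.ofReal_mul (by positivity), ← ENNReal.ofReal_mul (by positivity),
        ← ENNReal.ofReal_mul (by positivity)]
      refine le_trans (le_of_eq ?_) (dlNorm_piece_le_dhNorm χ s u i (c := C₁ * C₃ l * ε)
        (by positivity) ((n : ℝ) / 2 + 1))
      congr 2
      rw [Real.mul_rpow h2i.le hε.le, Real.rpow_sub_one h2i.ne', Real.rpow_add_one h2i.ne']
      have e : ε ^ (1 - (n : ℝ) / 2) * ε ^ ((n : ℝ) / 2 - 1) = 1 := by
        rw [← Real.rpow_add hε]; simp
      generalize ε ^ (1 - (n : ℝ) / 2) = a at e ⊢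
      generalize ε ^ ((n : ℝ) / 2 - 1) = b at e ⊢
      field_simp
      linear_combination e
    refine (Finset.sum_le_sum hterm).trans ?_
    rw [sum_ofReal_mul (by positivity) hr0]
  refine (dlGradNorm_le_sum one_pos _).trans ((Finset.sum_le_sum fun l _ => hdir l).trans ?_)
  rw [← Finset.sum_mul, ← ENNReal.ofReal_sum_of_nonneg fun l _ => by
    have := hC₃ l
    positivity]
  simp_rw [← Finset.sum_mul]
  exact le_rfl

/-- For a < 0 the sum is bounded and ε remains; for a > 0 the last terms dominate, and 2^p ≤ 1/ε
turns them into ε^(-a). -/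
theorem exists_geometric_le_max {a : ℝ} (ha : a ≠ 0) :
    ∃ C : ℝ, 0 ≤ C ∧ ∀ (ε : ℝ) (p : ℕ), 0 < ε → (2 : ℝ) ^ p * ε ≤ 1 →
      ε * ∑ i ∈ Finset.range (p + 3), ((2 : ℝ) ^ a) ^ i ≤ C * max ε (ε ^ (1 - a)) := by
  set r : ℝ := 2 ^ a with hr
  have hr0 : 0 < r := by positivity
  rcases lt_or_gt_of_ne ha with h | h
  · have hr1 : r < 1 := Real.rpow_lt_one_of_one_lt_of_neg (by norm_num) h
    have hG : 0 ≤ (1 - r)⁻¹ := inv_nonneg.2 (by linarith)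
    refine ⟨(1 - r)⁻¹, hG, fun ε p hε _ => ?_⟩
    rw [mul_comm]
    exact mul_le_mul (sum_range_geometric_le hr0.le hr1 _) (le_max_left _ _) hε.le hG
  · have hr1 : 1 < r := Real.one_lt_rpow (by norm_num) h
    have hr1' : 0 < r - 1 := by linarith
    refine ⟨r ^ 3 / (r - 1), by positivity, fun ε p hε hp => ?_⟩
    have h1 : ∑ i ∈ Finset.range (p + 3), r ^ i ≤ r ^ 3 / (r - 1) * r ^ p := by
      rw [geom_sum_eq hr1.ne', div_mul_eq_mul_div]
      gcongr
      rw [← pow_add, add_comm 3 p]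
      linarith
    have h2 : r ^ p ≤ ε ^ (-a) := by
      have e1 : r ^ p = ((2 : ℝ) ^ p) ^ a := by
        rw [hr, ← Real.rpow_mul_natCast (by norm_num), mul_comm,
          Real.rpow_natCast_mul (by norm_num)]
      rw [e1, Real.rpow_neg hε.le, ← Real.inv_rpow hε.le]
      refine Real.rpow_le_rpow (by positivity) ?_ h.le
      rw [← one_div, le_div_iff₀ hε]
      exact hp
    have h3 : ε * ε ^ (-a) = ε ^ (1 - a) := by
      rw [sub_eq_add_neg, Real.rpow_add hε, Real.rpow_one]
    calc ε * ∑ i ∈ Finset.range (p + 3), r ^ i ≤ ε * (r ^ 3 / (r - 1) * ε ^ (-a)) := by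
          gcongr
          exact h1.trans (by gcongr)
      _ = r ^ 3 / (r - 1) * ε ^ (1 - a) := by rw [← h3]; ring
      _ ≤ _ := by gcongr; exact le_max_right _ _

/-- Counts the dyadic frequencies below 4·2^p in the critical case: p log 2 ≤ |log ε|, and log 2 >
1/3. -/
theorem natCast_add_three_le_log {ε : ℝ} (hε : 0 < ε) {p : ℕ} (hp : (2 : ℝ) ^ p * ε ≤ 1) :
    (p : ℝ) + 3 ≤ 3 * (1 + |Real.log ε|) := by
  have h1 : Real.log ((2 : ℝ) ^ p * ε) ≤ 0 := Real.log_nonpos (by positivity) hp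
  rw [Real.log_mul (by positivity) hε.ne', Real.log_pow] at h1
  have h2 := neg_le_abs (Real.log ε)
  have h3 := Real.log_two_gt_d9
  nlinarith [Nat.cast_nonneg (α := ℝ) p]

/-- All multipliers involved are built from dilates of one Schwartz symbol, whose bound does not
depend on the dilation; hence uniformity in j and ε. -/
theorem exists_dlNorm_dyadicSymbol_le {n : ℕ} (hn : 1 ≤ n) (m : ℕ) (χ : LPCutoff n) :
    ∃ C : ℝ, 0 < C ∧ ∀ (j : ℕ) (ε : ℝ), 0 < ε → ∀ μ : ℝ, 0 < μ → ∀ v : 𝓢'(Rn n, Cm m),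
      dlNorm μ (fourierMultiplierCLM (Cm m) (fun ξ => χ.dyadicSymbol j (ε • ξ))
        (v - fourierMultiplierCLM (Cm m) (χ.sym ε) v)) ≤ ENNReal.ofReal C * dlNorm μ v := by
  obtain ⟨C, hC, H⟩ := χ.exists_dlNorm_sym_le hn m
  refine ⟨2 * C * (1 + C), by positivity, fun j ε hε μ hμ v => ?_⟩
  have hQ : dlNorm μ (v - fourierMultiplierCLM (Cm m) (χ.sym ε) v) ≤
      ENNReal.ofReal (1 + C) * dlNorm μ v := by
    refine (dlNorm_sub_le hμ _ _).trans ((add_le_add le_rfl (H ε hε μ hμ v)).trans (le_of_eq ?_))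
    rw [ENNReal.ofReal_add (by norm_num) hC.le, ENNReal.ofReal_one, add_mul, one_mul]
  have hP : ∀ w : 𝓢'(Rn n, Cm m),
      dlNorm μ (fourierMultiplierCLM (Cm m) (fun ξ => χ.dyadicSymbol j (ε • ξ)) w) ≤
        ENNReal.ofReal (2 * C) * dlNorm μ w := by
    intro w
    cases j with
    | zero =>
      have e : (fun ξ => χ.dyadicSymbol 0 (ε • ξ)) = χ.sym (((2 : ℝ) ^ 0)⁻¹ * ε) := by
        ext ξ
        exact χ.sym_smul _ _ _
      rw [e]
      refine (H _ (by positivity) μ hμ w).trans ?_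
      gcongr
      linarith
    | succ j =>
      have e : (fun ξ => χ.dyadicSymbol (j + 1) (ε • ξ)) =
          χ.sym (((2 : ℝ) ^ (j + 1))⁻¹ * ε) - χ.sym (((2 : ℝ) ^ j)⁻¹ * ε) := by
        ext ξ
        rw [Pi.sub_apply, ← χ.sym_smul, ← χ.sym_smul]
        rfl
      rw [e, fourierMultiplierCLM_sub_symbol (χ.hasTemperateGrowth_sym (by positivity))
        (χ.hasTemperateGrowth_sym (by positivity))]
      refine (dlNorm_sub_le hμ _ _).trans ((add_le_add (H _ (by positivity) μ hμ w)
        (H _ (by positivity) μ hμ w)).trans (le_of_eq ?_))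
      rw [← two_mul, ← mul_assoc, ENNReal.ofReal_mul (by norm_num), ENNReal.ofReal_ofNat]
  refine (hP _).trans ((mul_le_mul' le_rfl hQ).trans (le_of_eq ?_))
  rw [← mul_assoc, ← ENNReal.ofReal_mul (by positivity)]

theorem exists_dhNorm_high_le {n : ℕ} (hn : 1 ≤ n) (m : ℕ) {s : ℝ} (hs : 0 ≤ s)
    (χ : LPCutoff n) :
    ∃ C : ℝ, 0 ≤ C ∧ ∀ (u : 𝓢'(Rn n, Cm m)) (ε : ℝ) (hε : 0 < ε), ε ≤ 1 →
      dhNorm χ s (χ.high (rescale ε hε u)) ≤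
        ENNReal.ofReal (C * ε ^ (s - (n : ℝ) / 2)) * dhNorm χ s u := by
  obtain ⟨C₁, hC₁, H₁⟩ := exists_dlNorm_dyadicSymbol_le hn m χ
  obtain ⟨C₂, hC₂, H₂⟩ := exists_dlNorm_le_scale n m (B := 2) (by norm_num)
  set K : ℝ := C₁ * C₂ * 2 * (4 : ℝ) ^ s with hK
  have hK0 : 0 ≤ K := by positivity
  refine ⟨8 * K, by positivity, fun u ε hε hε1 => ?_⟩
  obtain ⟨p, hp1, hp2⟩ := exists_dyadic_near hε hε1
  set f : ℕ → ℝ≥0∞ := fun i => ENNReal.ofReal (((2 : ℝ) ^ i) ^ s) *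
    dlNorm ((2 : ℝ) ^ i) (χ.piece i u) with hf
  have hj : ∀ j : ℕ, ENNReal.ofReal (((2 : ℝ) ^ j) ^ s) *
      dlNorm ((2 : ℝ) ^ j) (χ.piece j (χ.high (rescale ε hε u))) ≤
      ENNReal.ofReal (K * ε ^ (s - (n : ℝ) / 2)) *
        ∑ i ∈ Finset.Icc (j + p - 1) (j + p + 2), f i := by
    intro j
    have h2j : (0 : ℝ) < 2 ^ j := by positivity
    have hμ : 0 < ε * (2 : ℝ) ^ j := by positivity
    rw [χ.piece_high_rescale hε hp1 hp2]
    refine (mul_le_mul' le_rfl ((dlNorm_rescale_le hε h2j _).trans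
      (mul_le_mul' le_rfl (dlNorm_sum_le hμ _ _)))).trans ?_
    rw [Finset.mul_sum, Finset.mul_sum, Finset.mul_sum]
    refine Finset.sum_le_sum fun i hi => ?_
    rw [Finset.mem_Icc] at hi
    have h2i : (0 : ℝ) < 2 ^ i := by positivity
    have hup : (2 : ℝ) ^ i * ε ≤ 4 * 2 ^ j := by
      have : (2 : ℝ) ^ i ≤ 2 ^ (j + p + 2) := pow_le_pow_right₀ (by norm_num) hi.2
      calc (2 : ℝ) ^ i * ε ≤ 2 ^ (j + p + 2) * ε := by gcongr
        _ = 4 * 2 ^ j * (2 ^ p * ε) := by ring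
        _ ≤ 4 * 2 ^ j * 1 := by gcongr
        _ = _ := mul_one _
    have hjp : (2 : ℝ) ^ j * 2 ^ p ≤ 2 * 2 ^ i := by
      rw [← pow_add, ← pow_succ']
      exact pow_le_pow_right₀ (by norm_num) (by omega)
    have hscale : ε * (2 : ℝ) ^ j ≤ 2 * 2 ^ i := by
      calc ε * (2 : ℝ) ^ j ≤ 1 * 2 ^ j := by gcongr
        _ ≤ 2 ^ j * 2 ^ p := by
            rw [one_mul]; exact le_mul_of_one_le_right h2j.le (one_le_pow₀ (by norm_num))
        _ ≤ _ := hjp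
    have hdown : (2 : ℝ) ^ j ≤ 4 * ε * 2 ^ i := by
      calc (2 : ℝ) ^ j ≤ 2 ^ j * (2 ^ (p + 1) * ε) := le_mul_of_one_le_right h2j.le hp2
        _ = 2 * ε * (2 ^ j * 2 ^ p) := by ring
        _ ≤ 2 * ε * (2 * 2 ^ i) := by gcongr
        _ = _ := by ring
    refine (mul_le_mul' le_rfl (mul_le_mul' le_rfl ((H₁ j ε hε _ hμ _).trans
      (mul_le_mul' le_rfl (H₂ _ _ hμ h2i hscale _))))).trans ?_
    rw [hf]
    simp only []
    rw [← mul_assoc, ← mul_assoc, ← mul_assoc, ← mul_assoc, ← ENNReal.ofReal_mul (by positivity),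
      ← ENNReal.ofReal_mul (by positivity), ← ENNReal.ofReal_mul (by positivity),
      ← ENNReal.ofReal_mul (by positivity)]
    refine mul_le_mul' (ENNReal.ofReal_le_ofReal ?_) le_rfl
    -- The loss in the radius: 2^i is at most 4·2^j/ε, so the quotient of the radii is at most 4/ε².
    have hroot : ((2 : ℝ) ^ i / (ε * 2 ^ j)) ^ (1 / 2 : ℝ) ≤ 2 / ε := by
      rw [← Real.sqrt_eq_rpow, Real.sqrt_le_left (by positivity), div_pow,
        div_le_div_iff₀ hμ (by positivity)]
      nlinarith
    -- The gain in the weight: output frequency 2^j comes from 2^i ≳ 2^j/ε, and s ≥ 0.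
    have hpow : ((2 : ℝ) ^ j) ^ s ≤ 4 ^ s * ε ^ s * (2 ^ i) ^ s := by
      rw [← Real.mul_rpow (by norm_num) hε.le, ← Real.mul_rpow (by positivity) h2i.le]
      exact Real.rpow_le_rpow h2j.le hdown hs
    have he : ε ^ (s - (n : ℝ) / 2) = ε ^ s * ε ^ (1 - (n : ℝ) / 2) * ε⁻¹ := by
      rw [← Real.rpow_neg_one, ← Real.rpow_add hε, ← Real.rpow_add hε]
      congr 1
      ring
    calc ((2 : ℝ) ^ j) ^ s * ε ^ (1 - (n : ℝ) / 2) * C₁ *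
          (C₂ * ((2 : ℝ) ^ i / (ε * 2 ^ j)) ^ (1 / 2 : ℝ))
        ≤ (4 ^ s * ε ^ s * (2 ^ i) ^ s) * ε ^ (1 - (n : ℝ) / 2) * C₁ * (C₂ * (2 / ε)) := by
          gcongr
      _ = K * ε ^ (s - (n : ℝ) / 2) * (2 ^ i) ^ s := by
          rw [he, hK]; ring
  rw [dhNorm_eq]
  calc (∑' j : ℕ, (ENNReal.ofReal (((2 : ℝ) ^ j) ^ s) *
        dlNorm ((2 : ℝ) ^ j) (χ.piece j (χ.high (rescale ε hε u)))) ^ 2) ^ (1 / 2 : ℝ)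
      ≤ (∑' j : ℕ, (ENNReal.ofReal (K * ε ^ (s - (n : ℝ) / 2)) *
        ∑ i ∈ Finset.Icc (j + p - 1) (j + p + 2), f i) ^ 2) ^ (1 / 2 : ℝ) := by
        refine ENNReal.rpow_le_rpow (ENNReal.tsum_le_tsum fun j => ?_) (by norm_num)
        exact pow_le_pow_left' (hj j) 2
    _ ≤ (ENNReal.ofReal (K * ε ^ (s - (n : ℝ) / 2)) ^ 2 * (64 * ∑' i, f i ^ 2)) ^ (1 / 2 : ℝ) := by
        gcongr
        simp_rw [mul_pow]
        rw [ENNReal.tsum_mul_left]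
        gcongr
        exact tsum_sq_sum_Icc_le f p
    _ = _ := by
        have h64 : (64 : ℝ≥0∞) ^ (1 / 2 : ℝ) = 8 := by
          rw [show (64 : ℝ≥0∞) = 8 ^ 2 by norm_num, ← ENNReal.rpow_two, ← ENNReal.rpow_mul]
          norm_num
        rw [dhNorm_eq, ENNReal.mul_rpow_of_nonneg _ _ (by norm_num),
          ENNReal.mul_rpow_of_nonneg _ _ (by norm_num), h64, ← ENNReal.rpow_two,
          ← ENNReal.rpow_mul, ← mul_assoc, mul_assoc 8 K,
          ENNReal.ofReal_mul (by norm_num : (0 : ℝ) ≤ 8)]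
        norm_num
        ring

/-! ### Collecting the constants -/

theorem ofReal_mul_le_coe_mul {c C x : ℝ} {M : ℝ≥0∞} (hc : 0 ≤ c) (hcC : c ≤ C) :
    ENNReal.ofReal (c * x) * M ≤ (C.toNNReal : ℝ≥0∞) * ENNReal.ofReal x * M := by
  rw [ENNReal.ofReal_mul hc]
  refine mul_le_mul' (mul_le_mul' ?_ le_rfl) le_rfl
  exact ENNReal.ofReal_le_ofReal hcC

end DLSpace

end

theorem mainTheorem7 (n m : ℕ) (hn : 1 ≤ n) (s : ℝ) (hs : (n : ℝ) / 2 < s)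
    (χ : DLSpace.LPCutoff n) :
    ∃ C : ℝ≥0, ∀ u₀ : 𝓢'(DLSpace.Rn n, DLSpace.Cm m), DLSpace.dhNorm χ s u₀ < ∞ →
      ∀ (ε : ℝ) (hε : 0 < ε), ε ≤ 1 →
        DLSpace.linftyNorm (χ.low (DLSpace.rescale ε hε u₀)) +
            DLSpace.linftyNorm (χ.high (DLSpace.rescale ε hε u₀))
          ≤ C * ENNReal.ofReal ε * DLSpace.dhNorm χ s u₀ ∧
        DLSpace.dlNorm 1 (χ.low (DLSpace.rescale ε hε u₀)) ≤ C * DLSpace.dhNorm χ s u₀ ∧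
        (s ≠ (n : ℝ) / 2 + 1 →
          DLSpace.dlGradNorm 1 (χ.low (DLSpace.rescale ε hε u₀))
            ≤ C * ENNReal.ofReal (max ε (ε ^ (s - (n : ℝ) / 2))) * DLSpace.dhNorm χ s u₀) ∧
        (s = (n : ℝ) / 2 + 1 →
          DLSpace.dlGradNorm 1 (χ.low (DLSpace.rescale ε hε u₀))
            ≤ C * ENNReal.ofReal (ε * (1 + |Real.log ε|)) * DLSpace.dhNorm χ s u₀) ∧
        DLSpace.dhNorm χ s (χ.high (DLSpace.rescale ε hε u₀))
          ≤ C * ENNReal.ofReal (ε ^ (s - (n : ℝ) / 2)) * DLSpace.dhNorm χ s u₀ := by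
  have hs0 : 0 ≤ s := le_trans (by positivity) hs.le
  obtain ⟨C₁, hC₁, H₁⟩ := DLSpace.exists_linftyNorm_le hn m hs χ
  obtain ⟨C₂, hC₂, H₂⟩ := DLSpace.exists_dlNorm_low_le hn m hs χ
  obtain ⟨C₃, hC₃, H₃⟩ := DLSpace.exists_dlGradNorm_low_le hn m s χ
  -- The constant must be fixed before the case distinction; at the critical exponent the claim is
  -- vacuous and 0 will do.
  obtain ⟨C₄, hC₄, H₄⟩ : ∃ C : ℝ, 0 ≤ C ∧ (s ≠ (n : ℝ) / 2 + 1 → ∀ (ε : ℝ) (p : ℕ), 0 < ε →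
      (2 : ℝ) ^ p * ε ≤ 1 →
      ε * ∑ i ∈ Finset.range (p + 3), ((2 : ℝ) ^ ((n : ℝ) / 2 + 1 - s)) ^ i ≤
        C * max ε (ε ^ (s - (n : ℝ) / 2))) := by
    by_cases h : s = (n : ℝ) / 2 + 1
    · exact ⟨0, le_rfl, fun h' => absurd h h'⟩
    · obtain ⟨C, hC, H⟩ := DLSpace.exists_geometric_le_max (a := (n : ℝ) / 2 + 1 - s)
        fun h' => h (by linarith)
      refine ⟨C, hC, fun _ ε p hε hp => ?_⟩
      have := H ε p hε hp
      rwa [show 1 - ((n : ℝ) / 2 + 1 - s) = s - (n : ℝ) / 2 by ring] at this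
  obtain ⟨C₅, hC₅, H₅⟩ := DLSpace.exists_dhNorm_high_le hn m hs0 χ
  have h34 : 0 ≤ C₃ * C₄ := mul_nonneg hC₃ hC₄
  refine ⟨(C₁ + C₂ + C₃ * C₄ + C₃ * 3 + C₅).toNNReal, fun u₀ _ ε hε hε1 => ?_⟩
  obtain ⟨p, hp1, hp2⟩ := DLSpace.exists_dyadic_near hε hε1
  refine ⟨?_, ?_, fun hne => ?_, fun heq => ?_, ?_⟩
  · exact (H₁ u₀ ε hε hε1).trans (DLSpace.ofReal_mul_le_coe_mul hC₁ (by linarith))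
  · exact (H₂ u₀ ε hε hε1).trans
      (mul_le_mul' (ENNReal.ofReal_le_ofReal (by linarith)) le_rfl)
  · refine (H₃ u₀ ε hε p hp1 hp2).trans (le_trans (mul_le_mul' (ENNReal.ofReal_le_ofReal ?_) le_rfl)
      (DLSpace.ofReal_mul_le_coe_mul h34 (by linarith)))
    rw [mul_assoc, mul_assoc]
    exact mul_le_mul_of_nonneg_left (H₄ hne ε p hε hp1) hC₃
  · refine (H₃ u₀ ε hε p hp1 hp2).trans (le_trans (mul_le_mul' (ENNReal.ofReal_le_ofReal ?_) le_rfl)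
      (DLSpace.ofReal_mul_le_coe_mul (c := C₃ * 3) (by linarith) (by linarith)))
    -- At the critical exponent the geometric ratio is 1, and the sum is the number p + 3 of its
    -- terms.
    rw [heq, sub_self, Real.rpow_zero]
    simp only [one_pow, Finset.sum_const, Finset.card_range, nsmul_eq_mul, mul_one]
    push_cast
    have := DLSpace.natCast_add_three_le_log hε hp1
    calc C₃ * ε * ((p : ℝ) + 3) ≤ C₃ * ε * (3 * (1 + |Real.log ε|)) := by gcongr
      _ = _ := by ring
  · exact (H₅ u₀ ε hε hε1).trans (DLSpace.ofReal_mul_le_coe_mul hC₅ (by linarith))
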